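/- **Setting.** Let $d,m\ge 1$. Let $B$ be a real $d\times d$ matrix all of whose (complex) eigenvalues have modulus $>1$, let $q=|\det B|$, let $d_1,\dots,d_m\in\mathbb R^d$, and put $S_i(x)=B^{-1}(x+d_i)$. The self-affine set $K$ is the non-empty compact set with $K=\bigcup_i S_i(K)$; it is *dust-like* if $S_i(K)\cap S_j(K)=\emptyset$ for $i\ne j$. For a word $u=i_1\cdots i_n$ over $\Sigma=\{1,\dots,m\}$ write $S_u=S_{i_1}\circ\cdots\circ S_{i_n}$ and $E_u=S_u(E)$ for $E\subseteq\mathbb R^d$. *Augmented tree.* Fix a non-empty bounded closed set $J$ with $S_i(J)\subseteq J$ for all $i$. Let $X=\bigcup_{n\ge0}\Sigma^n$, let $\mathcal E_v$ be the edges $\{u,ui\}$ (vertical), let $\mathcal E_h$ be the edges $\{u,v\}$ with $|u|=|v|$, $u\neq v$, $J_u\cap J_v\ne\emptyset$ (horizontal), and let $\mathcal E=\mathcal E_v\cup\mathcal E_h$. A horizontal component is a connected component $T$ of $(X,\mathcal E_h)$; let $T\Sigma=\{ui:u\in T,\,i\in\Sigma\}$. Two components $T,T'$ are equivalent if there is a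 bijection $T\cup T\Sigma\to T'\cup T'\Sigma$ that preserves, together with its inverse, vertical and horizontal edges. The tree is *simple* if there are finitely many equivalence classes $\mathscr T_1,\dots,\mathscr T_r$. Then $b_i$ is the number of elements of any component of class $\mathscr T_i$, $\mathbf b=[b_1,\dots,b_r]^t$, and the incidence matrix $A=[a_{ij}]$ is the matrix such that, for every component $T$ of class $\mathscr T_i$, exactly $a_{ij}$ of the components contained in $T\Sigma$ have class $\mathscr T_j$ (it is supposed that this number depends only on the class of $T$). *Rearrangeable.* A nonnegative integral $r\times r$ matrix is $(m,\mathbf b)$-rearrangeable if for each of its rows $\mathbf a$ there are $p\geq1$ and a nonnegative integral $p\times r$ matrix $C$ with $\mathbf a=[1,\dots,1]C$ and $C\mathbf b=[m,\dots,m]^t$. It is primitive if some positive power of it has only positive entries. *Hyperbolic boundary.* Let $G$ be one of the graphs $(X,\mathcal E)$, $(X,\mathcal E_v)$, with graph distance $\mathrm{dist}$ and the empty word $o$ as root. Put $|x\wedge y|=\frac12(\mathrm{dist}(o,x)+\mathrm{dist}(o,y)-\mathrm{dist}(x,y))$. $G$ is $\delta$-hyperbolic if $|x\wedge y|\ge\min\{|x\wedge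 z|,|z\wedge y|\}-\delta$ for all $x,y,z$. For $a>0$ let $\rho_a(x,y)=e^{-a|x\wedge y|}$ for $x\ne y$, $\rho_a(x,x)=0$, and let $\theta_a(x,y)$ be the infimum of $\sum_{i=1}^n\rho_a(x_{i-1},x_i)$ over all chains $x=x_0,\dots,x_n=y$, $n\geq1$. The boundary $\partial G$ is the completion of $(X,\theta_a)$ minus $X$, with the metric $\theta_a$ (which is comparable to $\rho_a$ when $e^{\delta a}-1<\sqrt2-1$). A near-isometry is a bijection between vertex sets that changes graph distances by at most a constant. For symmetric distance functions $\rho,\rho'$ on sets $Y,Y'$ we write $(Y,\rho)\simeq(Y',\rho')$ (Lipschitz equivalent) if there are a bijection $\sigma:Y\to Y'$ and $C>0$ with $C^{-1}\rho(x,y)\le\rho'(\sigma x,\sigma y)\le C\rho(x,y)$ for all $x,y$. *Ultra-metric.* Choose a norm $\|\cdot\|$ on $\mathbb R^d$ with $\|x\|\le\|Bx\|$ for all $x$, a number $0<\delta<1/2$, and an even $C^\infty$ function $\varphi\ge0$ that vanishes outside $U_\delta=\{\|x\|<\delta\}$, has $0$ in its (closed) support, and satisfies $\int\varphi=1$. With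 $V=BU_1\setminus U_1$ and $h=\chi_V*\varphi$ put $$w(x)=\sum_{n=-\infty}^{\infty}q^{-n/d}\,h(B^nx).$$ Subsets of $\mathbb R^d$ carry the distance $w(x-y)$. Condition (H): there is $c>0$ such that for all $n\ge1$ and $u,v\in\Sigma^n$, $K_u\cap K_v=\emptyset$ implies $w(x-y)\ge cq^{-n/d}$ for all $x\in K_u$, $y\in K_v$. **Theorem.** (1) Suppose that $(X,\mathcal E)$ is simple and that its incidence matrix $A$ is $(m,\mathbf b)$-rearrangeable or primitive. Then $(X,\mathcal E)$ is hyperbolic, and $\partial(X,\mathcal E)\simeq\partial(X,\mathcal E_v)$ for every $a>0$ for which $(X,\mathcal E)$ is $\delta$-hyperbolic for some $\delta>0$ with $e^{\delta a}-1<\sqrt2-1$. If $A$ is $(m,\mathbf b)$-rearrangeable, there is a near-isometry from $(X,\mathcal E)$ onto $(X,\mathcal E_v)$. If $A$ is primitive, $A^k$ is $(m^k,\mathbf b)$-rearrangeable for some $k\geq1$. (2) Let $K$ and $K'$ be self-affine sets in $\mathbb R^d$ given by systems as above with the same number $m$ of maps and with expanding matrices $B,B'$ satisfying $|\det B|=|\det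 B'|$ (for instance $B=B'$), with $w,w'$ constructed from $B,B'$ as above (for instance $w=w'$ if $B=B'$). Suppose that both satisfy condition (H), that (for some choice of $J$, $J'$) both augmented trees are simple, and that each incidence matrix is rearrangeable (with respect to $m$ and its own size vector) or primitive. Then $(K,w)\simeq(K',w')$. Moreover there are an expanding $d\times d$ matrix $B''$ with $|\det B''|=|\det B|$, a function $w''$ constructed from $B''$ as above, and a dust-like self-affine set $K''$ of a system of $m$ maps $x\mapsto (B'')^{-1}(x+d_i'')$ such that $(K,w)\simeq(K'',w'')\simeq(K',w')$. -/

import Mathlib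

open scoped Matrix ContDiff

noncomputable section

/-! ### Lipschitz equivalence and near-isometries -/

/-- `σ` is a bijection which is bi-Lipschitz for the distance functions `ρ` and `ρ'`
(these need not satisfy the triangle inequality). -/
def LipschitzEquivalent {α β : Type*} (ρ : α → α → ℝ) (ρ' : β → β → ℝ) : Prop :=
  ∃ σ : α ≃ β, ∃ C : ℝ, 0 < C ∧
    ∀ x y, C⁻¹ * ρ x y ≤ ρ' (σ x) (σ y) ∧ ρ' (σ x) (σ y) ≤ C * ρ x y

/-- A bijection between two graphs that changes the graph distances by a bounded amount. -/
def IsNearIsometry {V W : Type*} (G : SimpleGraph V) (H : SimpleGraph W) (σ : V ≃ W) : Prop :=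
  ∃ c : ℝ, 0 < c ∧ ∀ x y, |(H.dist (σ x) (σ y) : ℝ) - (G.dist x y : ℝ)| ≤ c

/-! ### Hyperbolic graphs and the hyperbolic boundary -/

section Hyperbolic

variable {V : Type*}

/-- The Gromov product `|x ∧ y|` with respect to the root `o`. -/
def gromovProduct (G : SimpleGraph V) (o x y : V) : ℝ :=
  ((G.dist o x : ℝ) + (G.dist o y : ℝ) - (G.dist x y : ℝ)) / 2

/-- The hyperbolicity inequality with constant `δ`. -/
def IsHyperbolicWith (G : SimpleGraph V) (o : V) (δ : ℝ) : Prop :=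
  ∀ x y z, min (gromovProduct G o x z) (gromovProduct G o z y) - δ ≤ gromovProduct G o x y

open Classical in
/-- The ultra-metric `ρ_a(x, y) = exp (-a |x ∧ y|)` for `x ≠ y`, and `ρ_a(x, x) = 0`. -/
def rhoA (G : SimpleGraph V) (o : V) (a : ℝ) (x y : V) : NNReal :=
  if x = y then 0 else Real.toNNReal (Real.exp (-a * gromovProduct G o x y))

theorem rhoA_self (G : SimpleGraph V) (o : V) (a : ℝ) (x : V) : rhoA G o a x x = 0 := by
  simp [rhoA]

theorem rhoA_comm (G : SimpleGraph V) (o : V) (a : ℝ) (x y : V) :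
    rhoA G o a x y = rhoA G o a y x := by
  have h : gromovProduct G o x y = gromovProduct G o y x := by
    unfold gromovProduct
    rw [SimpleGraph.dist_comm (u := x) (v := y)]
    ring
  by_cases hxy : x = y
  · subst hxy
    rfl
  · unfold rhoA
    rw [h, if_neg hxy, if_neg (Ne.symm hxy)]

/-- The vertex set of `G`, to be equipped with the path metric `θ_a`. -/
def VisualSpace (_G : SimpleGraph V) (_o : V) (_a : ℝ) : Type _ := V

/-- The path metric `θ_a(x, y) = inf ∑ ρ_a(x_{i-1}, x_i)`, the infimum being over all finite chains
`x = x_0, x_1, …, x_n = y`, `n ≥ 1`. -/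
instance (G : SimpleGraph V) (o : V) (a : ℝ) : PseudoMetricSpace (VisualSpace G o a) :=
  PseudoMetricSpace.ofPreNNDist (X := V) (rhoA G o a) (rhoA_self G o a) (rhoA_comm G o a)

/-- The hyperbolic boundary: the points which the completion adds to the graph.  It carries the
metric `θ_a` of the completion, which is comparable to (any extension of) `ρ_a` if `G` is
`δ`-hyperbolic and `exp (δ a) - 1 < √2 - 1`. -/
abbrev HyperbolicBoundary (G : SimpleGraph V) (o : V) (a : ℝ) : Type _ :=
  {ξ : UniformSpace.Completion (VisualSpace G o a) //
    ξ ∉ Set.range ((↑) : VisualSpace G o a → UniformSpace.Completion (VisualSpace G o a))}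

end Hyperbolic

/-! ### The augmented tree of an iterated function system -/

section AugmentedTree

variable {E : Type*} {m : ℕ}

/-- `S_u = S_{i_1} ∘ ⋯ ∘ S_{i_n}` for the word `u = i_1 ⋯ i_n`. -/
def wordMap (S : Fin m → E → E) : List (Fin m) → E → E
  | [] => id
  | i :: u => S i ∘ wordMap S u

/-- The cell `J_u = S_u(J)`. -/
def cell (S : Fin m → E → E) (J : Set E) (u : List (Fin m)) : Set E := wordMap S u '' J

/-- The vertical edges `u — ui` of the tree of all finite words, with root the empty word. -/
def verticalGraph (m : ℕ) : SimpleGraph (List (Fin m)) where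
  Adj u v := (∃ i, v = u ++ [i]) ∨ ∃ i, u = v ++ [i]
  symm := ⟨fun _ _ h => h.symm⟩
  loopless := ⟨by rintro u (⟨i, h⟩ | ⟨i, h⟩) <;> simp at h⟩

/-- The horizontal edges: distinct words of the same length whose `J`-cells meet. -/
def horizontalGraph (S : Fin m → E → E) (J : Set E) : SimpleGraph (List (Fin m)) where
  Adj u v := u.length = v.length ∧ u ≠ v ∧ (cell S J u ∩ cell S J v).Nonempty
  symm := ⟨fun _ _ h => ⟨h.1.symm, h.2.1.symm, by rw [Set.inter_comm]; exact h.2.2⟩⟩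
  loopless := ⟨fun _ h => h.2.1 rfl⟩

/-- The augmented tree `(X, E_v ∪ E_h)`. -/
def augmentedTree (S : Fin m → E → E) (J : Set E) : SimpleGraph (List (Fin m)) :=
  verticalGraph m ⊔ horizontalGraph S J

/-- Horizontal connected components (each of them lies in a single level). -/
abbrev HComponent (S : Fin m → E → E) (J : Set E) : Type :=
  (horizontalGraph S J).ConnectedComponent

/-- The set `TΣ` of offsprings of a set `T` of words. -/
def offspring (T : Set (List (Fin m))) : Set (List (Fin m)) := {v | ∃ u ∈ T, ∃ i, v = u ++ [i]}

/-- The vertex set `T ∪ TΣ`. -/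
def family (S : Fin m → E → E) (J : Set E) (T : HComponent S J) : Set (List (Fin m)) :=
  T.supp ∪ offspring T.supp

/-- Two horizontal components are equivalent if there is a bijection `T ∪ TΣ → T' ∪ T'Σ` such that
it and its inverse preserve vertical and horizontal edges. -/
def componentSetoid (S : Fin m → E → E) (J : Set E) : Setoid (HComponent S J) where
  r T T' := ∃ g : family S J T ≃ family S J T',
    (∀ x y, (verticalGraph m).Adj (g x) (g y) ↔ (verticalGraph m).Adj (x : List (Fin m)) y) ∧
    (∀ x y, (horizontalGraph S J).Adj (g x) (g y) ↔
      (horizontalGraph S J).Adj (x : List (Fin m)) y)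
  iseqv :=
    { refl := fun _ => ⟨Equiv.refl _, fun _ _ => Iff.rfl, fun _ _ => Iff.rfl⟩
      symm := by
        rintro _ _ ⟨g, h1, h2⟩
        exact ⟨g.symm, fun x y => by simpa using (h1 (g.symm x) (g.symm y)).symm,
          fun x y => by simpa using (h2 (g.symm x) (g.symm y)).symm⟩
      trans := by
        rintro _ _ _ ⟨g, h1, h2⟩ ⟨k, h3, h4⟩
        exact ⟨g.trans k, fun x y => (h3 (g x) (g y)).trans (h1 x y),
          fun x y => (h4 (g x) (g y)).trans (h2 x y)⟩ }

/-- The set of connected classes. -/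
abbrev ConnectedClass (S : Fin m → E → E) (J : Set E) : Type := Quotient (componentSetoid S J)

/-- The connected class `[T]`. -/
def connectedClass {S : Fin m → E → E} {J : Set E} (T : HComponent S J) : ConnectedClass S J :=
  Quotient.mk (componentSetoid S J) T

/-- The augmented tree is simple if there are finitely many connected classes. -/
def IsSimpleTree (S : Fin m → E → E) (J : Set E) : Prop := Finite (ConnectedClass S J)

/-- `A` is the incidence matrix for the labelling `e` of the connected classes: for every
component `T` of class `i`, the number of components of class `j` contained in `TΣ` is `a_{ij}`. -/
def IsIncidenceMatrix (S : Fin m → E → E) (J : Set E) {r : ℕ} (e : ConnectedClass S J ≃ Fin r)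
    (A : Matrix (Fin r) (Fin r) ℕ) : Prop :=
  ∀ (T : HComponent S J) (j : Fin r), A (e (connectedClass T)) j =
    Set.ncard {Z : HComponent S J | Z.supp ⊆ offspring T.supp ∧ e (connectedClass Z) = j}

/-- `b_i` is the number of words in any component of class `i`. -/
def IsSizeVector (S : Fin m → E → E) (J : Set E) {r : ℕ} (e : ConnectedClass S J ≃ Fin r)
    (b : Fin r → ℕ) : Prop :=
  ∀ T : HComponent S J, b (e (connectedClass T)) = T.supp.ncard

end AugmentedTree

/-! ### Rearrangeable and primitive matrices -/

/-- A row vector `a` is `(m, b)`-rearrangeable. -/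
def IsRearrangeableRow {r : ℕ} (m : ℕ) (b a : Fin r → ℕ) : Prop :=
  ∃ p : ℕ, 0 < p ∧ ∃ C : Matrix (Fin p) (Fin r) ℕ,
    a = (fun _ => 1) ᵥ* C ∧ C *ᵥ b = fun _ => m

/-- A matrix is `(m, b)`-rearrangeable if all its rows are. -/
def IsRearrangeable {r : ℕ} (m : ℕ) (b : Fin r → ℕ) (A : Matrix (Fin r) (Fin r) ℕ) : Prop :=
  ∀ i, IsRearrangeableRow m b (A i)

/-- A primitive matrix: `A ^ n > 0` entrywise for some `n > 0`. -/
def IsPrimitiveMatrix {r : ℕ} (A : Matrix (Fin r) (Fin r) ℕ) : Prop :=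
  ∃ n : ℕ, 0 < n ∧ ∀ i j, 0 < (A ^ n) i j

/-! ### Self-affine iterated function systems -/

section SelfAffine

variable {d m : ℕ}

/-- All complex eigenvalues of `B` have modulus greater than `1`. -/
def IsExpanding (B : Matrix (Fin d) (Fin d) ℝ) : Prop :=
  ∀ z ∈ spectrum ℂ (B.map (algebraMap ℝ ℂ)), 1 < ‖z‖

/-- The maps `S_i(x) = B⁻¹ (x + d_i)`. -/
def affineIFS (B : Matrix (Fin d) (Fin d) ℝ) (D : Fin m → Fin d → ℝ) :
    Fin m → (Fin d → ℝ) → (Fin d → ℝ) :=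
  fun i x => B⁻¹ *ᵥ (x + D i)

/-- `K` is the attractor: the non-empty compact set with `K = ⋃ S_i(K)`. -/
def IsAttractor (S : Fin m → (Fin d → ℝ) → (Fin d → ℝ)) (K : Set (Fin d → ℝ)) : Prop :=
  K.Nonempty ∧ IsCompact K ∧ K = ⋃ i, S i '' K

/-- `J` is a (non-empty) bounded closed invariant set: `S_i(J) ⊆ J` for each `i`. -/
def IsBoundedInvariant (S : Fin m → (Fin d → ℝ) → (Fin d → ℝ)) (J : Set (Fin d → ℝ)) : Prop :=
  J.Nonempty ∧ IsClosed J ∧ Bornology.IsBounded J ∧ ∀ i, S i '' J ⊆ J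

/-- The system is strongly separated, that is, its attractor `K` is dust-like. -/
def IsDustLike (S : Fin m → (Fin d → ℝ) → (Fin d → ℝ)) (K : Set (Fin d → ℝ)) : Prop :=
  ∀ i j, i ≠ j → Disjoint (S i '' K) (S j '' K)

/-- The choices in the construction of the ultra-metric adapted to `B`: a norm `N` on `ℝ^d` with
`N x ≤ N (B x)`, a number `0 < δ < 1/2`, and a mollifier `φ` supported in the ball
`U_δ = {N < δ}`. -/
structure AdaptedData (B : Matrix (Fin d) (Fin d) ℝ) where
  N : Seminorm ℝ (Fin d → ℝ)
  eq_zero_of_N : ∀ x, N x = 0 → x = 0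
  N_le : ∀ x, N x ≤ N (B *ᵥ x)
  δ : ℝ
  δ_pos : 0 < δ
  δ_lt : δ < 1 / 2
  φ : (Fin d → ℝ) → ℝ
  φ_smooth : ContDiff ℝ ∞ φ
  φ_nonneg : ∀ x, 0 ≤ φ x
  φ_even : ∀ x, φ (-x) = φ x
  φ_support : Function.support φ ⊆ {x | N x < δ}
  zero_mem_tsupport : (0 : Fin d → ℝ) ∈ tsupport φ
  φ_integral : ∫ x, φ x = 1

namespace AdaptedData

variable {B : Matrix (Fin d) (Fin d) ℝ} (W : AdaptedData B)

/-- The open unit ball `U_1` of the norm. -/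
def unitBall : Set (Fin d → ℝ) := {x | W.N x < 1}

/-- `V = B U_1 \ U_1`. -/
def shell : Set (Fin d → ℝ) := ((fun x => B *ᵥ x) '' W.unitBall) \ W.unitBall

/-- `h = χ_V ∗ φ`. -/
def h (x : Fin d → ℝ) : ℝ := ∫ y, W.shell.indicator (fun _ => (1 : ℝ)) (x - y) * W.φ y

/-- `w(x) = ∑_{n ∈ ℤ} q^{-n/d} h(B^n x)` with `q = |det B|`.  For expanding `B` only finitely many
terms of the sum are non-zero. -/
def w (x : Fin d → ℝ) : ℝ :=
  ∑' n : ℤ, |B.det| ^ (-(n : ℝ) / (d : ℝ)) * W.h ((B ^ n) *ᵥ x)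

/-- `w(x - y)` as a distance function on a subset `K` of `ℝ^d`. -/
def wDist (K : Set (Fin d → ℝ)) (x y : K) : ℝ := W.w ((x : Fin d → ℝ) - y)

/-- Condition (H) for `w`: there is `c > 0` such that, for all `n ≥ 1` and all words `u, v` of
length `n`, `dist_w(K_u, K_v) ≥ c q^{-n/d}` unless `K_u` and `K_v` meet. -/
def ConditionH (S : Fin m → (Fin d → ℝ) → (Fin d → ℝ)) (K : Set (Fin d → ℝ)) : Prop :=
  ∃ c : ℝ, 0 < c ∧ ∀ n : ℕ, 1 ≤ n → ∀ u v : List (Fin m), u.length = n → v.length = n →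
    cell S K u ∩ cell S K v = ∅ →
      ∀ x ∈ cell S K u, ∀ y ∈ cell S K v, c * |B.det| ^ (-(n : ℝ) / (d : ℝ)) ≤ W.w (x - y)

end AdaptedData

end SelfAffine

end

/-! ### Lipschitz equivalence -/

/-! Everything is measured by one integer. For an equivalence relation between words of equal length
that passes to prefixes, `confluence` is the last level at which the prefixes of two words are
related. The relation is equality for the plain tree, and "same horizontal component" for the
augmented tree. If components have at most `M` elements, then dist(x, y) equals |x| + |y| - 2
confluence up to `M`, so the Gromov product is the confluence up to `M`
(`IsLevelGraph.abs_gromovProduct_sub_le`). Since exp(-a confluence) satisfies the ultrametric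
inequality, the graph is hyperbolic, and passing to chains does not change the distance by more than
a factor: θ_a is comparable to exp(-a confluence) off the diagonal. A length-preserving bijection of
words that distorts confluence by a bounded amount is therefore a near-isometry and induces a
bi-Lipschitz map of boundaries.

Such a bijection from the augmented tree to the tree comes from counting. The k-fold offspring of a
component T has #T · m^k words. Rearrangeability of `A ^ k` says that the components in it can be
split into #T groups of exactly m^k words each, one group for every word of T
(`exists_distribution`). Making each group the set of k-th level descendants of its word,
recursively, gives the bijection (`exists_equiv_of_regrouping`): a whole component stays under one
ancestor, and equal image prefixes force related prefixes. For primitive `A`, a high power contains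
so many components of the class of the root, which have size 1, that they fill the gaps left by a
greedy packing (`exists_matrix_of_many_units`).

For the second assertion, w(Bx) = q^(1/d) w(x). If N is the last level at which the codings of x and
y lie in a common component, w(x - y) is comparable to q^(-N/d): the upper bound holds because
rescaled components have bounded diameter, the lower one is condition (H). With a = log q / d this
is the visual metric, so (K, w) is the boundary of the augmented tree
(`lipschitzEquivalent_hyperbolicBoundary`), hence that of the m-ary tree, which depends on m and q
only. A dust-like set with the same m and q exists once m < q. This inequality follows from a volume
argument (`natCast_lt_abs_det`), and the set is produced by a cyclic coordinate shift stretched by q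
in one coordinate. -/

theorem LipschitzEquivalent.symm {α β : Type*} {ρ : α → α → ℝ} {ρ' : β → β → ℝ}
    (h : LipschitzEquivalent ρ ρ') : LipschitzEquivalent ρ' ρ := by
  obtain ⟨σ, C, hC, h⟩ := h
  refine ⟨σ.symm, C, hC, fun x y => ?_⟩
  have := h (σ.symm x) (σ.symm y)
  simp only [Equiv.apply_symm_apply] at this
  constructor
  · rw [inv_mul_le_iff₀ hC]; exact this.2
  · have h1 := this.1
    rwa [inv_mul_le_iff₀ hC] at h1

theorem LipschitzEquivalent.trans {α β γ : Type*} {ρ : α → α → ℝ} {ρ' : β → β → ℝ}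
    {ρ'' : γ → γ → ℝ} (h : LipschitzEquivalent ρ ρ') (h' : LipschitzEquivalent ρ' ρ'') :
    LipschitzEquivalent ρ ρ'' := by
  obtain ⟨σ, C, hC, h⟩ := h
  obtain ⟨τ, D, hD, h'⟩ := h'
  refine ⟨σ.trans τ, D * C, mul_pos hD hC, fun x y => ?_⟩
  have h1 := h x y
  have h2 := h' (σ x) (σ y)
  simp only [Equiv.trans_apply]
  constructor
  · rw [mul_inv, mul_assoc]
    exact (mul_le_mul_of_nonneg_left h1.1 (inv_nonneg.2 hD.le)).trans h2.1
  · rw [mul_assoc]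
    exact h2.2.trans (mul_le_mul_of_nonneg_left h1.2 hD.le)

/-- A bi-Lipschitz bijection induces a bi-Lipschitz bijection between the sets of points added by
the completions. -/
theorem lipschitzEquivalent_completion_remainder {α β : Type*} [PseudoMetricSpace α]
    [PseudoMetricSpace β] (σ : α ≃ β) {C : ℝ} (hC : 0 < C)
    (h : ∀ x y, C⁻¹ * dist x y ≤ dist (σ x) (σ y) ∧ dist (σ x) (σ y) ≤ C * dist x y) :
    LipschitzEquivalent
      (fun ξ η : {ξ : UniformSpace.Completion α //
        ξ ∉ Set.range ((↑) : α → UniformSpace.Completion α)} => dist ξ η)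
      (fun ξ η : {ξ : UniformSpace.Completion β //
        ξ ∉ Set.range ((↑) : β → UniformSpace.Completion β)} => dist ξ η) := by
  have h1 : LipschitzWith ⟨C, hC.le⟩ σ := LipschitzWith.of_dist_le_mul fun x y => (h x y).2
  have h2 : LipschitzWith ⟨C, hC.le⟩ σ.symm := LipschitzWith.of_dist_le_mul fun x y => by
    have := (h (σ.symm x) (σ.symm y)).1
    rw [inv_mul_le_iff₀ hC] at this
    rw [Equiv.apply_symm_apply, Equiv.apply_symm_apply] at this
    exact this
  let e : α ≃ᵤ β := ⟨σ, h1.uniformContinuous, h2.uniformContinuous⟩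
  let E := UniformSpace.Completion.mapEquiv e
  have hE : ∀ x : α, E x = (σ x : β) := fun x => UniformSpace.Completion.mapEquiv_coe e x
  have hmem : ∀ ξ, ξ ∉ Set.range ((↑) : α → UniformSpace.Completion α) ↔
      E ξ ∉ Set.range ((↑) : β → UniformSpace.Completion β) := by
    intro ξ
    rw [not_iff_not]
    constructor
    · rintro ⟨x, rfl⟩
      exact ⟨σ x, (hE x).symm⟩
    · rintro ⟨y, hy⟩
      refine ⟨σ.symm y, E.injective ?_⟩
      rw [hE, ← hy, Equiv.apply_symm_apply]
  have hdist : ∀ ξ η : UniformSpace.Completion α,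
      C⁻¹ * dist ξ η ≤ dist (E ξ) (E η) ∧ dist (E ξ) (E η) ≤ C * dist ξ η := by
    intro ξ η
    have hEc : Continuous E := E.uniformContinuous.continuous
    refine UniformSpace.Completion.induction_on₂ ξ η ?_ ?_
    · have c1 : IsClosed {p : UniformSpace.Completion α × UniformSpace.Completion α |
          C⁻¹ * dist p.1 p.2 ≤ dist (E p.1) (E p.2)} := isClosed_le (by fun_prop) (by fun_prop)
      have c2 : IsClosed {p : UniformSpace.Completion α × UniformSpace.Completion α |
          dist (E p.1) (E p.2) ≤ C * dist p.1 p.2} := isClosed_le (by fun_prop) (by fun_prop)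
      exact c1.inter c2
    · intro a b
      rw [hE, hE, UniformSpace.Completion.dist_eq, UniformSpace.Completion.dist_eq]
      exact h a b
  exact ⟨E.toEquiv.subtypeEquiv hmem, C, hC, fun ξ η => hdist ξ η⟩

/-! ### Level relations on words -/

section LevelRelation

variable {m : ℕ}

/-- An equivalence relation between words of equal length which passes to prefixes. -/
structure IsLevelRelation (R : List (Fin m) → List (Fin m) → Prop) : Prop where
  equiv : Equivalence R
  length_eq : ∀ {u v}, R u v → u.length = v.length
  take : ∀ {u v}, R u v → ∀ n, R (u.take n) (v.take n)

theorem isLevelRelation_eq : IsLevelRelation (m := m) (· = ·) where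
  equiv := eq_equivalence
  length_eq := fun h => by rw [h]
  take := fun h n => by rw [h]

open Classical in
/-- The last level on which the prefixes of `x` and `y` are related. -/
noncomputable def confluence (R : List (Fin m) → List (Fin m) → Prop) (x y : List (Fin m)) : ℕ :=
  Nat.findGreatest (fun n => R (x.take n) (y.take n)) (min x.length y.length)

variable {R : List (Fin m) → List (Fin m) → Prop}

theorem confluence_le_left (x y : List (Fin m)) : confluence R x y ≤ x.length := by
  classical exact (Nat.findGreatest_le _).trans (min_le_left _ _)

theorem confluence_le_right (x y : List (Fin m)) : confluence R x y ≤ y.length := by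
  classical exact (Nat.findGreatest_le _).trans (min_le_right _ _)

theorem le_confluence {x y : List (Fin m)} {n : ℕ} (hx : n ≤ x.length) (hy : n ≤ y.length)
    (h : R (x.take n) (y.take n)) : n ≤ confluence R x y := by
  classical
  exact Nat.le_findGreatest (P := fun n => R (x.take n) (y.take n)) (le_min hx hy) h

namespace IsLevelRelation

variable (hR : IsLevelRelation R)
include hR

theorem rel_take_of_le_confluence {x y : List (Fin m)} {n : ℕ} (h : n ≤ confluence R x y) :
    R (x.take n) (y.take n) := by
  classical
  have h0 : R (x.take (confluence R x y)) (y.take (confluence R x y)) := by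
    unfold confluence
    exact Nat.findGreatest_spec (P := fun n => R (x.take n) (y.take n)) (Nat.zero_le _)
      (by simpa using hR.equiv.refl [])
  have := hR.take h0 n
  rwa [List.take_take, List.take_take, min_eq_left h] at this

theorem confluence_congr {x z z' : List (Fin m)} (h : R z z') :
    confluence R x z ≤ confluence R x z' :=
  le_confluence (confluence_le_left _ _)
    ((confluence_le_right _ _).trans_eq (hR.length_eq h))
    (hR.equiv.trans (hR.rel_take_of_le_confluence le_rfl) (hR.take h _))

theorem confluence_append_le (x z : List (Fin m)) (i : Fin m) :
    confluence R x (z ++ [i]) ≤ confluence R x z + 1 := by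
  rw [← Nat.sub_le_iff_le_add]
  have h1 := confluence_le_left (R := R) x (z ++ [i])
  have h2 := confluence_le_right (R := R) x (z ++ [i])
  simp only [List.length_append, List.length_singleton] at h2
  have h3 := hR.rel_take_of_le_confluence (x := x) (y := z ++ [i])
    (n := confluence R x (z ++ [i]) - 1) (Nat.sub_le _ _)
  rw [List.take_append_of_le_length (by omega)] at h3
  exact le_confluence (by omega) (by omega) h3

theorem confluence_le_append (x z : List (Fin m)) (i : Fin m) :
    confluence R x z ≤ confluence R x (z ++ [i]) := by
  have h2 := confluence_le_right (R := R) x z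
  refine le_confluence (confluence_le_left _ _) (by simp; omega) ?_
  rw [List.take_append_of_le_length h2]
  exact hR.rel_take_of_le_confluence le_rfl

theorem confluence_self (x : List (Fin m)) : confluence R x x = x.length :=
  le_antisymm (confluence_le_left _ _) (le_confluence le_rfl le_rfl (hR.equiv.refl _))

/-- Transitivity of the relation at the smaller of the two levels; this is the exact ultrametric
inequality behind hyperbolicity. -/
theorem min_confluence_le (x y z : List (Fin m)) :
    min (confluence R x z) (confluence R z y) ≤ confluence R x y := by
  set n := min (confluence R x z) (confluence R z y)
  have h1 : n ≤ confluence R x z := min_le_left _ _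
  have h2 : n ≤ confluence R z y := min_le_right _ _
  exact le_confluence (h1.trans (confluence_le_left _ _)) (h2.trans (confluence_le_right _ _))
    (hR.equiv.trans (hR.rel_take_of_le_confluence h1) (hR.rel_take_of_le_confluence h2))

end IsLevelRelation

/-! ### Graphs of words adapted to a level relation -/

/-- A graph containing the tree of words, whose other edges join related words, and in which
related words are joined by walks of length at most `M`. -/
structure IsLevelGraph (R : List (Fin m) → List (Fin m) → Prop) (G : SimpleGraph (List (Fin m)))
    (M : ℕ) : Prop where
  rel : IsLevelRelation R
  vertical : ∀ u i, G.Adj u (u ++ [i])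
  adj : ∀ {u v}, G.Adj u v → R u v ∨ (∃ i, v = u ++ [i]) ∨ ∃ i, u = v ++ [i]
  horizontal : ∀ {u v}, R u v → ∃ p : G.Walk u v, p.length ≤ M

theorem isLevelGraph_vertical : IsLevelGraph (· = ·) (verticalGraph m) 0 where
  rel := isLevelRelation_eq
  vertical := fun u i => Or.inl ⟨i, rfl⟩
  adj := fun h => Or.inr h
  horizontal := fun {u v} h => by
    subst h
    exact ⟨SimpleGraph.Walk.nil, by simp⟩

namespace IsLevelGraph

variable {G : SimpleGraph (List (Fin m))} {M : ℕ} (hG : IsLevelGraph R G M)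
include hG

theorem exists_walk_append (u v : List (Fin m)) : ∃ p : G.Walk u (u ++ v), p.length = v.length := by
  induction v using List.reverseRecOn with
  | nil => exact ⟨SimpleGraph.Walk.nil.copy rfl (by simp), by simp⟩
  | append_singleton v i ih =>
    obtain ⟨p, hp⟩ := ih
    refine ⟨(p.concat (hG.vertical (u ++ v) i)).copy rfl (by simp), ?_⟩
    simp [hp]

/-- Climb from x to the confluence level, cross to the ancestor of y by a walk of length at most
`M`, and descend to y. -/
theorem exists_walk (x y : List (Fin m)) : ∃ p : G.Walk x y,
    p.length + 2 * confluence R x y ≤ x.length + y.length + M := by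
  set n := confluence R x y with hn
  obtain ⟨p, hp⟩ := hG.exists_walk_append (x.take n) (x.drop n)
  obtain ⟨q, hq⟩ := hG.exists_walk_append (y.take n) (y.drop n)
  obtain ⟨s, hs⟩ := hG.horizontal (hG.rel.rel_take_of_le_confluence (x := x) (y := y) hn.le)
  refine ⟨((p.reverse.append s).append q).copy (by simp) (by simp), ?_⟩
  have h1 := confluence_le_left (R := R) x y
  have h2 := confluence_le_right (R := R) x y
  simp only [SimpleGraph.Walk.length_copy, SimpleGraph.Walk.length_append,
    SimpleGraph.Walk.length_reverse, hp, hq, List.length_drop]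
  omega

theorem dist_add_le (x y : List (Fin m)) :
    G.dist x y + 2 * confluence R x y ≤ x.length + y.length + M := by
  obtain ⟨p, hp⟩ := hG.exists_walk x y
  have := SimpleGraph.dist_le p
  omega

/-- The quantity |x| + |z| - 2 confluence(x, z) vanishes at z = x and changes by at most 1 along an
edge at z: not at all along an edge inside a class, and along a vertical edge the length changes by
1 while the confluence moves by 0 or 1 in the same direction. -/
theorem le_walk_length {x z : List (Fin m)} (p : G.Walk z x) :
    x.length + z.length ≤ p.length + 2 * confluence R x z := by
  induction p with
  | nil => rw [hG.rel.confluence_self]; omega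
  | @cons u v w h p ih =>
    rw [SimpleGraph.Walk.length_cons]
    rcases hG.adj h with h | ⟨i, rfl⟩ | ⟨i, rfl⟩
    · have h1 := hG.rel.confluence_congr (x := w) (hG.rel.equiv.symm h)
      have h2 := hG.rel.length_eq h
      omega
    · have := hG.rel.confluence_append_le w u i
      simp only [List.length_append, List.length_singleton] at ih
      omega
    · have := hG.rel.confluence_le_append w v i
      simp only [List.length_append, List.length_singleton]
      omega

theorem le_dist_add (x y : List (Fin m)) :
    x.length + y.length ≤ G.dist x y + 2 * confluence R x y := by
  obtain ⟨p, -⟩ := hG.exists_walk y x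
  obtain ⟨q, hq⟩ := p.reachable.exists_walk_length_eq_dist
  have := hG.le_walk_length q
  rwa [hq, SimpleGraph.dist_comm] at this

theorem dist_nil_mem (x : List (Fin m)) : x.length ≤ G.dist [] x ∧ G.dist [] x ≤ x.length + M := by
  have h1 := hG.dist_add_le [] x
  have h2 := hG.le_dist_add [] x
  have h3 := confluence_le_left (R := R) [] x
  simp only [List.length_nil] at h1 h2 h3
  omega

theorem abs_gromovProduct_sub_le (x y : List (Fin m)) :
    |gromovProduct G [] x y - confluence R x y| ≤ M := by
  have hx := hG.dist_nil_mem x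
  have hy := hG.dist_nil_mem y
  have h1 := hG.dist_add_le x y
  have h2 := hG.le_dist_add x y
  unfold gromovProduct
  zify at hx hy h1 h2
  have hx' : (x.length : ℝ) ≤ G.dist [] x ∧ (G.dist [] x : ℝ) ≤ x.length + M := by exact_mod_cast hx
  have hy' : (y.length : ℝ) ≤ G.dist [] y ∧ (G.dist [] y : ℝ) ≤ y.length + M := by exact_mod_cast hy
  have h1' : (G.dist x y : ℝ) + 2 * confluence R x y ≤ x.length + y.length + M := by
    exact_mod_cast h1
  have h2' : (x.length : ℝ) + y.length ≤ G.dist x y + 2 * confluence R x y := by exact_mod_cast h2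
  have hM : (0 : ℝ) ≤ M := Nat.cast_nonneg M
  rw [abs_le]
  constructor <;> linarith

/-- Replacing the Gromov products by confluences costs `M` on each side of the inequality; the
summand 1 keeps the constant positive when `M` is 0. -/
theorem isHyperbolicWith : IsHyperbolicWith G [] (2 * M + 1) := by
  intro x y z
  have h1 := abs_le.1 (hG.abs_gromovProduct_sub_le x y)
  have h2 := abs_le.1 (hG.abs_gromovProduct_sub_le x z)
  have h3 := abs_le.1 (hG.abs_gromovProduct_sub_le z y)
  have h4 : (min (confluence R x z : ℝ) (confluence R z y)) ≤ confluence R x y := by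
    exact_mod_cast hG.rel.min_confluence_le x y z
  rcases min_le_iff.1 h4 with h | h
  · have := min_le_left (gromovProduct G [] x z) (gromovProduct G [] z y)
    linarith
  · have := min_le_right (gromovProduct G [] x z) (gromovProduct G [] z y)
    linarith

theorem rhoA_le {a : ℝ} (ha : 0 < a) (x y : List (Fin m)) :
    (rhoA G [] a x y : ℝ) ≤ Real.exp (a * M) * Real.exp (-a * confluence R x y) := by
  unfold rhoA
  split_ifs
  · simpa using by positivity
  · rw [Real.coe_toNNReal _ (Real.exp_pos _).le, ← Real.exp_add, Real.exp_le_exp]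
    have := abs_le.1 (hG.abs_gromovProduct_sub_le x y)
    nlinarith

theorem le_rhoA {a : ℝ} (ha : 0 < a) {x y : List (Fin m)} (hxy : x ≠ y) :
    Real.exp (-a * confluence R x y) ≤ Real.exp (a * M) * rhoA G [] a x y := by
  unfold rhoA
  rw [if_neg hxy, Real.coe_toNNReal _ (Real.exp_pos _).le, ← Real.exp_add, Real.exp_le_exp]
  have := abs_le.1 (hG.abs_gromovProduct_sub_le x y)
  nlinarith

/-- Induction on the chain: by the ultrametric inequality the term for (x, y) is at most the one for
(x, z) or the one for (z, y), so the factor does not grow with the length of the chain. Coinciding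
neighbours are treated separately, because `rhoA` is 0 on the diagonal while the exponential is not.
-/
theorem exp_le_sum {a : ℝ} (ha : 0 < a) (l : List (List (Fin m))) {x y : List (Fin m)}
    (hxy : x ≠ y) :
    Real.exp (-a * confluence R x y) ≤
      Real.exp (a * M) * (((x :: l).zipWith (rhoA G [] a) (l ++ [y])).sum : NNReal) := by
  induction l generalizing x with
  | nil => simpa using hG.le_rhoA ha hxy
  | cons z l ih =>
    rw [List.cons_append, List.zipWith_cons_cons, List.sum_cons, NNReal.coe_add, mul_add]
    have h0 : 0 ≤ Real.exp (a * M) * (rhoA G [] a x z : ℝ) := by positivity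
    have h0' : 0 ≤ Real.exp (a * M) *
      (((z :: l).zipWith (rhoA G [] a) (l ++ [y])).sum : NNReal) := by positivity
    by_cases hxz : x = z
    · subst hxz
      linarith [ih hxy]
    · have h1 := hG.le_rhoA ha hxz
      by_cases hzy : z = y
      · subst hzy
        linarith
      · have h2 := ih hzy
        have h4 : (min (confluence R x z : ℝ) (confluence R z y)) ≤ confluence R x y := by
          exact_mod_cast hG.rel.min_confluence_le x y z
        rcases min_le_iff.1 h4 with h | h
        · have : Real.exp (-a * confluence R x y) ≤ Real.exp (-a * confluence R x z) := by
            rw [Real.exp_le_exp]; nlinarith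
          linarith
        · have : Real.exp (-a * confluence R x y) ≤ Real.exp (-a * confluence R z y) := by
            rw [Real.exp_le_exp]; nlinarith
          linarith

theorem dist_visual_le {a : ℝ} (ha : 0 < a) (x y : VisualSpace G [] a) :
    dist x y ≤ Real.exp (a * M) * Real.exp (-a * confluence R x y) :=
  (PseudoMetricSpace.dist_ofPreNNDist_le (rhoA G [] a) (rhoA_self G [] a) (rhoA_comm G [] a)
    x y).trans (hG.rhoA_le ha x y)

theorem le_dist_visual {a : ℝ} (ha : 0 < a) {x y : VisualSpace G [] a} (hxy : x ≠ y) :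
    Real.exp (-a * confluence R x y) ≤ Real.exp (a * M) * dist x y := by
  have h : dist x y = _ := PseudoMetricSpace.dist_ofPreNNDist (rhoA G [] a) (rhoA_self G [] a)
    (rhoA_comm G [] a) x y
  rw [h, ← div_le_iff₀' (Real.exp_pos _)]
  have hpos : (0 : ℝ) ≤ Real.exp (-a * confluence R x y) / Real.exp (a * M) := by positivity
  rw [← Real.coe_toNNReal _ hpos, NNReal.coe_le_coe]
  refine le_ciInf fun l => ?_
  rw [← NNReal.coe_le_coe, Real.coe_toNNReal _ hpos, div_le_iff₀' (Real.exp_pos _)]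
  exact hG.exp_le_sum ha l hxy

end IsLevelGraph

/-! ### Length-preserving bijections of bounded confluence distortion -/

section Distortion

variable {R' : List (Fin m) → List (Fin m) → Prop} {G G' : SimpleGraph (List (Fin m))} {M M' : ℕ}
  (hG : IsLevelGraph R G M) (hG' : IsLevelGraph R' G' M') (σ : List (Fin m) ≃ List (Fin m)) {c : ℕ}
  (h1 : ∀ x y, confluence R x y ≤ confluence R' (σ x) (σ y) + c)
  (h2 : ∀ x y, confluence R' (σ x) (σ y) ≤ confluence R x y + c)
include hG hG' h1 h2

theorem isNearIsometry_of_confluence (hσ : ∀ x, (σ x).length = x.length) :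
    IsNearIsometry G G' σ := by
  -- Each graph distance is known from the confluence up to `M` or `M'`, and the confluences differ
  -- by at most `c` and enter twice; the 1 makes the bound positive.
  refine ⟨M + M' + 2 * c + 1, by positivity, fun x y => ?_⟩
  have a1 := hG.dist_add_le x y
  have a2 := hG.le_dist_add x y
  have a3 := hG'.dist_add_le (σ x) (σ y)
  have a4 := hG'.le_dist_add (σ x) (σ y)
  have a5 := h1 x y
  have a6 := h2 x y
  rw [hσ, hσ] at a3 a4
  have : |(G'.dist (σ x) (σ y) : ℤ) - (G.dist x y : ℤ)| ≤ M + M' + 2 * c + 1 := by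
    rw [abs_le]; omega
  exact_mod_cast this

theorem lipschitzEquivalent_boundary_of_confluence {a : ℝ} (ha : 0 < a) :
    LipschitzEquivalent (fun ξ η : HyperbolicBoundary G [] a => dist ξ η)
      (fun ξ η : HyperbolicBoundary G' [] a => dist ξ η) := by
  have key : ∀ {R R' : List (Fin m) → List (Fin m) → Prop} {G G' : SimpleGraph (List (Fin m))}
      {M M' : ℕ}, IsLevelGraph R G M → IsLevelGraph R' G' M' → ∀ (x y x' y' : List (Fin m)),
      (x = y → x' = y') → confluence R x y ≤ confluence R' x' y' + c →
      (dist (α := VisualSpace G' [] a) x' y') ≤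
        Real.exp (a * (M + M' + c)) * dist (α := VisualSpace G [] a) x y := by
    intro R R' G G' M M' hG hG' x y x' y' he hc
    by_cases hxy : x = y
    · rw [he hxy, hxy, dist_self (α := VisualSpace G' [] a) y', dist_self (α := VisualSpace G [] a) y,
        mul_zero]
    · have b1 := hG'.dist_visual_le ha x' y'
      have b2 := hG.le_dist_visual ha (x := x) (y := y) hxy
      have hc' : (confluence R x y : ℝ) ≤ confluence R' x' y' + c := by exact_mod_cast hc
      calc _ ≤ _ := b1
        _ ≤ Real.exp (a * (M' + c)) * Real.exp (-a * confluence R x y) := by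
          rw [← Real.exp_add, ← Real.exp_add, Real.exp_le_exp]
          nlinarith
        _ ≤ Real.exp (a * (M' + c)) * (Real.exp (a * M) * dist (α := VisualSpace G [] a) x y) :=
          mul_le_mul_of_nonneg_left b2 (Real.exp_pos _).le
        _ = _ := by
          rw [← mul_assoc, ← Real.exp_add]
          ring_nf
  refine lipschitzEquivalent_completion_remainder (α := VisualSpace G [] a)
    (β := VisualSpace G' [] a) σ (C := Real.exp (a * (M + M' + c))) (Real.exp_pos _)
    fun x y => ⟨?_, ?_⟩
  · rw [inv_mul_le_iff₀ (Real.exp_pos _)]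
    have := key hG' hG (σ x) (σ y) x y (fun h => σ.injective h) (h2 x y)
    rwa [add_comm (M' : ℝ) M] at this
  · exact key hG hG' x y (σ x) (σ y) (fun h => congrArg σ h) (h1 x y)

end Distortion

end LevelRelation

/-! ### The horizontal graph as a level relation -/

section Horizontal

variable {E : Type*} {m : ℕ}

theorem wordMap_append (S : Fin m → E → E) (u v : List (Fin m)) :
    wordMap S (u ++ v) = wordMap S u ∘ wordMap S v := by
  induction u with
  | nil => rfl
  | cons i u ih => rw [List.cons_append, wordMap, wordMap, ih]; rfl

theorem cell_append (S : Fin m → E → E) (J : Set E) (u v : List (Fin m)) :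
    cell S J (u ++ v) = wordMap S u '' cell S J v := by
  rw [cell, cell, wordMap_append, Set.image_comp]

theorem cell_subset {S : Fin m → E → E} {J : Set E} (hJ : ∀ i, S i '' J ⊆ J) (u : List (Fin m)) :
    cell S J u ⊆ J := by
  induction u with
  | nil => simp [cell, wordMap]
  | cons i u ih =>
    rw [cell, wordMap, Set.image_comp]
    exact (Set.image_mono ih).trans (hJ i)

theorem cell_append_subset {S : Fin m → E → E} {J : Set E} (hJ : ∀ i, S i '' J ⊆ J)
    (u v : List (Fin m)) : cell S J (u ++ v) ⊆ cell S J u := by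
  rw [cell_append]
  exact Set.image_mono (cell_subset hJ v)

theorem cell_subset_cell_take {S : Fin m → E → E} {J : Set E} (hJ : ∀ i, S i '' J ⊆ J)
    (u : List (Fin m)) (n : ℕ) : cell S J u ⊆ cell S J (u.take n) := by
  conv_lhs => rw [← List.take_append_drop n u]
  exact cell_append_subset hJ _ _

theorem cell_mono (S : Fin m → E → E) {J J' : Set E} (h : J ⊆ J') (u : List (Fin m)) :
    cell S J u ⊆ cell S J' u :=
  Set.image_mono h

/-- Words in the same horizontal component. -/
abbrev HRel (S : Fin m → E → E) (J : Set E) (u v : List (Fin m)) : Prop :=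
  (horizontalGraph S J).Reachable u v

variable {S : Fin m → E → E} {J : Set E}

theorem HRel.of_inter {u v : List (Fin m)} (hl : u.length = v.length)
    (h : (cell S J u ∩ cell S J v).Nonempty) : HRel S J u v := by
  by_cases huv : u = v
  · rw [huv]
  · exact SimpleGraph.Adj.reachable ⟨hl, huv, h⟩

theorem isLevelRelation_hRel (hJ : ∀ i, S i '' J ⊆ J) : IsLevelRelation (HRel S J) where
  equiv := SimpleGraph.reachable_is_equivalence _
  length_eq := by
    rintro u v ⟨p⟩
    induction p with
    | nil => rfl
    | cons h _ ih => exact h.1.trans ih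
  take := by
    rintro u v ⟨p⟩ n
    induction p with
    | nil => exact SimpleGraph.Reachable.refl _
    | cons h _ ih =>
      refine SimpleGraph.Reachable.trans (HRel.of_inter (by simp [h.1]) ?_) ih
      exact h.2.2.mono (Set.inter_subset_inter (cell_subset_cell_take hJ _ _)
        (cell_subset_cell_take hJ _ _))

theorem HComponent.finite_supp (hJ : ∀ i, S i '' J ⊆ J) (T : HComponent S J) : T.supp.Finite := by
  induction T using SimpleGraph.ConnectedComponent.ind with | h u
  refine (List.finite_length_eq (Fin m) u.length).subset fun v hv => ?_
  exact (isLevelRelation_hRel hJ).length_eq (SimpleGraph.ConnectedComponent.exact hv)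

theorem HComponent.ncard_supp_pos (hJ : ∀ i, S i '' J ⊆ J) (T : HComponent S J) :
    0 < T.supp.ncard :=
  (Set.ncard_pos (T.finite_supp hJ)).2 T.nonempty_supp

/-- A path repeats no vertex and stays in its component, so it is shorter than the size of that
component. -/
theorem exists_horizontal_walk (hJ : ∀ i, S i '' J ⊆ J) {M : ℕ}
    (hM : ∀ T : HComponent S J, T.supp.ncard ≤ M) {u v : List (Fin m)} (h : HRel S J u v) :
    ∃ p : (horizontalGraph S J).Walk u v, p.length ≤ M := by
  classical
  obtain ⟨p⟩ := h
  refine ⟨p.bypass, ?_⟩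
  have hnd := p.bypass_isPath.support_nodup
  set T := (horizontalGraph S J).connectedComponentMk u
  have hsub : (p.bypass.support.toFinset : Set (List (Fin m))) ⊆ T.supp := by
    intro w hw
    simp only [List.coe_toFinset, Set.mem_ofPred_eq] at hw
    exact SimpleGraph.ConnectedComponent.sound (p.bypass.takeUntil w hw).reachable.symm
  have h1 := Set.ncard_le_ncard hsub (HComponent.finite_supp hJ T)
  rw [Set.ncard_coe_finset, List.toFinset_card_of_nodup hnd, SimpleGraph.Walk.length_support] at h1
  exact (Nat.le_succ _).trans (h1.trans (hM T))

theorem isLevelGraph_augmentedTree (hJ : ∀ i, S i '' J ⊆ J) {M : ℕ}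
    (hM : ∀ T : HComponent S J, T.supp.ncard ≤ M) :
    IsLevelGraph (HRel S J) (augmentedTree S J) M where
  rel := isLevelRelation_hRel hJ
  vertical := fun u i => Or.inl (Or.inl ⟨i, rfl⟩)
  adj := fun h => h.elim (fun h => Or.inr h) fun h => Or.inl (SimpleGraph.Adj.reachable h)
  horizontal := fun h => by
    obtain ⟨p, hp⟩ := exists_horizontal_walk hJ hM h
    exact ⟨p.mapLe le_sup_right, (SimpleGraph.Walk.length_mapLe _ _).trans_le hp⟩

/-- Distinct words of equal length have disjoint cells: a common first letter is cancelled by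
injectivity, and different first letters put the cells into disjoint pieces. There are thus no
horizontal edges, and the augmented tree of a dust-like set is governed by equality. -/
theorem hRel_eq_of_disjoint {K : Set E} (hS : ∀ i, Function.Injective (S i))
    (hK : ∀ i, S i '' K ⊆ K) (hd : ∀ i j, i ≠ j → Disjoint (S i '' K) (S j '' K)) :
    HRel S K = (· = ·) := by
  have key : ∀ u v : List (Fin m), u.length = v.length → (cell S K u ∩ cell S K v).Nonempty →
      u = v := by
    intro u
    induction u with
    | nil => intro v h _; exact (List.length_eq_zero_iff.1 h.symm).symm
    | cons i u ih =>
      rintro (_ | ⟨j, v⟩) h hne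
      · simp at h
      · have e1 : cell S K (i :: u) = S i '' cell S K u := by rw [cell, wordMap, Set.image_comp, cell]
        have e2 : cell S K (j :: v) = S j '' cell S K v := by rw [cell, wordMap, Set.image_comp, cell]
        rw [e1, e2] at hne
        have hij : i = j := by
          by_contra hij
          obtain ⟨x, h1, h2⟩ := hne
          exact (Set.disjoint_left.1 (hd i j hij)) (Set.image_mono (cell_subset hK u) h1)
            (Set.image_mono (cell_subset hK v) h2)
        subst hij
        rw [← Set.image_inter (hS i), Set.image_nonempty] at hne
        rw [ih v (by simpa using h) hne]
  funext u v
  refine propext ⟨?_, fun h => by subst h; exact SimpleGraph.Reachable.refl _⟩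
  rintro ⟨p⟩
  induction p with
  | nil => rfl
  | cons h _ _ => exact absurd (key _ _ h.1 h.2.2) h.2.1

end Horizontal

/-! ### Bijections obtained by regrouping words -/

section Regroup

variable {m : ℕ}

theorem ncard_length_eq (m n : ℕ) : {u : List (Fin m) | u.length = n}.ncard = m ^ n := by
  have : Nat.card (List.Vector (Fin m) n) = m ^ n := by
    rw [Nat.card_eq_fintype_card, card_vector, Fintype.card_fin]
  exact this

/-- The bijection of words given by regrouping: the word `u` is mapped to a descendant of the image
of `f u`, which is selected by `γ u`. -/
def regroup (k : ℕ) (f γ : List (Fin m) → List (Fin m)) (u : List (Fin m)) : List (Fin m) :=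
  -- The comparison of lengths only secures termination; under the standing hypotheses f u is
  -- exactly k letters shorter than u.
  if _h : k ≤ u.length ∧ (f u).length < u.length then regroup k f γ (f u) ++ γ u else u
termination_by u.length
decreasing_by exact _h.2

variable {R : List (Fin m) → List (Fin m) → Prop} {k : ℕ} {f γ : List (Fin m) → List (Fin m)}

section

variable (hR : IsLevelRelation R) (hk : 0 < k)
  (h1 : ∀ u, k ≤ u.length → R (f u) (u.take (u.length - k)))
include hR h1

theorem length_of_rel_take (u : List (Fin m)) (hu : k ≤ u.length) : (f u).length + k = u.length := by
  rw [hR.length_eq (h1 u hu), List.length_take]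
  omega

variable (hγ : ∀ t, Set.BijOn γ {u | u.length = t.length + k ∧ f u = t} {w | w.length = k})
include hk

theorem regroup_of_le (u : List (Fin m)) (hu : k ≤ u.length) :
    regroup k f γ u = regroup k f γ (f u) ++ γ u := by
  rw [regroup, dif_pos]
  have := length_of_rel_take hR h1 u hu
  exact ⟨hu, by omega⟩

omit hR h1 hk in
theorem regroup_of_lt (u : List (Fin m)) (hu : u.length < k) : regroup k f γ u = u := by
  rw [regroup, dif_neg]
  omega

include hγ

omit hk in
theorem length_selector (u : List (Fin m)) (hu : k ≤ u.length) : (γ u).length = k :=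
  (hγ (f u)).mapsTo ⟨(length_of_rel_take hR h1 u hu).symm, rfl⟩

theorem length_regroup (u : List (Fin m)) : (regroup k f γ u).length = u.length := by
  induction hn : u.length using Nat.strong_induction_on generalizing u with | _ n ih
  rcases lt_or_ge u.length k with h | h
  · rw [regroup_of_lt u h, hn]
  · have h2 := length_of_rel_take hR h1 u h
    rw [regroup_of_le hR hk h1 u h, List.length_append, ih _ (by omega) _ rfl,
      length_selector hR h1 hγ u h]
    omega

theorem regroup_injective : Function.Injective (regroup k f γ) := by
  intro u v huv
  have hl : u.length = v.length := by
    rw [← length_regroup hR hk h1 hγ u, huv, length_regroup hR hk h1 hγ v]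
  induction hn : u.length using Nat.strong_induction_on generalizing u v with | _ n ih
  rcases lt_or_ge u.length k with h | h
  · rwa [regroup_of_lt u h, regroup_of_lt v (by omega)] at huv
  · have a1 := length_of_rel_take hR h1 u h
    have a2 := length_of_rel_take hR h1 v (by omega)
    rw [regroup_of_le hR hk h1 u h, regroup_of_le hR hk h1 v (by omega)] at huv
    obtain ⟨e1, e2⟩ := List.append_inj huv
      (by rw [length_regroup hR hk h1 hγ, length_regroup hR hk h1 hγ]; omega)
    have e3 := ih (f u).length (by omega) e1 (by omega) rfl
    exact (hγ (f u)).injOn ⟨a1.symm, rfl⟩ ⟨by rw [e3]; exact a2.symm, e3.symm⟩ e2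

theorem regroup_surjective : Function.Surjective (regroup k f γ) := by
  intro w
  induction hn : w.length using Nat.strong_induction_on generalizing w with | _ n ih
  rcases lt_or_ge w.length k with h | h
  · exact ⟨w, regroup_of_lt w h⟩
  · obtain ⟨t, ht⟩ := ih (w.take (w.length - k)).length (by simp; omega) _ rfl
    have hw : (w.drop (w.length - k)).length = k := by simp; omega
    obtain ⟨u, ⟨hu1, hu2⟩, hu⟩ := (hγ t).surjOn hw
    refine ⟨u, ?_⟩
    rw [regroup_of_le hR hk h1 u (by omega), hu2, hu, ht, List.take_append_drop]

variable (h2 : ∀ u v, R u v → f u = f v)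

-- The witness s is the ancestor of u obtained by applying `f` i times. Each application stays
-- related to the prefix k levels higher, and `regroup` only appends letters to the image of the
-- ancestor.
omit hγ in
theorem exists_regroup_take_eq (j i : ℕ)
    (hγ : ∀ t, Set.BijOn γ {u | u.length = t.length + k ∧ f u = t} {w | w.length = k})
    (u : List (Fin m)) (hu : u.length = k * (j + i)) :
    ∃ s, R s (u.take (k * j)) ∧ (regroup k f γ u).take (k * j) = regroup k f γ s := by
  induction i generalizing u with
  | zero =>
    refine ⟨u, ?_, ?_⟩
    · rw [List.take_of_length_le (by rw [hu, add_zero])]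
      exact hR.equiv.refl _
    · rw [List.take_of_length_le]
      rw [length_regroup hR hk h1 hγ, hu, add_zero]
  | succ i ih =>
    have hku : k ≤ u.length := by rw [hu, ← add_assoc, mul_add, mul_one]; omega
    have hl := length_of_rel_take hR h1 u hku
    have hl' : (f u).length = k * (j + i) := by
      rw [hu, ← add_assoc, mul_add k (j + i), mul_one] at hl; omega
    obtain ⟨s, hs1, hs2⟩ := ih (f u) hl'
    have hle : k * j ≤ u.length - k := by
      have : k * j ≤ k * (j + i) := Nat.mul_le_mul_left _ (Nat.le_add_right _ _)
      omega
    refine ⟨s, hR.equiv.trans hs1 ?_, ?_⟩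
    · have := hR.take (h1 u hku) (k * j)
      rwa [List.take_take, min_eq_left hle] at this
    · rw [regroup_of_le hR hk h1 u hku, List.take_append_of_le_length, hs2]
      rw [length_regroup hR hk h1 hγ]
      omega

end

/-- The extension of a map of words of lengths divisible by `k` to all words. -/
def extendBlocks (k : ℕ) (σ : List (Fin m) → List (Fin m)) (x : List (Fin m)) : List (Fin m) :=
  σ (x.take (k * (x.length / k))) ++ x.drop (k * (x.length / k))

theorem length_extendBlocks {σ : List (Fin m) → List (Fin m)} (hl : ∀ u, (σ u).length = u.length)
    (x : List (Fin m)) : (extendBlocks k σ x).length = x.length := by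
  have := Nat.mul_div_le x.length k
  simp only [extendBlocks, List.length_append, hl, List.length_take, List.length_drop]
  omega

theorem extendBlocks_injective {σ : List (Fin m) → List (Fin m)}
    (hl : ∀ u, (σ u).length = u.length) (hσ : Function.Injective σ) :
    Function.Injective (extendBlocks k σ) := by
  intro x y hxy
  have hlen : x.length = y.length := by
    rw [← length_extendBlocks (k := k) hl x, hxy, length_extendBlocks hl y]
  unfold extendBlocks at hxy
  rw [hlen] at hxy
  obtain ⟨e1, e2⟩ := List.append_inj hxy (by simp [hl, hlen])
  calc x = x.take (k * (y.length / k)) ++ x.drop (k * (y.length / k)) :=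
        (List.take_append_drop _ _).symm
    _ = y := by rw [hσ e1, e2, List.take_append_drop]

theorem extendBlocks_surjective {σ : List (Fin m) → List (Fin m)}
    (hl : ∀ u, (σ u).length = u.length) (hσ : Function.Surjective σ) :
    Function.Surjective (extendBlocks k σ) := by
  intro y
  obtain ⟨s, hs⟩ := hσ (y.take (k * (y.length / k)))
  have h0 := Nat.mul_div_le y.length k
  have h1 : s.length = k * (y.length / k) := by
    rw [← hl, hs, List.length_take]; omega
  have h2 : (s ++ y.drop (k * (y.length / k))).length = y.length := by
    rw [List.length_append, h1, List.length_drop]; omega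
  refine ⟨s ++ y.drop (k * (y.length / k)), ?_⟩
  unfold extendBlocks
  rw [h2, List.take_append_of_le_length h1.ge, List.take_of_length_le h1.le, hs,
    List.drop_append_of_le_length h1.ge, List.drop_of_length_le h1.le, List.nil_append,
    List.take_append_drop]

/-- If the words of each level can be regrouped `k` levels above, in such a way that related words
fall into the same group, there is a length-preserving bijection which sends the relation to
equality, up to a bounded number of levels. -/
theorem exists_equiv_of_regrouping (hR : IsLevelRelation R) (hk : 0 < k)
    (h1 : ∀ u, k ≤ u.length → R (f u) (u.take (u.length - k)))
    (h2 : ∀ u v, R u v → f u = f v)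
    (h3 : ∀ t : List (Fin m), {u | u.length = t.length + k ∧ f u = t}.ncard = m ^ k) :
    ∃ σ : List (Fin m) ≃ List (Fin m), (∀ x, (σ x).length = x.length) ∧
      (∀ x y, confluence R x y ≤ confluence (· = ·) (σ x) (σ y) + 2 * k) ∧
      ∀ x y, confluence (· = ·) (σ x) (σ y) ≤ confluence R x y + 2 * k := by
  -- A group and the set of words of length k both have m ^ k elements, so each group can be
  -- identified with the k-th level descendants of a single word.
  have hβ : ∀ t : List (Fin m), ∃ β : List (Fin m) → List (Fin m),
      Set.BijOn β {u | u.length = t.length + k ∧ f u = t} {w | w.length = k} := by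
    intro t
    have hf1 : {u : List (Fin m) | u.length = t.length + k ∧ f u = t}.Finite :=
      (List.finite_length_eq (Fin m) (t.length + k)).subset fun u hu => hu.1
    have hf2 := List.finite_length_eq (Fin m) k
    refine hf1.exists_bijOn_of_encard_eq ?_
    rw [← hf1.cast_ncard_eq, ← hf2.cast_ncard_eq, h3, ncard_length_eq]
  choose β hβ using hβ
  have hγ : ∀ t, Set.BijOn (fun u => β (f u) u) {u | u.length = t.length + k ∧ f u = t}
      {w | w.length = k} :=
    fun t => (hβ t).congr fun u hu => by rw [hu.2]
  set τ := regroup k f (fun u => β (f u) u) with hτ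
  have hl : ∀ u, (τ u).length = u.length := length_regroup hR hk h1 hγ
  have hinj : Function.Injective τ := regroup_injective hR hk h1 hγ
  have hsurj : Function.Surjective τ := regroup_surjective hR hk h1 hγ
  let σ : List (Fin m) ≃ List (Fin m) := Equiv.ofBijective (extendBlocks k τ)
    ⟨extendBlocks_injective hl hinj, extendBlocks_surjective hl hsurj⟩
  have hσl : ∀ x, (σ x).length = x.length := length_extendBlocks hl
  -- At levels divisible by k, the prefix of the image is the regrouped image of a word related to
  -- the prefix of x.
  have key : ∀ (x : List (Fin m)) (j : ℕ), k * j ≤ x.length →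
      ∃ s, R s (x.take (k * j)) ∧ (σ x).take (k * j) = τ s := by
    intro x j hj
    have hdiv : j ≤ x.length / k := (Nat.le_div_iff_mul_le hk).2 (by rwa [mul_comm] at hj)
    have hmul := Nat.mul_le_mul_left k hdiv
    have h0 := Nat.mul_div_le x.length k
    have hlen : (x.take (k * (x.length / k))).length = k * (j + (x.length / k - j)) := by
      rw [Nat.add_sub_cancel' hdiv, List.length_take]; omega
    obtain ⟨s, hs1, hs2⟩ := exists_regroup_take_eq hR hk h1 j _ hγ _ hlen
    refine ⟨s, ?_, ?_⟩
    · rwa [List.take_take, min_eq_left hmul] at hs1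
    · change (extendBlocks k τ x).take (k * j) = τ s
      rw [extendBlocks, List.take_append_of_le_length, hs2]
      rw [hl, hlen, Nat.add_sub_cancel' hdiv]
      exact hmul
  refine ⟨σ, hσl, fun x y => ?_, fun x y => ?_⟩
  · set n := confluence R x y with hn
    have hx := confluence_le_left (R := R) x y
    have hy := confluence_le_right (R := R) x y
    have hmod := Nat.div_add_mod n k
    have hlt := Nat.mod_lt n hk
    rcases Nat.eq_zero_or_pos (n / k) with h0 | hpos
    · rw [h0, mul_zero] at hmod
      omega
    -- Related words at level k(j + 1) have the same ancestor under `f`, so their images agree only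
    -- up to level kj. This block, and the remainder of n modulo k, account for the loss of 2k.
    obtain ⟨j, hj⟩ : ∃ j, n / k = j + 1 := ⟨n / k - 1, by omega⟩
    rw [hj, mul_add, mul_one] at hmod
    have hkj : k * (j + 1) = k * j + k := by ring
    obtain ⟨s, hs1, hs2⟩ := key x (j + 1) (by omega)
    obtain ⟨s', hs1', hs2'⟩ := key y (j + 1) (by omega)
    have hss : R s s' := hR.equiv.trans hs1 (hR.equiv.trans
      (hR.rel_take_of_le_confluence (by omega)) (hR.equiv.symm hs1'))
    have hsl : s.length = k * j + k := by
      rw [hR.length_eq hs1, List.length_take]; omega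
    have hsl' : s'.length = k * j + k := by
      rw [hR.length_eq hs1', List.length_take]; omega
    have e : (σ x).take (k * j) = (σ y).take (k * j) := by
      have e1 : (τ s).take (k * j) = (τ s').take (k * j) := by
        have a1 := length_of_rel_take hR h1 s (by omega)
        have a2 := length_of_rel_take hR h1 s' (by omega)
        rw [hτ, regroup_of_le hR hk h1 s (by omega), regroup_of_le hR hk h1 s' (by omega),
          ← hτ, List.take_append_of_le_length (by rw [hl]; omega),
          List.take_append_of_le_length (by rw [hl]; omega), h2 s s' hss]
      rw [← hs2, ← hs2', List.take_take, List.take_take, min_eq_left (by omega)] at e1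
      exact e1
    have := le_confluence (R := (· = ·)) (x := σ x) (y := σ y) (n := k * j)
      (by rw [hσl]; omega) (by rw [hσl]; omega) e
    omega
  · set n := confluence (· = ·) (σ x) (σ y) with hn
    have hx := confluence_le_left (R := (· = ·)) (σ x) (σ y)
    have hy := confluence_le_right (R := (· = ·)) (σ x) (σ y)
    rw [hσl, ← hn] at hx hy
    have hmod := Nat.div_add_mod n k
    have hlt := Nat.mod_lt n hk
    obtain ⟨s, hs1, hs2⟩ := key x (n / k) (by omega)
    obtain ⟨s', hs1', hs2'⟩ := key y (n / k) (by omega)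
    have e : (σ x).take (k * (n / k)) = (σ y).take (k * (n / k)) :=
      isLevelRelation_eq.rel_take_of_le_confluence (by omega)
    rw [hs2, hs2'] at e
    -- Conversely, equal images come from the same word, to which the prefixes of both x and y are
    -- related; only the remainder modulo k is lost.
    have hss := hinj e
    subst hss
    have := le_confluence (R := R) (x := x) (y := y) (n := k * (n / k)) (by omega) (by omega)
      (hR.equiv.trans (hR.equiv.symm hs1) hs1')
    omega

end Regroup

/-! ### Descendants of horizontal components -/

section Descendants

variable {E : Type*} {m : ℕ} {S : Fin m → E → E} {J : Set E}

/-- The horizontal component of a word. -/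
abbrev hComponent (S : Fin m → E → E) (J : Set E) (u : List (Fin m)) : HComponent S J :=
  (horizontalGraph S J).connectedComponentMk u

/-- `Z` is contained in the `k`-fold offspring of `T`. -/
def IsDescendant (k : ℕ) (T Z : HComponent S J) : Prop :=
  ∃ u : List (Fin m), k ≤ u.length ∧ hComponent S J u = Z ∧
    hComponent S J (u.take (u.length - k)) = T

variable (hJ : ∀ i, S i '' J ⊆ J)
include hJ

theorem hComponent_take_congr {u v : List (Fin m)} (h : hComponent S J u = hComponent S J v)
    (n : ℕ) : hComponent S J (u.take n) = hComponent S J (v.take n) :=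
  SimpleGraph.ConnectedComponent.sound
    ((isLevelRelation_hRel hJ).take (SimpleGraph.ConnectedComponent.exact h) n)

theorem length_congr {u v : List (Fin m)} (h : hComponent S J u = hComponent S J v) :
    u.length = v.length :=
  (isLevelRelation_hRel hJ).length_eq (SimpleGraph.ConnectedComponent.exact h)

theorem isDescendant_mk {k : ℕ} {T : HComponent S J} {u : List (Fin m)} :
    IsDescendant k T (hComponent S J u) ↔
      k ≤ u.length ∧ hComponent S J (u.take (u.length - k)) = T := by
  constructor
  · rintro ⟨v, h1, h2, h3⟩
    have hl := length_congr hJ h2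
    refine ⟨hl ▸ h1, ?_⟩
    rw [← h3, ← hl]
    exact (hComponent_take_congr hJ h2 _).symm
  · rintro ⟨h1, h2⟩
    exact ⟨u, h1, rfl, h2⟩

theorem finite_descendants (k : ℕ) (T : HComponent S J) : {Z | IsDescendant k T Z}.Finite := by
  induction T using SimpleGraph.ConnectedComponent.ind with | h t
  refine ((List.finite_length_eq (Fin m) (t.length + k)).image (hComponent S J)).subset ?_
  rintro Z ⟨u, h1, h2, h3⟩
  refine ⟨u, ?_, h2⟩
  have := length_congr hJ h3
  rw [List.length_take] at this
  change u.length = t.length + k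
  omega

/-- The finite set of the components contained in the `k`-fold offspring of `T`. -/
noncomputable def descendants (k : ℕ) (T : HComponent S J) : Finset (HComponent S J) :=
  (finite_descendants hJ k T).toFinset

theorem mem_descendants {k : ℕ} {T Z : HComponent S J} :
    Z ∈ descendants hJ k T ↔ IsDescendant k T Z := by
  simp [descendants]

theorem descendants_zero (T : HComponent S J) : descendants hJ 0 T = {T} := by
  ext Z
  induction Z using SimpleGraph.ConnectedComponent.ind with | h u
  rw [mem_descendants, isDescendant_mk hJ, Finset.mem_singleton]
  simp

/-- The intermediate component is that of the prefix k letters shorter; it is well defined since the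
relation passes to prefixes. -/
theorem descendants_succ [DecidableEq (HComponent S J)] (k : ℕ) (T : HComponent S J) :
    descendants hJ (k + 1) T = (descendants hJ 1 T).biUnion fun Y => descendants hJ k Y := by
  ext Z
  induction Z using SimpleGraph.ConnectedComponent.ind with | h u
  simp only [Finset.mem_biUnion, mem_descendants]
  constructor
  · intro h
    obtain ⟨h1, h2⟩ := (isDescendant_mk hJ).1 h
    refine ⟨hComponent S J (u.take (u.length - k)), (isDescendant_mk hJ).2 ⟨?_, ?_⟩,
      (isDescendant_mk hJ).2 ⟨by omega, rfl⟩⟩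
    · rw [List.length_take]; omega
    · rw [← h2, List.take_take, List.length_take]
      congr 2
      omega
  · rintro ⟨Y, h1, h2⟩
    obtain ⟨h3, rfl⟩ := (isDescendant_mk hJ).1 h2
    obtain ⟨h4, h5⟩ := (isDescendant_mk hJ).1 h1
    rw [List.length_take] at h4
    refine (isDescendant_mk hJ).2 ⟨by omega, ?_⟩
    rw [← h5, List.take_take, List.length_take]
    congr 2
    omega

theorem disjoint_descendants {k : ℕ} {Y Y' : HComponent S J} (h : Y ≠ Y') :
    Disjoint (descendants hJ k Y) (descendants hJ k Y') := by
  rw [Finset.disjoint_left]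
  intro Z
  induction Z using SimpleGraph.ConnectedComponent.ind with | h u
  rw [mem_descendants, mem_descendants, isDescendant_mk hJ, isDescendant_mk hJ]
  rintro ⟨-, h1⟩ ⟨-, h2⟩
  exact h (h1.symm.trans h2)

theorem supp_subset_offspring_iff {T Z : HComponent S J} :
    Z.supp ⊆ offspring T.supp ↔ Z ∈ descendants hJ 1 T := by
  induction Z using SimpleGraph.ConnectedComponent.ind with | h u
  rw [mem_descendants, isDescendant_mk hJ]
  constructor
  · intro h
    obtain ⟨t, ht, i, rfl⟩ := h (SimpleGraph.ConnectedComponent.connectedComponentMk_mem)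
    simpa using ht
  · rintro ⟨h1, rfl⟩ v hv
    have hv' : hComponent S J v = hComponent S J u := hv
    have hl := length_congr hJ hv'
    have hne : v ≠ [] := by
      rintro rfl
      simp at hl
      omega
    refine ⟨v.dropLast, ?_, v.getLast hne, (List.dropLast_append_getLast hne).symm⟩
    have := hComponent_take_congr hJ hv' (u.length - 1)
    rwa [← hl, ← List.dropLast_eq_take, hl] at this

/-- The words in the `k`-fold offspring of `T` are `m ^ k` times as many as those in `T`. -/
theorem sum_descendants_ncard (k : ℕ) (T : HComponent S J) :
    ∑ Z ∈ descendants hJ k T, Z.supp.ncard = T.supp.ncard * m ^ k := by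
  classical
  have hT := T.finite_supp hJ
  have e1 : ∑ Z ∈ descendants hJ k T, Z.supp.ncard =
      {u : List (Fin m) | k ≤ u.length ∧ hComponent S J (u.take (u.length - k)) = T}.ncard := by
    have : {u : List (Fin m) | k ≤ u.length ∧ hComponent S J (u.take (u.length - k)) = T} =
        ((descendants hJ k T).biUnion fun Z => (Z.finite_supp hJ).toFinset : Finset _) := by
      ext u
      simp only [Set.mem_ofPred_eq, Finset.coe_biUnion, Set.mem_iUnion, Finset.mem_coe,
        Set.Finite.coe_toFinset, mem_descendants]
      rw [← isDescendant_mk hJ]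
      constructor
      · exact fun h => ⟨_, h, rfl⟩
      · rintro ⟨Z, h, rfl⟩
        exact h
    rw [this, Set.ncard_coe_finset, Finset.card_biUnion]
    · exact Finset.sum_congr rfl fun Z _ => Set.ncard_eq_toFinset_card _ _
    · intro Z _ Z' _ hne
      refine Finset.disjoint_left.2 fun u h1 h2 => ?_
      simp only [Set.Finite.mem_toFinset] at h1 h2
      exact hne (Eq.trans (Eq.symm h1) h2)
  -- A word in the k-fold offspring is uniquely a word of T followed by k letters.
  have e2 : {u : List (Fin m) | k ≤ u.length ∧ hComponent S J (u.take (u.length - k)) = T} =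
      (fun p : List (Fin m) × List (Fin m) => p.1 ++ p.2) '' (T.supp ×ˢ {w | w.length = k}) := by
    ext u
    constructor
    · rintro ⟨h1, h2⟩
      exact ⟨(u.take (u.length - k), u.drop (u.length - k)), ⟨h2, by simp; omega⟩, by simp⟩
    · rintro ⟨⟨t, w⟩, ⟨h1, h2⟩, rfl⟩
      simp only [Set.mem_ofPred_eq] at h2
      refine ⟨by simp [h2], ?_⟩
      simpa [h2] using h1
  rw [e1, e2, Set.InjOn.ncard_image, Set.ncard_prod, ncard_length_eq]
  rintro ⟨t, w⟩ ⟨-, h1⟩ ⟨t', w'⟩ ⟨-, h2⟩ h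
  simp only [Set.mem_ofPred_eq] at h1 h2
  obtain ⟨rfl, rfl⟩ := List.append_inj' h (h1.trans h2.symm)
  rfl

/-! ### Powers of the incidence matrix -/

section Matrix

variable {r : ℕ} {e : ConnectedClass S J ≃ Fin r} {A : Matrix (Fin r) (Fin r) ℕ} {b : Fin r → ℕ}

/-- Matrix multiplication sums over the class of the component one level below T; distinct
components there have disjoint sets of descendants, so nothing is counted twice. -/
theorem incidence_pow_apply (hA : IsIncidenceMatrix S J e A) (k : ℕ) (T : HComponent S J)
    (j : Fin r) : (A ^ k) (e (connectedClass T)) j =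
      ((descendants hJ k T).filter fun Z => e (connectedClass Z) = j).card := by
  classical
  induction k generalizing T with
  | zero =>
    rw [pow_zero, descendants_zero, Finset.filter_singleton, Matrix.one_apply]
    split_ifs <;> simp
  | succ k ih =>
    have h1 : ∀ l, A (e (connectedClass T)) l =
        ((descendants hJ 1 T).filter fun Z => e (connectedClass Z) = l).card := by
      intro l
      rw [hA T l, ← Set.ncard_coe_finset]
      congr 1
      ext Z
      simp [supp_subset_offspring_iff hJ]
    rw [pow_succ', Matrix.mul_apply, descendants_succ, Finset.filter_biUnion, Finset.card_biUnion]
    · rw [← Finset.sum_fiberwise (descendants hJ 1 T) (fun Z => e (connectedClass Z))]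
      refine Finset.sum_congr rfl fun l _ => ?_
      rw [h1, ← smul_eq_mul, ← Finset.sum_const]
      refine Finset.sum_congr rfl fun Y hY => ?_
      rw [← ih Y, (Finset.mem_filter.1 hY).2]
    · intro Y _ Y' _ hne
      exact Finset.disjoint_filter_filter (disjoint_descendants hJ hne)

/-- The size vector is an eigenvector of `A` for the eigenvalue m: both sides count the words in the
k-fold offspring of a component of class i. -/
theorem sum_incidence_pow_mul (hA : IsIncidenceMatrix S J e A) (hb : IsSizeVector S J e b) (k : ℕ)
    (i : Fin r) : ∑ j, (A ^ k) i j * b j = b i * m ^ k := by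
  obtain ⟨c, rfl⟩ := e.surjective i
  induction c using Quotient.ind with | _ T
  change ∑ j, (A ^ k) (e (connectedClass T)) j * b j = b (e (connectedClass T)) * m ^ k
  rw [hb T, ← sum_descendants_ncard hJ,
    ← Finset.sum_fiberwise (descendants hJ k T) (fun Z => e (connectedClass Z))]
  refine Finset.sum_congr rfl fun l _ => ?_
  rw [incidence_pow_apply hJ hA, ← smul_eq_mul, ← Finset.sum_const]
  refine Finset.sum_congr rfl fun Z hZ => ?_
  rw [← hb Z, (Finset.mem_filter.1 hZ).2]

end Matrix

end Descendants

/-! ### Regrouping from rearrangeability -/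

theorem exists_map_card_fiber {α ι : Type*} [Fintype ι] [DecidableEq ι] [Nonempty ι] (s : Finset α)
    (c : ι → ℕ) (h : s.card = ∑ x, c x) : ∃ g : α → ι, ∀ x, (s.filter fun a => g a = x).card = c x := by
  classical
  have hc : Fintype.card s = Fintype.card (Σ x, Fin (c x)) := by simp [h]
  let ε : s ≃ (Σ x, Fin (c x)) := Fintype.equivOfCardEq hc
  refine ⟨fun a => if ha : a ∈ s then (ε ⟨a, ha⟩).1 else Classical.arbitrary ι, fun x => ?_⟩
  have hinj : Function.Injective fun y : Fin (c x) => (ε.symm ⟨x, y⟩ : α) := fun y y' hy => by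
    have h1 : (⟨x, y⟩ : Σ x, Fin (c x)) = ⟨x, y'⟩ := ε.symm.injective (Subtype.ext hy)
    exact eq_of_heq (Sigma.mk.inj h1).2
  have : (s.filter fun a => (if ha : a ∈ s then (ε ⟨a, ha⟩).1 else Classical.arbitrary ι) = x) =
      (Finset.univ : Finset (Fin (c x))).map ⟨_, hinj⟩ := by
    ext a
    simp only [Finset.mem_filter, Finset.mem_map, Finset.mem_univ, true_and,
      Function.Embedding.coeFn_mk]
    constructor
    · rintro ⟨ha, h1⟩
      rw [dif_pos ha] at h1
      subst h1
      refine ⟨(ε ⟨a, ha⟩).2, ?_⟩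
      change (ε.symm (ε ⟨a, ha⟩) : α) = a
      rw [Equiv.symm_apply_apply]
    · rintro ⟨y, rfl⟩
      refine ⟨(ε.symm ⟨x, y⟩).2, ?_⟩
      rw [dif_pos (ε.symm ⟨x, y⟩).2]
      change (ε (ε.symm ⟨x, y⟩)).1 = x
      rw [Equiv.apply_symm_apply]
  rw [this, Finset.card_map, Finset.card_univ, Fintype.card_fin]

section Rearrangement

variable {E : Type*} {m : ℕ} {S : Fin m → E → E} {J : Set E} {r : ℕ}
  {e : ConnectedClass S J ≃ Fin r} {A : Matrix (Fin r) (Fin r) ℕ} {b : Fin r → ℕ} {k : ℕ}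

/-- The components in the `k`-fold offspring of `T` can be distributed evenly among the words
of `T`. -/
theorem exists_distribution (hJ : ∀ i, S i '' J ⊆ J) (hm : 0 < m) (hA : IsIncidenceMatrix S J e A)
    (hb : IsSizeVector S J e b) (hr : IsRearrangeable (m ^ k) b (A ^ k)) (T : HComponent S J) :
    ∃ F : HComponent S J → List (Fin m), (∀ Z, F Z ∈ T.supp) ∧
      ∀ t ∈ T.supp, ∀ [DecidableEq (List (Fin m))],
        ∑ Z ∈ (descendants hJ k T).filter (fun Z => F Z = t), Z.supp.ncard = m ^ k := by
  classical
  obtain ⟨p, hp, C, hC1, hC2⟩ := hr (e (connectedClass T))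
  have hC1' : ∀ j, (A ^ k) (e (connectedClass T)) j = ∑ x, C x j := by
    intro j
    rw [hC1]
    simp [Matrix.vecMul, dotProduct]
  have hC2' : ∀ x, ∑ j, C x j * b j = m ^ k := fun x => congrFun hC2 x
  -- The definition leaves the number p of rows free, but comparing total sizes forces it to be the
  -- number of words of T, so rows can be matched with words.
  have hpT : p = T.supp.ncard := by
    have h1 := sum_incidence_pow_mul hJ hA hb k (e (connectedClass T))
    simp only [hC1', Finset.sum_mul] at h1
    rw [Finset.sum_comm] at h1
    simp only [hC2', Finset.sum_const, Finset.card_univ, Fintype.card_fin, smul_eq_mul] at h1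
    rw [← hb T]
    exact Nat.eq_of_mul_eq_mul_right (pow_pos hm k) h1
  have : Nonempty (Fin p) := ⟨⟨0, hp⟩⟩
  have : Finite T.supp := (T.finite_supp hJ).to_subtype
  have hcard : Nat.card T.supp = p := hpT.symm
  let ε : T.supp ≃ Fin p := Finite.equivFinOfCardEq hcard
  -- The column j of `C` prescribes how many components of class j each word receives; within a
  -- class the choice is arbitrary.
  have hg : ∀ j, ∃ g : HComponent S J → Fin p, ∀ x, (((descendants hJ k T).filter fun Z =>
      e (connectedClass Z) = j).filter fun Z => g Z = x).card = C x j := fun j =>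
    exists_map_card_fiber _ (fun x => C x j) ((incidence_pow_apply hJ hA k T j).symm.trans (hC1' j))
  choose g hg using hg
  refine ⟨fun Z => ε.symm (g (e (connectedClass Z)) Z), fun Z => Subtype.coe_prop _, ?_⟩
  intro t ht inst
  have hx : ∀ Z : HComponent S J, ((ε.symm (g (e (connectedClass Z)) Z) : List (Fin m)) = t) ↔
      g (e (connectedClass Z)) Z = ε ⟨t, ht⟩ := by
    intro Z
    rw [← Equiv.symm_apply_eq, Subtype.ext_iff]
  rw [← Finset.sum_fiberwise _ (fun Z => e (connectedClass Z)), ← hC2' (ε ⟨t, ht⟩)]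
  refine Finset.sum_congr rfl fun j _ => ?_
  rw [← hg j (ε ⟨t, ht⟩), ← smul_eq_mul, ← Finset.sum_const]
  refine Finset.sum_congr ?_ fun Z hZ => ?_
  · ext Z
    simp only [Finset.mem_filter, hx]
    constructor
    · rintro ⟨⟨h1, h2⟩, h3⟩
      subst h3
      exact ⟨⟨h1, rfl⟩, h2⟩
    · rintro ⟨⟨h1, h2⟩, h3⟩
      subst h2
      exact ⟨⟨h1, h3⟩, rfl⟩
  · simp only [Finset.mem_filter] at hZ
    rw [← hb Z, hZ.1.2]

theorem exists_equiv_of_isRearrangeable (hJ : ∀ i, S i '' J ⊆ J) (hm : 0 < m) (hk : 0 < k)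
    (hA : IsIncidenceMatrix S J e A) (hb : IsSizeVector S J e b)
    (hr : IsRearrangeable (m ^ k) b (A ^ k)) :
    ∃ σ : List (Fin m) ≃ List (Fin m), (∀ x, (σ x).length = x.length) ∧
      (∀ x y, confluence (HRel S J) x y ≤ confluence (· = ·) (σ x) (σ y) + 2 * k) ∧
      ∀ x y, confluence (· = ·) (σ x) (σ y) ≤ confluence (HRel S J) x y + 2 * k := by
  classical
  choose F hF1 hF2 using exists_distribution (k := k) hJ hm hA hb hr
  have hR := isLevelRelation_hRel hJ
  -- The new ancestor of u depends only on the component of u and on that of its prefix, so related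
  -- words share it.
  let f : List (Fin m) → List (Fin m) := fun u =>
    F (hComponent S J (u.take (u.length - k))) (hComponent S J u)
  have hf1 : ∀ u, HRel S J (f u) (u.take (u.length - k)) := fun u =>
    SimpleGraph.ConnectedComponent.exact (hF1 (hComponent S J (u.take (u.length - k))) _)
  refine exists_equiv_of_regrouping (f := f) hR hk (fun u _ => hf1 u) ?_ ?_
  · intro u v huv
    have h1 : hComponent S J u = hComponent S J v := SimpleGraph.ConnectedComponent.sound huv
    have h2 := hComponent_take_congr hJ h1 (u.length - k)
    rw [length_congr hJ h1] at h2
    change F _ _ = F _ _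
    rw [← h2, ← h1, length_congr hJ h1]
  · intro t
    rw [← hF2 (hComponent S J t) t rfl]
    have : {u : List (Fin m) | u.length = t.length + k ∧ f u = t} =
        (((descendants hJ k (hComponent S J t)).filter
          fun Z => F (hComponent S J t) Z = t).biUnion fun Z => (Z.finite_supp hJ).toFinset :
            Finset _) := by
      ext u
      simp only [Set.mem_ofPred_eq, Finset.coe_biUnion, Set.mem_iUnion, Finset.mem_coe,
        Set.Finite.coe_toFinset, Finset.mem_filter, mem_descendants]
      constructor
      · rintro ⟨h1, h2⟩
        have h3 : hComponent S J (u.take (u.length - k)) = hComponent S J t := by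
          rw [← h2]
          exact (SimpleGraph.ConnectedComponent.sound (hf1 u)).symm
        refine ⟨hComponent S J u, ⟨(isDescendant_mk hJ).2 ⟨by omega, h3⟩, ?_⟩, rfl⟩
        rw [← h3]
        exact h2
      · rintro ⟨Z, ⟨h1, h2⟩, rfl⟩
        obtain ⟨h3, h4⟩ := (isDescendant_mk hJ).1 h1
        have h5 := length_congr hJ h4
        rw [List.length_take] at h5
        refine ⟨by omega, ?_⟩
        change F _ _ = t
        rw [h4]
        exact h2
    rw [this, Set.ncard_coe_finset, Finset.card_biUnion]
    · exact Finset.sum_congr rfl fun Z _ => (Set.ncard_eq_toFinset_card _ _).symm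
    · intro Z _ Z' _ hne
      refine Finset.disjoint_left.2 fun u h1 h2 => ?_
      simp only [Set.Finite.mem_toFinset] at h1 h2
      exact hne (Eq.trans (Eq.symm h1) h2)

end Rearrangement

/-! ### Primitive incidence matrices -/

section Primitive

/-- Greedy packing: as long as some item is left and at least `M` units of room remain, another item
fits. If this never stopped, the number of packed items would exceed the number available. -/
theorem exists_maximal_fill {r : ℕ} (b a : Fin r → ℕ) {M : ℕ} (hb : ∀ j, b j ≤ M) (N : ℕ) :
    ∃ c ≤ a, ∑ j, c j * b j ≤ N ∧ (c = a ∨ N < ∑ j, c j * b j + M) := by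
  by_contra! h
  have key : ∀ n : ℕ, ∃ c ≤ a, ∑ j, c j * b j ≤ N ∧ n ≤ ∑ j, c j := by
    intro n
    induction n with
    | zero => exact ⟨0, fun _ => Nat.zero_le _, by simp, Nat.zero_le _⟩
    | succ n ih =>
      obtain ⟨c, h1, h2, h3⟩ := ih
      obtain ⟨h4, h5⟩ := h c h1 h2
      obtain ⟨j, hj⟩ : ∃ j, c j < a j := by
        by_contra! h6
        exact h4 (le_antisymm h1 h6)
      refine ⟨c + Pi.single j 1, fun i => ?_, ?_, ?_⟩
      · by_cases hij : i = j
        · subst hij; simpa using hj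
        · simpa [hij] using h1 i
      · simp only [Pi.add_apply, add_mul, Finset.sum_add_distrib, Pi.single_apply, ite_mul, one_mul,
          zero_mul, Finset.sum_ite_eq', Finset.mem_univ, if_true]
        have := hb j
        omega
      · simp only [Pi.add_apply, Finset.sum_add_distrib, Pi.single_apply, Finset.sum_ite_eq',
          Finset.mem_univ, if_true]
        omega
  obtain ⟨c, h1, -, h3⟩ := key (∑ j, a j + 1)
  have := Finset.sum_le_sum fun j (_ : j ∈ Finset.univ) => h1 j
  omega

/-- One row at a time: pack the items outside class i₀ greedily and complete the row to N with items
of size 1. Either fewer than `M` units are spent, which the supply of `p * M` allows, or the other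
items are exhausted and everything left is units. -/
theorem exists_matrix_of_many_units {r : ℕ} (b : Fin r → ℕ) {M N : ℕ} (hb : ∀ j, b j ≤ M)
    (hb0 : ∀ j, 0 < b j) (hMN : M ≤ N) {i₀ : Fin r} (hi₀ : b i₀ = 1) (p : ℕ) (a : Fin r → ℕ)
    (ha : ∑ j, a j * b j = p * N) (hu : p * M ≤ a i₀) :
    ∃ C : Matrix (Fin p) (Fin r) ℕ, (∀ j, a j = ∑ x, C x j) ∧ ∀ x, ∑ j, C x j * b j = N := by
  induction p generalizing a with
  | zero =>
    refine ⟨0, fun j => ?_, fun x => x.elim0⟩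
    rw [zero_mul, Finset.sum_eq_zero_iff] at ha
    have := ha j (Finset.mem_univ j)
    have := hb0 j
    simp
    rcases Nat.mul_eq_zero.1 (ha j (Finset.mem_univ j)) with h | h <;> omega
  | succ p ih =>
    obtain ⟨c, h1, h2, h3⟩ := exists_maximal_fill b (Function.update a i₀ 0) hb N
    have hc0 : c i₀ = 0 := by simpa using h1 i₀
    set s := ∑ j, c j * b j with hs
    have hsingle : ∀ n : ℕ, ∑ j, (Pi.single i₀ n : Fin r → ℕ) j * b j = n := by
      intro n
      simp [Pi.single_apply, hi₀]
    have hupd : ∑ j, a j * b j = ∑ j, Function.update a i₀ 0 j * b j + a i₀ := by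
      rw [← hsingle (a i₀), ← Finset.sum_add_distrib]
      refine Finset.sum_congr rfl fun j _ => ?_
      by_cases hj : j = i₀
      · subst hj; simp
      · simp [hj]
    have hexp : (p + 1) * M = p * M + M := by ring
    have hexpN : (p + 1) * N = p * N + N := by ring
    have hpMN : p * M ≤ p * N := Nat.mul_le_mul_left p hMN
    -- Enough units must remain for the other p rows. When the other items are exhausted, the units
    -- number pN + (N - s), and M ≤ N suffices.
    have hleft : N - s + p * M ≤ a i₀ := by
      rcases h3 with h3 | h3
      · rw [h3] at hs
        rw [← hs, ha] at hupd
        omega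
      · omega
    have hle : ∀ j, (c + Pi.single i₀ (N - s) : Fin r → ℕ) j ≤ a j := by
      intro j
      by_cases hj : j = i₀
      · subst hj; simp; omega
      · simpa [hj] using h1 j
    have hcN : ∑ j, (c + Pi.single i₀ (N - s) : Fin r → ℕ) j * b j = N := by
      simp only [Pi.add_apply, add_mul, Finset.sum_add_distrib, hsingle]
      omega
    have hsplit : ∑ j, a j * b j = ∑ j, (a - (c + Pi.single i₀ (N - s)) : Fin r → ℕ) j * b j + N := by
      refine Eq.trans ?_ (congrArg (_ + ·) hcN)
      rw [← Finset.sum_add_distrib]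
      refine Finset.sum_congr rfl fun j _ => ?_
      rw [← add_mul, Pi.sub_apply, Nat.sub_add_cancel (hle j)]
    obtain ⟨C, hC1, hC2⟩ := ih (a - (c + Pi.single i₀ (N - s))) (by omega)
      (by simp only [Pi.sub_apply, Pi.add_apply, Pi.single_eq_same, hc0]; omega)
    refine ⟨Matrix.of (Fin.cons (α := fun _ => Fin r → ℕ) (c + Pi.single i₀ (N - s))
      (Matrix.of.symm C)), fun j => ?_, fun x => ?_⟩
    · rw [Fin.sum_univ_succ]
      simp only [Matrix.of_apply, Fin.cons_zero, Fin.cons_succ, Matrix.of_symm_apply]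
      rw [← hC1 j, Pi.sub_apply]
      have := hle j
      omega
    · refine Fin.cases ?_ (fun x => ?_) x
      · simpa only [Matrix.of_apply, Fin.cons_zero] using hcN
      · simpa only [Matrix.of_apply, Fin.cons_succ, Matrix.of_symm_apply] using hC2 x

theorem pow_le_pow_apply {r : ℕ} {P : Matrix (Fin r) (Fin r) ℕ} (hP : ∀ i j, 0 < P i j) (l : ℕ)
    (i j : Fin r) : r ^ l ≤ (P ^ (l + 1)) i j := by
  induction l generalizing j with
  | zero => simpa using Nat.succ_le_of_lt (hP i j)
  | succ l ih =>
    rw [pow_succ P, Matrix.mul_apply]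
    calc r ^ (l + 1) = ∑ _x : Fin r, r ^ l := by simp [pow_succ, mul_comm]
      _ ≤ _ := Finset.sum_le_sum fun x _ => (ih x).trans (Nat.le_mul_of_pos_right _ (hP x j))

variable {E : Type*} {m : ℕ} {S : Fin m → E → E} {J : Set E} {r : ℕ}
  {e : ConnectedClass S J ≃ Fin r} {A : Matrix (Fin r) (Fin r) ℕ} {b : Fin r → ℕ}

theorem ncard_supp_root (hJ : ∀ i, S i '' J ⊆ J) : (hComponent S J []).supp.ncard = 1 := by
  rw [Set.ncard_eq_one]
  refine ⟨[], Set.eq_singleton_iff_unique_mem.2 ⟨rfl, fun u hu => ?_⟩⟩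
  exact List.length_eq_zero_iff.1 (length_congr hJ hu)

/-- Some power of a primitive incidence matrix is rearrangeable. -/
theorem IsPrimitiveMatrix.exists_isRearrangeable_pow (hJ : ∀ i, S i '' J ⊆ J)
    (hA : IsIncidenceMatrix S J e A) (hb : IsSizeVector S J e b) (hP : IsPrimitiveMatrix A) :
    ∃ k : ℕ, 0 < k ∧ IsRearrangeable (m ^ k) b (A ^ k) := by
  obtain ⟨n, hn, hpos⟩ := hP
  have hb0 : ∀ j, 0 < b j := by
    intro j
    obtain ⟨c, rfl⟩ := e.surjective j
    induction c using Quotient.ind with | _ T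
    exact (hb T).symm ▸ T.ncard_supp_pos hJ
  -- The component of the root is a single word, so its class supplies the items of size 1.
  set i₀ := e (connectedClass (hComponent S J [])) with hi
  have hi₀ : b i₀ = 1 := by rw [hi, hb, ncard_supp_root hJ]
  set M := Finset.univ.sup b with hM
  have hbM : ∀ j, b j ≤ M := fun j => Finset.le_sup (Finset.mem_univ j)
  -- The packing needs b i * M ≤ M ^ 2 units in each row, and the entries of the (l + 1)-st power of
  -- a positive matrix are at least r ^ l. For r ≥ 2 this exceeds l = M ^ 2; for r = 1 the class of
  -- the root is the only one and M ≤ 1.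
  set l := M ^ 2 with hl
  have hrM : M ^ 2 ≤ r ^ l := by
    rcases Nat.lt_or_ge r 2 with h | h
    · have hM1 : M ≤ 1 := by
        refine Finset.sup_le fun j _ => ?_
        have : j = i₀ := Fin.ext (by have := j.2; have := i₀.2; omega)
        rw [this, hi₀]
      have hr1 : r = 1 := by have := i₀.2; omega
      rw [hr1, one_pow]
      exact pow_le_one₀ (Nat.zero_le _) hM1
    · exact Nat.lt_two_pow_self.le.trans (Nat.pow_le_pow_left h _)
  refine ⟨n * (l + 1), Nat.mul_pos hn (Nat.succ_pos _), fun i => ⟨b i, hb0 i, ?_⟩⟩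
  have hentry : b i * M ≤ (A ^ (n * (l + 1))) i i₀ := by
    rw [pow_mul]
    exact (Nat.mul_le_mul_right M (hbM i)).trans
      (((sq M).symm.trans_le hrM).trans (pow_le_pow_apply hpos l i i₀))
  have hsum := sum_incidence_pow_mul hJ hA hb (n * (l + 1)) i
  -- The units alone already number at least b i * M, while all items together weigh b i * m ^ k for
  -- the chosen exponent k.
  have hMN : M ≤ m ^ (n * (l + 1)) := by
    have h1 : (A ^ (n * (l + 1))) i i₀ * b i₀ ≤ b i * m ^ (n * (l + 1)) := by
      rw [← hsum]
      exact Finset.single_le_sum (f := fun j => (A ^ (n * (l + 1))) i j * b j)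
        (fun _ _ => Nat.zero_le _) (Finset.mem_univ i₀)
    rw [hi₀, mul_one] at h1
    exact Nat.le_of_mul_le_mul_left (hentry.trans h1) (hb0 i)
  obtain ⟨C, hC1, hC2⟩ := exists_matrix_of_many_units b hbM hb0 hMN hi₀ (b i) _ hsum hentry
  refine ⟨C, ?_, funext hC2⟩
  funext j
  rw [hC1 j]
  simp [Matrix.vecMul, dotProduct]

end Primitive

/-! ### Expanding matrices -/

section Expanding

variable {d : ℕ} {B : Matrix (Fin d) (Fin d) ℝ}

theorem IsExpanding.isUnit_det (hB : IsExpanding B) : IsUnit B.det := by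
  have h0 : (0 : ℂ) ∉ spectrum ℂ (B.map (algebraMap ℝ ℂ)) := fun h => by
    have := hB 0 h
    simp at this
    linarith
  rw [spectrum.zero_notMem_iff, Matrix.isUnit_iff_isUnit_det] at h0
  have h1 : (B.map (algebraMap ℝ ℂ)).det = algebraMap ℝ ℂ B.det :=
    (RingHom.map_det (algebraMap ℝ ℂ) B).symm
  rw [h1, isUnit_iff_ne_zero] at h0
  exact isUnit_iff_ne_zero.2 fun h => h0 (by rw [h, map_zero])

theorem one_lt_norm_multiset_prod (s : Multiset ℂ) (hs : ∀ z ∈ s, 1 < ‖z‖) (h0 : s ≠ 0) :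
    1 < ‖s.prod‖ := by
  have h1 : ∀ s : Multiset ℂ, (∀ z ∈ s, 1 < ‖z‖) → 1 ≤ ‖s.prod‖ := by
    intro s
    induction s using Multiset.induction with
    | empty => simp
    | cons a s ih =>
      intro h
      rw [Multiset.prod_cons, norm_mul]
      exact one_le_mul_of_one_le_of_one_le (h a (Multiset.mem_cons_self a s)).le
        (ih fun z hz => h z (Multiset.mem_cons_of_mem hz))
  obtain ⟨a, t, rfl⟩ := s.empty_or_exists_mem.resolve_left h0 |>.imp fun a ha =>
    Multiset.exists_cons_of_mem ha
  rw [Multiset.prod_cons, norm_mul]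
  exact one_lt_mul_of_lt_of_le (hs a (Multiset.mem_cons_self a t))
    (h1 t fun z hz => hs z (Multiset.mem_cons_of_mem hz))

theorem IsExpanding.one_lt_abs_det (hd : 1 ≤ d) (hB : IsExpanding B) : 1 < |B.det| := by
  have h1 : (B.map (algebraMap ℝ ℂ)).det = algebraMap ℝ ℂ B.det :=
    (RingHom.map_det (algebraMap ℝ ℂ) B).symm
  have h2 := one_lt_norm_multiset_prod (B.map (algebraMap ℝ ℂ)).charpoly.roots
    (fun z hz => hB z (Matrix.mem_spectrum_iff_isRoot_charpoly.2
      (Polynomial.isRoot_of_mem_roots hz))) ?_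
  · rw [← Matrix.det_eq_prod_roots_charpoly, h1] at h2
    simpa using h2
  · intro h
    have h3 := (IsAlgClosed.splits (B.map (algebraMap ℝ ℂ)).charpoly).natDegree_eq_card_roots
    rw [Matrix.charpoly_natDegree_eq_dim, h, Fintype.card_fin, Multiset.card_zero] at h3
    omega

/-- Gelfand's formula: the spectral radius is below 1, so the norms of the powers are eventually
dominated by a geometric sequence. -/
theorem tendsto_pow_of_spectrum (hd : 1 ≤ d) (C : Matrix (Fin d) (Fin d) ℂ)
    (hC : ∀ z ∈ spectrum ℂ C, ‖z‖ < 1) :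
    Filter.Tendsto (fun n : ℕ => C ^ n) Filter.atTop (nhds 0) := by
  let : NormedRing (Matrix (Fin d) (Fin d) ℂ) := Matrix.linftyOpNormedRing
  let : NormedAlgebra ℂ (Matrix (Fin d) (Fin d) ℂ) := Matrix.linftyOpNormedAlgebra
  have : CompleteSpace (Matrix (Fin d) (Fin d) ℂ) := FiniteDimensional.complete ℂ _
  have : Nonempty (Fin d) := ⟨⟨0, hd⟩⟩
  have h1 : spectralRadius ℂ C < (1 : NNReal) :=
    spectrum.spectralRadius_lt_of_forall_lt C fun z hz => by
      rw [← NNReal.coe_lt_coe]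
      exact hC z hz
  obtain ⟨ρ, hρ1, hρ2⟩ := ENNReal.lt_iff_exists_nnreal_btwn.1 h1
  have h2 := spectrum.pow_nnnorm_pow_one_div_tendsto_nhds_spectralRadius C
  have h3 : ∀ᶠ n : ℕ in Filter.atTop, ‖C ^ n‖ ≤ (ρ : ℝ) ^ n := by
    filter_upwards [h2.eventually_lt_const hρ1, Filter.eventually_gt_atTop 0] with n hn hn0
    have hn0' : (0 : ℝ) < n := by exact_mod_cast hn0
    have h4 := ENNReal.rpow_le_rpow hn.le hn0'.le
    rw [← ENNReal.rpow_mul, one_div_mul_cancel hn0'.ne', ENNReal.rpow_one, ENNReal.rpow_natCast]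
      at h4
    exact_mod_cast h4
  have hρ : (ρ : ℝ) < 1 := by exact_mod_cast hρ2
  exact squeeze_zero_norm' h3 (tendsto_pow_atTop_nhds_zero_of_lt_one ρ.2 hρ)

theorem IsExpanding.tendsto_inv_pow (hd : 1 ≤ d) (hB : IsExpanding B) :
    Filter.Tendsto (fun n : ℕ => B⁻¹ ^ n) Filter.atTop (nhds 0) := by
  have hdet := hB.isUnit_det
  set C : Matrix (Fin d) (Fin d) ℂ := B.map (algebraMap ℝ ℂ)
  set f : Matrix (Fin d) (Fin d) ℝ →+* Matrix (Fin d) (Fin d) ℂ := (algebraMap ℝ ℂ).mapMatrix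
  have hfB : f B = C := rfl
  have hC1 : f B⁻¹ * C = 1 := by
    rw [← hfB, ← map_mul, Matrix.nonsing_inv_mul _ hdet, map_one]
  have hC2 : C * f B⁻¹ = 1 := by
    rw [← hfB, ← map_mul, Matrix.mul_nonsing_inv _ hdet, map_one]
  let u : (Matrix (Fin d) (Fin d) ℂ)ˣ := ⟨f B⁻¹, C, hC1, hC2⟩
  have hspec : ∀ z ∈ spectrum ℂ (f B⁻¹), ‖z‖ < 1 := by
    intro z hz
    have hz0 : z ≠ 0 := spectrum.ne_zero_of_mem_of_unit (a := u) hz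
    have h1 := hB z⁻¹ (spectrum.inv_mem_iff (r := Units.mk0 z hz0) (a := u) |>.1 hz)
    rw [norm_inv] at h1
    exact (one_lt_inv₀ (norm_pos_iff.2 hz0)).1 h1
  have h1 := tendsto_pow_of_spectrum hd (f B⁻¹) hspec
  refine tendsto_pi_nhds.2 fun i => tendsto_pi_nhds.2 fun j => ?_
  have h3 := (Complex.continuous_re.tendsto _).comp
    (tendsto_pi_nhds.1 (tendsto_pi_nhds.1 h1 i) j)
  refine h3.congr fun n => ?_
  have h4 : (f B⁻¹ ^ n) i j = ((B⁻¹ ^ n) i j : ℂ) := by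
    rw [← map_pow]
    rfl
  change ((f B⁻¹ ^ n) i j).re = _
  rw [h4, Complex.ofReal_re]

theorem IsExpanding.exists_norm_inv_pow_mulVec_le (hd : 1 ≤ d) (hB : IsExpanding B) {ε : ℝ}
    (hε : 0 < ε) : ∃ n₀ : ℕ, ∀ n, n₀ ≤ n → ∀ x : Fin d → ℝ, ‖B⁻¹ ^ n *ᵥ x‖ ≤ ε * ‖x‖ := by
  let : NormedRing (Matrix (Fin d) (Fin d) ℝ) := Matrix.linftyOpNormedRing
  have h1 := hB.tendsto_inv_pow hd
  have h2 : Filter.Tendsto (fun n : ℕ => ‖B⁻¹ ^ n‖) Filter.atTop (nhds 0) := by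
    have := h1.norm
    rwa [norm_zero] at this
  obtain ⟨n₀, hn₀⟩ := Filter.eventually_atTop.1 (h2.eventually_lt_const hε)
  exact ⟨n₀, fun n hn x => (Matrix.linfty_opNorm_mulVec _ x).trans
    (mul_le_mul_of_nonneg_right (hn₀ n hn).le (norm_nonneg x))⟩

theorem exists_norm_mulVec_le (A : Matrix (Fin d) (Fin d) ℝ) :
    ∃ C : ℝ, 0 < C ∧ ∀ x : Fin d → ℝ, ‖A *ᵥ x‖ ≤ C * ‖x‖ := by
  let : NormedRing (Matrix (Fin d) (Fin d) ℝ) := Matrix.linftyOpNormedRing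
  exact ⟨‖A‖ + 1, by positivity, fun x => (Matrix.linfty_opNorm_mulVec A x).trans
    (mul_le_mul_of_nonneg_right (by linarith) (norm_nonneg x))⟩

theorem pow_mulVec_inv_pow_mulVec (hB : IsUnit B.det) (n : ℕ) (x : Fin d → ℝ) :
    B ^ n *ᵥ (B⁻¹ ^ n *ᵥ x) = x := by
  rw [Matrix.mulVec_mulVec, Matrix.inv_pow', Matrix.mul_nonsing_inv, Matrix.one_mulVec]
  rw [Matrix.det_pow]
  exact hB.pow n

theorem inv_pow_mulVec_pow_mulVec (hB : IsUnit B.det) (n : ℕ) (x : Fin d → ℝ) :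
    B⁻¹ ^ n *ᵥ (B ^ n *ᵥ x) = x := by
  rw [Matrix.mulVec_mulVec, Matrix.inv_pow', Matrix.nonsing_inv_mul, Matrix.one_mulVec]
  rw [Matrix.det_pow]
  exact hB.pow n

end Expanding

/-! ### The ultra-metric -/

theorem Seminorm.exists_le_mul_norm {d : ℕ} (N : Seminorm ℝ (Fin d → ℝ)) :
    ∃ C : ℝ, 0 < C ∧ ∀ x, N x ≤ C * ‖x‖ := by
  refine ⟨∑ i, N (Pi.single i 1) + 1,
    add_pos_of_nonneg_of_pos (Finset.sum_nonneg fun i _ => apply_nonneg N _) one_pos, fun x => ?_⟩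
  have h1 : x = ∑ i, x i • (Pi.single i 1 : Fin d → ℝ) := pi_eq_sum_univ' x
  calc N x ≤ ∑ i, N (x i • (Pi.single i 1 : Fin d → ℝ)) := by
        conv_lhs => rw [h1]
        exact Finset.le_sum_of_subadditive N (map_zero N).le (map_add_le_add N) _ _
    _ ≤ ∑ i, N (Pi.single i 1) * ‖x‖ := by
        refine Finset.sum_le_sum fun i _ => ?_
        rw [map_smul_eq_mul, mul_comm]
        exact mul_le_mul_of_nonneg_left (norm_le_pi_norm x i) (apply_nonneg N _)
    _ ≤ _ := by
        rw [← Finset.sum_mul]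
        exact mul_le_mul_of_nonneg_right (by linarith) (norm_nonneg x)

namespace AdaptedData

variable {d : ℕ} {B : Matrix (Fin d) (Fin d) ℝ} (W : AdaptedData B)

theorem φ_integrable : MeasureTheory.Integrable W.φ := by
  by_contra h
  have := W.φ_integral
  rw [MeasureTheory.integral_undef h] at this
  exact zero_ne_one this

theorem h_nonneg (x : Fin d → ℝ) : 0 ≤ W.h x :=
  MeasureTheory.integral_nonneg fun y =>
    mul_nonneg (Set.indicator_nonneg (fun _ _ => zero_le_one) _) (W.φ_nonneg y)

theorem h_le_one (x : Fin d → ℝ) : W.h x ≤ 1 := by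
  rw [← W.φ_integral]
  refine MeasureTheory.integral_mono_of_nonneg (Filter.Eventually.of_forall fun y =>
    mul_nonneg (Set.indicator_nonneg (fun _ _ => zero_le_one) _) (W.φ_nonneg y)) W.φ_integrable
    (Filter.Eventually.of_forall fun y => ?_)
  exact mul_le_of_le_one_left (W.φ_nonneg y)
    (Set.indicator_le_self' (fun _ _ => zero_le_one) _)

/-- The mollifier lives in a ball of radius δ < 1/2, so x - y stays in the unit ball, which the
shell avoids. -/
theorem h_eq_zero {x : Fin d → ℝ} (hx : W.N x ≤ 1 / 2) : W.h x = 0 := by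
  unfold h
  rw [← MeasureTheory.integral_zero (Fin d → ℝ) ℝ]
  congr 1
  funext y
  by_cases hy : W.φ y = 0
  · rw [hy, mul_zero]
  · have h1 : W.N y < W.δ := W.φ_support hy
    have h2 : W.N (x - y) < 1 := by
      have := map_sub_le_add W.N x y
      have := W.δ_lt
      linarith
    rw [Set.indicator_of_notMem (fun h => h.2 h2), zero_mul]

/-- The terms of the series defining `w`. -/
noncomputable def wTerm (x : Fin d → ℝ) (n : ℤ) : ℝ :=
  |B.det| ^ (-(n : ℝ) / (d : ℝ)) * W.h ((B ^ n) *ᵥ x)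

theorem wTerm_nonneg (x : Fin d → ℝ) (n : ℤ) : 0 ≤ W.wTerm x n :=
  mul_nonneg (Real.rpow_nonneg (abs_nonneg _) _) (W.h_nonneg _)

theorem w_nonneg (x : Fin d → ℝ) : 0 ≤ W.w x := tsum_nonneg (W.wTerm_nonneg x)

theorem w_zero : W.w 0 = 0 := by
  unfold w
  have : ∀ n : ℤ, |B.det| ^ (-(n : ℝ) / (d : ℝ)) * W.h ((B ^ n) *ᵥ 0) = 0 := fun n => by
    rw [Matrix.mulVec_zero, W.h_eq_zero (by rw [map_zero]; norm_num), mul_zero]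
  exact (tsum_congr this).trans tsum_zero

/-- Replacing x by Bx shifts the summation index by one. This scaling law makes w measure levels. -/
theorem w_mulVec (hB : IsUnit B.det) (x : Fin d → ℝ) :
    W.w (B *ᵥ x) = |B.det| ^ ((1 : ℝ) / d) * W.w x := by
  unfold w
  rw [← (Equiv.addRight (1 : ℤ)).tsum_eq
    (fun n : ℤ => |B.det| ^ (-(n : ℝ) / (d : ℝ)) * W.h ((B ^ n) *ᵥ x)), ← tsum_mul_left]
  congr 1
  funext n
  have hpos : 0 < |B.det| := abs_pos.2 hB.ne_zero
  rw [Equiv.coe_addRight, Matrix.mulVec_mulVec, ← Matrix.zpow_add_one hB, ← mul_assoc,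
    ← Real.rpow_add hpos]
  congr 2
  push_cast
  ring

theorem w_pow_mulVec (hB : IsUnit B.det) (n : ℕ) (x : Fin d → ℝ) :
    W.w (B ^ n *ᵥ x) = |B.det| ^ ((n : ℝ) / d) * W.w x := by
  induction n with
  | zero => simp
  | succ n ih =>
    have hpos : 0 < |B.det| := abs_pos.2 hB.ne_zero
    rw [pow_succ', ← Matrix.mulVec_mulVec, W.w_mulVec hB, ih, ← mul_assoc, ← Real.rpow_add hpos]
    congr 2
    push_cast
    ring

theorem w_eq (hB : IsUnit B.det) (n : ℕ) (x : Fin d → ℝ) :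
    W.w x = |B.det| ^ (-(n : ℝ) / d) * W.w (B ^ n *ᵥ x) := by
  have hpos : 0 < |B.det| := abs_pos.2 hB.ne_zero
  rw [W.w_pow_mulVec hB, ← mul_assoc, ← Real.rpow_add hpos, neg_div, neg_add_cancel,
    Real.rpow_zero, one_mul]

/-- On bounded sets, the terms of the series defining `w` are dominated by those of a convergent
series. -/
theorem exists_summable_bound (hd : 1 ≤ d) (hB : IsExpanding B) (ρ : ℝ) :
    ∃ g : ℤ → ℝ, Summable g ∧ ∀ x : Fin d → ℝ, ‖x‖ ≤ ρ → ∀ n, W.wTerm x n ≤ g n := by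
  obtain ⟨C, hC, hN⟩ := W.N.exists_le_mul_norm
  have hd' : (0 : ℝ) < d := by exact_mod_cast hd
  have hρ : 0 < |ρ| + 1 := by positivity
  obtain ⟨n₀, hn₀⟩ := hB.exists_norm_inv_pow_mulVec_le hd
    (ε := 1 / (2 * C * (|ρ| + 1))) (by positivity)
  have hq := hB.one_lt_abs_det hd
  have hq0 : 0 < |B.det| := by linarith
  -- For n ≤ -n₀ the point B ^ n x has norm at most 1/2 and h vanishes there; the other terms are
  -- bounded through h ≤ 1 by a geometric sequence with finitely many extra terms.
  refine ⟨fun n => if -(n₀ : ℤ) < n then |B.det| ^ (-(n : ℝ) / (d : ℝ)) else 0, ?_, ?_⟩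
  · refine Summable.of_nat_of_neg ?_ ?_
    · have h1 : Summable fun n : ℕ => (|B.det| ^ (-1 / (d : ℝ))) ^ n := by
        refine summable_geometric_of_lt_one (by positivity) ?_
        exact Real.rpow_lt_one_of_one_lt_of_neg hq (div_neg_of_neg_of_pos (by norm_num) hd')
      refine Summable.of_nonneg_of_le (fun n => ?_) (fun n => ?_) h1
      · split_ifs <;> positivity
      · rw [← Real.rpow_natCast, ← Real.rpow_mul hq0.le]
        split_ifs
        · refine le_of_eq ?_
          push_cast
          ring_nf
        · positivity
    · refine summable_of_ne_finset_zero (s := Finset.range n₀) fun n hn => ?_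
      rw [Finset.mem_range] at hn
      rw [if_neg (by omega)]
  · intro x hx n
    unfold wTerm
    dsimp only
    split_ifs with hn
    · exact mul_le_of_le_one_right (by positivity) (W.h_le_one _)
    · obtain ⟨k, rfl⟩ : ∃ k : ℕ, n = -(k : ℤ) := ⟨n.natAbs, by omega⟩
      have h1 := hn₀ k (by omega) x
      rw [Matrix.zpow_neg_natCast, ← Matrix.inv_pow', W.h_eq_zero, mul_zero]
      refine (hN _).trans ((mul_le_mul_of_nonneg_left h1 hC.le).trans ?_)
      have h2 : ‖x‖ ≤ |ρ| + 1 := hx.trans ((le_abs_self ρ).trans (by linarith))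
      calc C * (1 / (2 * C * (|ρ| + 1)) * ‖x‖) = ‖x‖ / (|ρ| + 1) / 2 := by field_simp
        _ ≤ 1 / 2 := by
          gcongr
          exact (div_le_one hρ).2 h2

theorem summable_wTerm (hd : 1 ≤ d) (hB : IsExpanding B) (x : Fin d → ℝ) :
    Summable (W.wTerm x) := by
  obtain ⟨g, hg, hle⟩ := W.exists_summable_bound hd hB ‖x‖
  exact Summable.of_nonneg_of_le (W.wTerm_nonneg x) (hle x le_rfl) hg

theorem exists_w_le (hd : 1 ≤ d) (hB : IsExpanding B) (ρ : ℝ) :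
    ∃ C : ℝ, 0 < C ∧ ∀ x : Fin d → ℝ, ‖x‖ ≤ ρ → W.w x ≤ C := by
  obtain ⟨g, hg, hle⟩ := W.exists_summable_bound hd hB ρ
  refine ⟨max (∑' n, g n) 1, by positivity, fun x hx => le_max_of_le_left ?_⟩
  exact (W.summable_wTerm hd hB x).tsum_le_tsum (hle x hx) hg

/-- By scaling, w(x) = q^(-n/d) w(B ^ n x). Fix n with q^(-n/d) small against the bound of w on the
unit ball, and take x so small that B ^ n x lies in that ball. -/
theorem exists_w_lt (hd : 1 ≤ d) (hB : IsExpanding B) {c : ℝ} (hc : 0 < c) :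
    ∃ ρ : ℝ, 0 < ρ ∧ ∀ x : Fin d → ℝ, ‖x‖ < ρ → W.w x < c := by
  obtain ⟨C, hC, hle⟩ := W.exists_w_le hd hB 1
  have hq := hB.one_lt_abs_det hd
  have hq0 : 0 < |B.det| := by linarith
  have hd' : (0 : ℝ) < d := by exact_mod_cast hd
  have hlt : |B.det| ^ (-1 / (d : ℝ)) < 1 :=
    Real.rpow_lt_one_of_one_lt_of_neg hq (div_neg_of_neg_of_pos (by norm_num) hd')
  obtain ⟨n, hn⟩ := exists_pow_lt_of_lt_one (div_pos hc hC) hlt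
  rw [← Real.rpow_natCast, ← Real.rpow_mul hq0.le, lt_div_iff₀ hC] at hn
  obtain ⟨D, hD, hDle⟩ := exists_norm_mulVec_le (B ^ n)
  refine ⟨1 / D, by positivity, fun x hx => ?_⟩
  rw [W.w_eq hB.isUnit_det n x]
  refine lt_of_le_of_lt (mul_le_mul_of_nonneg_left (hle _ ?_) (by positivity)) ?_
  · refine (hDle x).trans ?_
    rw [lt_div_iff₀ hD] at hx
    linarith
  · convert hn using 3
    ring

end AdaptedData

/-! ### Self-affine systems -/

section AffineIFS

variable {d m : ℕ} {B : Matrix (Fin d) (Fin d) ℝ} {D : Fin m → Fin d → ℝ}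

theorem wordMap_affineIFS_sub (u : List (Fin m)) (x y : Fin d → ℝ) :
    wordMap (affineIFS B D) u x - wordMap (affineIFS B D) u y = B⁻¹ ^ u.length *ᵥ (x - y) := by
  induction u with
  | nil => simp [wordMap]
  | cons i u ih =>
    rw [wordMap, Function.comp_apply, Function.comp_apply, affineIFS, affineIFS, ← Matrix.mulVec_sub,
      add_sub_add_right_eq_sub, ih, Matrix.mulVec_mulVec, List.length_cons, pow_succ']

theorem continuous_wordMap_affineIFS (u : List (Fin m)) :
    Continuous (wordMap (affineIFS B D) u) := by
  induction u with
  | nil => exact continuous_id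
  | cons i u ih =>
    refine Continuous.comp ?_ ih
    unfold affineIFS
    fun_prop

theorem injective_affineIFS (hB : IsUnit B.det) (i : Fin m) :
    Function.Injective (affineIFS B D i) := by
  intro x y h
  have h1 := congrArg (fun z => B *ᵥ z) h
  simp only [affineIFS, Matrix.mulVec_mulVec, Matrix.mul_nonsing_inv _ hB, Matrix.one_mulVec] at h1
  exact add_right_cancel h1

theorem exists_mem_cell {K : Set (Fin d → ℝ)} {S : Fin m → (Fin d → ℝ) → (Fin d → ℝ)}
    (hK : K = ⋃ i, S i '' K) {x : Fin d → ℝ} (hx : x ∈ K) (n : ℕ) :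
    ∃ u : List (Fin m), u.length = n ∧ x ∈ cell S K u := by
  induction n generalizing x with
  | zero => exact ⟨[], rfl, x, hx, rfl⟩
  | succ n ih =>
    have h1 := hx
    rw [hK, Set.mem_iUnion] at h1
    obtain ⟨i, y, hy, rfl⟩ := h1
    obtain ⟨u, hu, hyu⟩ := ih hy
    refine ⟨i :: u, by simp [hu], ?_⟩
    rw [cell, wordMap, Set.image_comp]
    exact ⟨y, hyu, rfl⟩

/-- A point of K is S_u(k) for a long word u, and S_u(j) is a point of J arbitrarily close to it; J
is closed. -/
theorem IsAttractor.subset_of_isBoundedInvariant (hd : 1 ≤ d) (hB : IsExpanding B)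
    {K J : Set (Fin d → ℝ)} (hK : IsAttractor (affineIFS B D) K)
    (hJ : IsBoundedInvariant (affineIFS B D) J) : K ⊆ J := by
  intro x hx
  obtain ⟨j, hj⟩ := hJ.1
  rw [← hJ.2.1.closure_eq, Metric.mem_closure_iff]
  intro ε hε
  obtain ⟨ρ, hρ, hbd⟩ := ((hK.2.1.isBounded.sub hJ.2.2.1)).exists_pos_norm_le
  obtain ⟨n, hn⟩ := hB.exists_norm_inv_pow_mulVec_le hd (ε := ε / (2 * ρ)) (by positivity)
  obtain ⟨u, hu, k, hk, rfl⟩ := exists_mem_cell hK.2.2 hx n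
  refine ⟨wordMap (affineIFS B D) u j, cell_subset hJ.2.2.2 u ⟨j, hj, rfl⟩, ?_⟩
  rw [dist_eq_norm, wordMap_affineIFS_sub]
  refine (hn _ hu.ge _).trans_lt ?_
  have := hbd (k - j) (Set.sub_mem_sub hk hj)
  calc ε / (2 * ρ) * ‖k - j‖ ≤ ε / (2 * ρ) * ρ := by gcongr
    _ = ε / 2 := by field_simp
    _ < ε := by linarith

theorem IsAttractor.image_subset {S : Fin m → (Fin d → ℝ) → (Fin d → ℝ)} {K : Set (Fin d → ℝ)}
    (hK : IsAttractor S K) (i : Fin m) : S i '' K ⊆ K := by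
  conv_rhs => rw [hK.2.2]
  exact Set.subset_iUnion (fun i => S i '' K) i

theorem isBoundedInvariant_of_isAttractor {S : Fin m → (Fin d → ℝ) → (Fin d → ℝ)}
    {K : Set (Fin d → ℝ)} (hK : IsAttractor S K) : IsBoundedInvariant S K :=
  ⟨hK.1, hK.2.1.isClosed, hK.2.1.isBounded, hK.image_subset⟩

/-- Cells of words in the same component are close to each other on the scale of their level. -/
theorem exists_norm_pow_mulVec_sub_le (hB : IsUnit B.det) {J : Set (Fin d → ℝ)}
    (hJ : IsBoundedInvariant (affineIFS B D) J) {M : ℕ}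
    (hM : ∀ T : HComponent (affineIFS B D) J, T.supp.ncard ≤ M) :
    ∃ ρ : ℝ, 0 < ρ ∧ ∀ u v : List (Fin m), HRel (affineIFS B D) J u v →
      ∀ x ∈ cell (affineIFS B D) J u, ∀ y ∈ cell (affineIFS B D) J v,
        ‖B ^ u.length *ᵥ (x - y)‖ ≤ ρ := by
  obtain ⟨ρ, hρ, hbd⟩ := (hJ.2.2.1.sub hJ.2.2.1).exists_pos_norm_le
  have hcell : ∀ u : List (Fin m), ∀ x ∈ cell (affineIFS B D) J u,
      ∀ y ∈ cell (affineIFS B D) J u, ‖B ^ u.length *ᵥ (x - y)‖ ≤ ρ := by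
    rintro u _ ⟨x, hx, rfl⟩ _ ⟨y, hy, rfl⟩
    rw [wordMap_affineIFS_sub, pow_mulVec_inv_pow_mulVec hB]
    exact hbd _ (Set.sub_mem_sub hx hy)
  -- Rescaled by B ^ n, every cell of level n is a translate of J, and consecutive cells of a
  -- horizontal walk meet, so each step adds at most the diameter bound of J.
  have hwalk : ∀ u v : List (Fin m), ∀ p : (horizontalGraph (affineIFS B D) J).Walk u v,
      ∀ x ∈ cell (affineIFS B D) J u, ∀ y ∈ cell (affineIFS B D) J v,
        ‖B ^ u.length *ᵥ (x - y)‖ ≤ (p.length + 1) * ρ := by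
    intro u v p
    induction p with
    | nil => intro x hx y hy; simpa using hcell _ x hx y hy
    | @cons u v w h p ih =>
      intro x hx y hy
      obtain ⟨z, hz1, hz2⟩ := h.2.2
      have h1 := hcell u x hx z hz1
      have h2 := ih z hz2 y hy
      rw [← h.1] at h2
      have h3 : x - y = (x - z) + (z - y) := by abel
      rw [h3, Matrix.mulVec_add, SimpleGraph.Walk.length_cons]
      refine (norm_add_le _ _).trans ((add_le_add h1 h2).trans_eq ?_)
      push_cast
      ring
  refine ⟨(M + 1) * ρ, by positivity, fun u v h x hx y hy => ?_⟩
  obtain ⟨p, hp⟩ := exists_horizontal_walk hJ.2.2.2 hM h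
  refine (hwalk u v p x hx y hy).trans ?_
  have : (p.length : ℝ) ≤ M := by exact_mod_cast hp
  gcongr

end AffineIFS

/-! ### Self-affine sets as hyperbolic boundaries -/

/-- A vertex of `G` as a point of the completion of its visual space. -/
noncomputable def visualPoint {V : Type*} (G : SimpleGraph V) (o : V) (a : ℝ) (u : V) :
    UniformSpace.Completion (VisualSpace G o a) :=
  UniformSpace.Completion.coe' (α := VisualSpace G o a) u

theorem dist_visualPoint {V : Type*} (G : SimpleGraph V) (o : V) (a : ℝ) (u v : V) :
    dist (visualPoint G o a u) (visualPoint G o a v) = dist (α := VisualSpace G o a) u v :=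
  UniformSpace.Completion.dist_eq _ _

/-! ### Points of the boundary as limits of words -/

namespace IsLevelGraph

variable {m : ℕ} {R : List (Fin m) → List (Fin m) → Prop} {G : SimpleGraph (List (Fin m))} {M : ℕ}
  (hG : IsLevelGraph R G M) {a : ℝ} (ha : 0 < a)
include hG ha

/-- The confluence with a fixed word x is at most |x|, which keeps longer words at a distance from x
bounded away from 0. -/
theorem notMem_range_of_tendsto {s : ℕ → List (Fin m)} {ξ : UniformSpace.Completion (VisualSpace G [] a)}
    (hs : ∀ n, (s n).length = n)
    (hξ : Filter.Tendsto (fun n => visualPoint G [] a (s n)) Filter.atTop (nhds ξ)) :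
    ξ ∉ Set.range ((↑) : VisualSpace G [] a → UniformSpace.Completion (VisualSpace G [] a)) := by
  rintro ⟨x, rfl⟩
  have h1 := (tendsto_iff_dist_tendsto_zero.1 hξ).const_mul (Real.exp (a * M))
  rw [mul_zero] at h1
  let x' : List (Fin m) := x
  have h2 : Real.exp (-a * x'.length) ≤ 0 := by
    refine ge_of_tendsto h1 (Filter.eventually_atTop.2 ⟨x'.length + 1, fun n hn => ?_⟩)
    have hne : s n ≠ x' := fun h => by
      have := hs n
      rw [h] at this
      omega
    refine le_trans ?_ ((hG.le_dist_visual ha hne).trans_eq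
      (congrArg (_ * ·) (dist_visualPoint G [] a (s n) x').symm))
    rw [Real.exp_le_exp]
    have : (confluence R (s n) x' : ℝ) ≤ x'.length := by exact_mod_cast confluence_le_right _ _
    nlinarith
  exact absurd h2 (not_le.2 (Real.exp_pos _))

theorem exists_forall_le_confluence {v : ℕ → List (Fin m)}
    {ξ : UniformSpace.Completion (VisualSpace G [] a)}
    (hξ : Filter.Tendsto (fun n => visualPoint G [] a (v n)) Filter.atTop (nhds ξ))
    (hmem : ξ ∉ Set.range
      ((↑) : VisualSpace G [] a → UniformSpace.Completion (VisualSpace G [] a))) (L : ℕ) :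
    ∃ n₀, ∀ n ≥ n₀, ∀ k ≥ n₀, L ≤ confluence R (v n) (v k) := by
  obtain ⟨n₀, hn₀⟩ := Metric.cauchySeq_iff.1 hξ.cauchySeq
    (Real.exp (-a * L) / Real.exp (a * M)) (by positivity)
  have hne : ∀ n ≥ n₀, ∀ k ≥ n₀, v n ≠ v k → L ≤ confluence R (v n) (v k) := by
    intro n hn k hk hvk
    have h1 := hn₀ n hn k hk
    rw [dist_visualPoint, lt_div_iff₀' (Real.exp_pos _)] at h1
    have h2 := (hG.le_dist_visual ha hvk).trans_lt h1
    rw [Real.exp_lt_exp] at h2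
    have h3 : (L : ℝ) < confluence R (v n) (v k) := by nlinarith
    exact_mod_cast h3.le
  refine ⟨n₀, fun n hn k hk => ?_⟩
  by_cases hvk : v n = v k
  · rw [← hvk, hG.rel.confluence_self]
    -- The lower bound for the distance says nothing about equal words. But the sequence is not
    -- eventually constant, since its limit is not a vertex, and a later different word shows that v
    -- n is long.
    obtain ⟨k', hk', hk1⟩ : ∃ k' ≥ n₀, v n ≠ v k' := by
      by_contra! h
      refine hmem ⟨v n, tendsto_nhds_unique ?_ hξ⟩
      refine tendsto_const_nhds.congr' (Filter.eventually_atTop.2 ⟨n₀, fun j hj => ?_⟩)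
      exact congrArg (visualPoint G [] a) (h j hj)
    exact (hne n hn k' hk' hk1).trans (confluence_le_left _ _)
  · exact hne n hn k hk hvk

end IsLevelGraph

section Boundary

variable {d m : ℕ} {B : Matrix (Fin d) (Fin d) ℝ} {D : Fin m → Fin d → ℝ}
  {J K : Set (Fin d → ℝ)}

/-- The exponent for which the visual metric corresponds to the ultra-metric `w`. -/
noncomputable def visualExponent (B : Matrix (Fin d) (Fin d) ℝ) : ℝ := Real.log |B.det| / d

theorem IsExpanding.visualExponent_pos (hd : 1 ≤ d) (hB : IsExpanding B) :
    0 < visualExponent B :=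
  div_pos (Real.log_pos (hB.one_lt_abs_det hd)) (by exact_mod_cast hd)

theorem rpow_eq_exp_visualExponent (hB : IsUnit B.det) (n : ℕ) :
    |B.det| ^ (-(n : ℝ) / d) = Real.exp (-visualExponent B * n) := by
  rw [Real.rpow_def_of_pos (abs_pos.2 hB.ne_zero), visualExponent]
  ring_nf

theorem hRel_of_mem_cell (hKJ : K ⊆ J) {S : Fin m → (Fin d → ℝ) → (Fin d → ℝ)} {s t : List (Fin m)}
    (hl : s.length = t.length) {x : Fin d → ℝ} (hs : x ∈ cell S K s) (ht : x ∈ cell S K t) :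
    HRel S J s t :=
  HRel.of_inter hl ⟨x, cell_mono S hKJ s hs, cell_mono S hKJ t ht⟩

section

variable (hd : 1 ≤ d) (hB : IsExpanding B) (hJ : IsBoundedInvariant (affineIFS B D) J)
  (hKJ : K ⊆ J) (W : AdaptedData B)
include hd hB hJ hKJ

theorem exists_w_le_of_hRel {M : ℕ} (hM : ∀ T : HComponent (affineIFS B D) J, T.supp.ncard ≤ M) :
    ∃ C : ℝ, 0 < C ∧ ∀ u v : List (Fin m), HRel (affineIFS B D) J u v →
      ∀ x ∈ cell (affineIFS B D) K u, ∀ y ∈ cell (affineIFS B D) K v,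
        W.w (x - y) ≤ C * Real.exp (-visualExponent B * u.length) := by
  obtain ⟨ρ, -, h1⟩ := exists_norm_pow_mulVec_sub_le hB.isUnit_det hJ hM
  obtain ⟨C, hC, h2⟩ := W.exists_w_le hd hB ρ
  refine ⟨C, hC, fun u v huv x hx y hy => ?_⟩
  rw [W.w_eq hB.isUnit_det u.length, rpow_eq_exp_visualExponent hB.isUnit_det, mul_comm]
  exact mul_le_mul_of_nonneg_right
    (h2 _ (h1 u v huv x (cell_mono _ hKJ u hx) y (cell_mono _ hKJ v hy))) (Real.exp_pos _).le

omit hd hJ in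
theorem exists_le_w_of_not_hRel (hH : W.ConditionH (affineIFS B D) K) :
    ∃ c : ℝ, 0 < c ∧ ∀ u v : List (Fin m), u.length = v.length → ¬ HRel (affineIFS B D) J u v →
      ∀ x ∈ cell (affineIFS B D) K u, ∀ y ∈ cell (affineIFS B D) K v,
        c * Real.exp (-visualExponent B * u.length) ≤ W.w (x - y) := by
  obtain ⟨c, hc, h⟩ := hH
  refine ⟨c, hc, fun u v hl huv x hx y hy => ?_⟩
  rw [← rpow_eq_exp_visualExponent hB.isUnit_det]
  refine h u.length ?_ u v rfl hl.symm ?_ x hx y hy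
  · by_contra h0
    have hu : u = [] := List.length_eq_zero_iff.1 (by omega)
    have hv : v = [] := List.length_eq_zero_iff.1 (by omega)
    exact huv (by rw [hu, hv])
  · by_contra h0
    obtain ⟨z, hz1, hz2⟩ := Set.nonempty_iff_ne_empty.2 h0
    exact huv (hRel_of_mem_cell hKJ hl hz1 hz2)

/-- The diameter of a component of level n, measured on K, shrinks to 0 with n. -/
theorem exists_forall_not_hRel {M : ℕ} (hM : ∀ T : HComponent (affineIFS B D) J, T.supp.ncard ≤ M)
    {x y : Fin d → ℝ} (hxy : x ≠ y) :
    ∃ n : ℕ, ∀ u v : List (Fin m), u.length = n → x ∈ cell (affineIFS B D) K u →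
      y ∈ cell (affineIFS B D) K v → ¬ HRel (affineIFS B D) J u v := by
  obtain ⟨ρ, hρ, h1⟩ := exists_norm_pow_mulVec_sub_le hB.isUnit_det hJ hM
  have hpos : 0 < ‖x - y‖ := norm_pos_iff.2 (sub_ne_zero.2 hxy)
  obtain ⟨n, hn⟩ := hB.exists_norm_inv_pow_mulVec_le hd (ε := ‖x - y‖ / (2 * ρ)) (by positivity)
  refine ⟨n, fun u v hu hx hy huv => ?_⟩
  have h2 := h1 u v huv x (cell_mono _ hKJ u hx) y (cell_mono _ hKJ v hy)
  have h3 := hn u.length hu.ge (B ^ u.length *ᵥ (x - y))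
  rw [inv_pow_mulVec_pow_mulVec hB.isUnit_det] at h3
  have h4 : ‖x - y‖ / (2 * ρ) * ‖B ^ u.length *ᵥ (x - y)‖ ≤ ‖x - y‖ / (2 * ρ) * ρ := by gcongr
  have h5 : ‖x - y‖ / (2 * ρ) * ρ = ‖x - y‖ / 2 := by field_simp
  linarith

end

/-- A self-affine set with condition (H) and components of bounded size is Lipschitz equivalent to
the hyperbolic boundary of its augmented tree. -/
theorem lipschitzEquivalent_hyperbolicBoundary (hd : 1 ≤ d) (hB : IsExpanding B)
    (hJ : IsBoundedInvariant (affineIFS B D) J) {M : ℕ}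
    (hM : ∀ T : HComponent (affineIFS B D) J, T.supp.ncard ≤ M) (W : AdaptedData B)
    (hK : IsAttractor (affineIFS B D) K) (hH : W.ConditionH (affineIFS B D) K) :
    LipschitzEquivalent (W.wDist K)
      (fun ξ η : HyperbolicBoundary (augmentedTree (affineIFS B D) J) [] (visualExponent B) =>
        dist ξ η) := by
  set S := affineIFS B D with hS
  set a := visualExponent B with haB
  have ha : 0 < a := hB.visualExponent_pos hd
  have hKJ : K ⊆ J := hK.subset_of_isBoundedInvariant hd hB hJ
  have hG := isLevelGraph_augmentedTree hJ.2.2.2 hM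
  have hR := hG.rel
  set G := augmentedTree S J
  obtain ⟨Cw, hCw, hw_le⟩ := exists_w_le_of_hRel hd hB hJ hKJ W hM
  obtain ⟨cw, hcw, hle_w⟩ := exists_le_w_of_not_hRel hB hKJ W hH
  set C := Real.exp (a * M) with hC
  have hCpos : 0 < C := Real.exp_pos _
  let ι : List (Fin m) → UniformSpace.Completion (VisualSpace G [] a) := visualPoint G [] a
  have hι_le : ∀ u v, dist (ι u) (ι v) ≤ C * Real.exp (-a * confluence (HRel S J) u v) := by
    intro u v
    rw [dist_visualPoint]
    exact hG.dist_visual_le ha u v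
  have hle_ι : ∀ u v, u ≠ v → Real.exp (-a * confluence (HRel S J) u v) ≤ C * dist (ι u) (ι v) := by
    intro u v huv
    rw [dist_visualPoint]
    exact hG.le_dist_visual ha huv
  have hmono : ∀ {n k : ℕ}, n ≤ k → Real.exp (-a * k) ≤ Real.exp (-a * n) := by
    intro n k hnk
    rw [Real.exp_le_exp]
    have : (n : ℝ) ≤ k := by exact_mod_cast hnk
    nlinarith
  have hexp0 : Filter.Tendsto (fun n : ℕ => C * Real.exp (-a * n)) Filter.atTop (nhds 0) := by
    have h1 : Filter.Tendsto (fun n : ℕ => Real.exp (-a * n)) Filter.atTop (nhds 0) := by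
      refine Real.tendsto_exp_atBot.comp ?_
      exact tendsto_natCast_atTop_atTop.const_mul_atTop_of_neg (neg_lt_zero.2 ha)
    simpa using h1.const_mul C
  have hcode : ∀ (x : K) (n : ℕ), ∃ u : List (Fin m), u.length = n ∧ (x : Fin d → ℝ) ∈ cell S K u :=
    fun x n => exists_mem_cell hK.2.2 x.2 n
  choose u hul hux using hcode
  -- The codes chosen at different levels need not be prefixes of each other, but both cells contain
  -- x, so they are related.
  have htake : ∀ (x : K) (n j : ℕ), j ≤ n → HRel S J (u x j) ((u x n).take j) := by
    intro x n j hj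
    refine hRel_of_mem_cell hKJ ?_ (hux x j) (cell_subset_cell_take hK.image_subset _ j (hux x n))
    rw [hul, List.length_take, hul, min_eq_left hj]
  have hconf : ∀ (x y : K) (n k j : ℕ), j ≤ n → j ≤ k →
      (j ≤ confluence (HRel S J) (u x n) (u y k) ↔ HRel S J (u x j) (u y j)) := by
    intro x y n k j hn hk
    constructor
    · intro h
      exact (htake x n j hn).trans ((hR.rel_take_of_le_confluence h).trans (htake y k j hk).symm)
    · intro h
      exact le_confluence (by rwa [hul]) (by rwa [hul])
        ((htake x n j hn).symm.trans (h.trans (htake y k j hk)))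
  have hcauchy : ∀ x : K, CauchySeq fun n => ι (u x n) := by
    intro x
    refine cauchySeq_of_le_tendsto_0 (fun n : ℕ => C * Real.exp (-a * n)) ?_ hexp0
    intro n k N hn hk
    refine (hι_le _ _).trans (mul_le_mul_of_nonneg_left (hmono ?_) hCpos.le)
    exact (hconf x x n k N hn hk).2 (SimpleGraph.Reachable.refl _)
  choose Φ hΦ using fun x : K => cauchySeq_tendsto_of_complete (hcauchy x)
  have hΦmem : ∀ x, Φ x ∉ Set.range
      ((↑) : VisualSpace G [] a → UniformSpace.Completion (VisualSpace G [] a)) := fun x =>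
    hG.notMem_range_of_tendsto ha (hul x) (hΦ x)
  -- N is the last level at which the codes of x and y share a component. Both distances are
  -- comparable to exp(-aN); the lower bound for w sees level N + 1, where the separation takes
  -- place.
  have hcomp : ∀ x y : K, x ≠ y → ∃ N : ℕ,
      C⁻¹ * Real.exp (-a * N) ≤ dist (Φ x) (Φ y) ∧ dist (Φ x) (Φ y) ≤ C * Real.exp (-a * N) ∧
      cw * Real.exp (-a * (N + 1)) ≤ W.wDist K x y ∧ W.wDist K x y ≤ Cw * Real.exp (-a * N) := by
    intro x y hxy
    have hex : ∃ n, ¬ HRel S J (u x n) (u y n) := by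
      obtain ⟨n, hn⟩ := exists_forall_not_hRel hd hB hJ hKJ hM (Subtype.coe_ne_coe.2 hxy)
      exact ⟨n, hn _ _ (hul x n) (hux x n) (hux y n)⟩
    classical
    obtain ⟨N, hN⟩ : ∃ N, Nat.find hex = N + 1 := by
      refine Nat.exists_eq_succ_of_ne_zero fun h0 => ?_
      have h1 := Nat.find_spec hex
      rw [h0] at h1
      refine h1 ?_
      rw [List.length_eq_zero_iff.1 (hul x 0), List.length_eq_zero_iff.1 (hul y 0)]
    have hN1 : ¬ HRel S J (u x (N + 1)) (u y (N + 1)) := hN ▸ Nat.find_spec hex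
    have hN2 : HRel S J (u x N) (u y N) := by
      by_contra h
      have := Nat.find_min' hex h
      omega
    have hcN : ∀ n ≥ N + 1, confluence (HRel S J) (u x n) (u y n) = N := by
      intro n hn
      have h1 := (hconf x y n n N (by omega) (by omega)).2 hN2
      have h2 := mt (hconf x y n n (N + 1) hn hn).1 hN1
      omega
    have hlim : Filter.Tendsto (fun n => dist (ι (u x n)) (ι (u y n))) Filter.atTop
        (nhds (dist (Φ x) (Φ y))) := (hΦ x).dist (hΦ y)
    refine ⟨N, ?_, ?_, ?_, ?_⟩
    · refine ge_of_tendsto hlim (Filter.eventually_atTop.2 ⟨N + 1, fun n hn => ?_⟩)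
      rw [inv_mul_le_iff₀ hCpos, ← hcN n hn]
      refine hle_ι _ _ fun h => ?_
      have h1 := hcN n hn
      rw [h, hR.confluence_self, hul] at h1
      omega
    · refine le_of_tendsto hlim (Filter.eventually_atTop.2 ⟨N + 1, fun n hn => ?_⟩)
      rw [← hcN n hn]
      exact hι_le _ _
    · have := hle_w _ _ (by rw [hul, hul]) hN1 x (hux x _) y (hux y _)
      rw [hul] at this
      push_cast at this
      exact this
    · have := hw_le _ _ hN2 x (hux x _) y (hux y _)
      rw [hul] at this
      exact this
  have hinj : Function.Injective Φ := by
    intro x y hxy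
    by_contra hne
    obtain ⟨N, h1, -⟩ := hcomp x y hne
    rw [hxy, dist_self] at h1
    exact absurd h1 (not_le.2 (by positivity))
  have hsurj : ∀ ξ : UniformSpace.Completion (VisualSpace G [] a), ξ ∉ Set.range
      ((↑) : VisualSpace G [] a → UniformSpace.Completion (VisualSpace G [] a)) →
      ∃ x, Φ x = ξ := by
    intro ξ hξ
    -- Approximate ξ by words v n and let x be a limit point in K of the points S_{v n}(x₀). At each
    -- level L these points eventually lie in the cells of a single component, a finite union of
    -- compact sets, so x has its code in the same component and its image is within C exp(-aL) of
    -- ξ.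
    obtain ⟨v', hv', hv⟩ := mem_closure_iff_seq_limit.1
      (UniformSpace.Completion.denseRange_coe (α := VisualSpace G [] a) ξ)
    have hv'' : ∀ n, ∃ u : List (Fin m), visualPoint G [] a u = v' n := hv'
    choose v hvv using hv''
    have hvlim : Filter.Tendsto (fun n => ι (v n)) Filter.atTop (nhds ξ) :=
      hv.congr fun n => (hvv n).symm
    have hvconf := hG.exists_forall_le_confluence ha hvlim hξ
    obtain ⟨x₀, hx₀⟩ := hK.1
    have hpK : ∀ n, wordMap S (v n) x₀ ∈ K := fun n =>
      cell_subset hK.image_subset (v n) ⟨x₀, hx₀, rfl⟩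
    obtain ⟨x, hxK, φ, hφ, hlim⟩ := hK.2.1.tendsto_subseq hpK
    refine ⟨⟨x, hxK⟩, dist_le_zero.1 ?_⟩
    refine ge_of_tendsto hexp0 (Filter.Eventually.of_forall fun L => ?_)
    obtain ⟨n₀, hn₀⟩ := hvconf L
    set T := hComponent S J ((v n₀).take L)
    have hclosed : IsClosed (⋃ t ∈ T.supp, cell S K t) := by
      refine (T.finite_supp hJ.2.2.2).isClosed_biUnion fun t _ => ?_
      exact (hK.2.1.image (continuous_wordMap_affineIFS t)).isClosed
    have hxT : x ∈ ⋃ t ∈ T.supp, cell S K t := by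
      refine hclosed.mem_of_tendsto hlim (Filter.eventually_atTop.2 ⟨n₀, fun n hn => ?_⟩)
      refine Set.mem_biUnion (x := (v (φ n)).take L) ?_
        (cell_subset_cell_take hK.image_subset _ L ⟨x₀, hx₀, rfl⟩)
      exact SimpleGraph.ConnectedComponent.sound
        (hR.rel_take_of_le_confluence (hn₀ (φ n) (hn.trans (hφ.id_le n)) n₀ le_rfl))
    obtain ⟨t, ht, hxt⟩ := Set.mem_iUnion₂.1 hxT
    have ht' : HRel S J t ((v n₀).take L) := SimpleGraph.ConnectedComponent.exact ht
    have hLn : ∀ n ≥ n₀, L ≤ (v n).length := fun n hn =>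
      (hn₀ n hn n hn).trans (confluence_le_left _ _)
    have htl : t.length = L := by
      rw [hR.length_eq ht', List.length_take, min_eq_left (hLn n₀ le_rfl)]
    have hux' : HRel S J (u ⟨x, hxK⟩ L) t := by
      refine hRel_of_mem_cell hKJ ?_ (hux ⟨x, hxK⟩ L) hxt
      rw [hul, htl]
    refine le_of_tendsto ((hΦ ⟨x, hxK⟩).dist hvlim)
      (Filter.eventually_atTop.2 ⟨max n₀ L, fun n hn => ?_⟩)
    have hn1 : n₀ ≤ n := (le_max_left _ _).trans hn
    have hn2 : L ≤ n := (le_max_right _ _).trans hn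
    refine (hι_le _ _).trans (mul_le_mul_of_nonneg_left (hmono ?_) hCpos.le)
    refine le_confluence (by rwa [hul]) (hLn n hn1) ?_
    exact (htake ⟨x, hxK⟩ n L hn2).symm.trans (hux'.trans (ht'.trans
      (hR.rel_take_of_le_confluence (hn₀ n₀ le_rfl n hn1))))
  let σ : K ≃ HyperbolicBoundary G [] a := Equiv.ofBijective (fun x => ⟨Φ x, hΦmem x⟩)
    ⟨fun x y h => hinj (Subtype.ext_iff.1 h), fun ξ => by
      obtain ⟨x, hx⟩ := hsurj ξ.1 ξ.2
      exact ⟨x, Subtype.ext hx⟩⟩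
  have hσ : ∀ x y, dist (σ x) (σ y) = dist (Φ x) (Φ y) := fun x y => rfl
  set C' := max (Cw * C) (C * Real.exp a / cw) with hC'
  have hC'pos : 0 < C' := lt_max_of_lt_left (by positivity)
  refine ⟨σ, C', hC'pos, fun x y => ?_⟩
  change _ ≤ dist (σ x) (σ y) ∧ dist (σ x) (σ y) ≤ _
  rw [hσ]
  by_cases hxy : x = y
  · subst hxy
    rw [dist_self, AdaptedData.wDist, sub_self, W.w_zero]
    simp
  · obtain ⟨N, h1, h2, h3, h4⟩ := hcomp x y hxy
    constructor
    · rw [inv_mul_le_iff₀ hC'pos]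
      rw [inv_mul_le_iff₀ hCpos] at h1
      calc W.wDist K x y ≤ Cw * Real.exp (-a * N) := h4
        _ ≤ Cw * (C * dist (Φ x) (Φ y)) := by gcongr
        _ = Cw * C * dist (Φ x) (Φ y) := by ring
        _ ≤ _ := mul_le_mul_of_nonneg_right (le_max_left _ _) dist_nonneg
    · have h5 : Real.exp (-a * N) = Real.exp a * Real.exp (-a * (N + 1)) := by
        rw [← Real.exp_add]; ring_nf
      calc dist (Φ x) (Φ y) ≤ C * Real.exp (-a * N) := h2
        _ = C * Real.exp a / cw * (cw * Real.exp (-a * (N + 1))) := by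
          rw [h5]; field_simp
        _ ≤ C * Real.exp a / cw * W.wDist K x y := by gcongr
        _ ≤ _ := mul_le_mul_of_nonneg_right (le_max_right _ _) (W.w_nonneg _)

end Boundary

/-! ### The number of maps is smaller than the determinant -/

theorem Metric.exists_infDist_eq {d : ℕ} (hd : 1 ≤ d) {C : Set (Fin d → ℝ)} (hC : C.Nonempty)
    (hb : Bornology.IsBounded C) {s : ℝ} (hs : 0 ≤ s) : ∃ p, Metric.infDist p C = s := by
  obtain ⟨ρ, hρ, hbd⟩ := hb.exists_pos_norm_le
  have : Nonempty (Fin d) := ⟨⟨0, hd⟩⟩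
  obtain ⟨y, hy⟩ := hC
  refine mem_range_of_exists_le_of_exists_ge (Metric.continuous_infDist_pt C)
    ⟨y, (Metric.infDist_zero_of_mem hy).trans_le hs⟩ ⟨fun _ => ρ + s, ?_⟩
  rw [Metric.le_infDist ⟨y, hy⟩]
  intro z hz
  have h1 : ‖(fun _ : Fin d => ρ + s)‖ = ρ + s := by
    rw [pi_norm_const, Real.norm_of_nonneg (by positivity)]
  have h2 := norm_sub_norm_le (fun _ : Fin d => ρ + s) z
  have h3 := hbd z hz
  rw [dist_eq_norm]
  linarith

section CountBound

variable {d m : ℕ} {B : Matrix (Fin d) (Fin d) ℝ} {D : Fin m → Fin d → ℝ}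
  {J K : Set (Fin d → ℝ)}

/-- Condition (H) separates different components in w; since w is small near 0, this becomes a
separation in norm, uniform over all levels after rescaling. -/
theorem exists_separation (hd : 1 ≤ d) (hB : IsExpanding B) (hKJ : K ⊆ J) (W : AdaptedData B)
    (hH : W.ConditionH (affineIFS B D) K) :
    ∃ r : ℝ, 0 < r ∧ ∀ u v : List (Fin m), u.length = v.length → ¬ HRel (affineIFS B D) J u v →
      ∀ x ∈ cell (affineIFS B D) K u, ∀ y ∈ cell (affineIFS B D) K v,
        r ≤ ‖B ^ u.length *ᵥ x - B ^ u.length *ᵥ y‖ := by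
  obtain ⟨c, hc, h1⟩ := exists_le_w_of_not_hRel hB hKJ W hH
  obtain ⟨r, hr, h2⟩ := W.exists_w_lt hd hB hc
  refine ⟨r, hr, fun u v hl huv x hx y hy => ?_⟩
  by_contra! h3
  rw [← Matrix.mulVec_sub] at h3
  have h4 := h2 _ h3
  have h5 := h1 u v hl huv x hx y hy
  rw [W.w_eq hB.isUnit_det u.length, rpow_eq_exp_visualExponent hB.isUnit_det, mul_comm] at h5
  have h6 := le_of_mul_le_mul_left h5 (Real.exp_pos _)
  linarith

/-- The points which, on the scale of level `n`, have distance about `r` from `K`. -/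
def levelCollar (B : Matrix (Fin d) (Fin d) ℝ) (K : Set (Fin d → ℝ)) (r : ℝ) (n : ℕ) :
    Set (Fin d → ℝ) :=
  {z | Metric.infDist z ((fun x => B ^ n *ᵥ x) '' K) ∈ Set.Ioo (r / 4) (r / 2)}

theorem isOpen_levelCollar (r : ℝ) (n : ℕ) : IsOpen (levelCollar B K r n) :=
  isOpen_Ioo.preimage (Metric.continuous_infDist_pt _)

theorem le_volume_levelCollar (hd : 1 ≤ d) (hJ : IsBoundedInvariant (affineIFS B D) J)
    (hK : IsAttractor (affineIFS B D) K) {r : ℝ} (hr : 0 < r)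
    (hsep : ∀ u v : List (Fin m), u.length = v.length → ¬ HRel (affineIFS B D) J u v →
      ∀ x ∈ cell (affineIFS B D) K u, ∀ y ∈ cell (affineIFS B D) K v,
        r ≤ ‖B ^ u.length *ᵥ x - B ^ u.length *ᵥ y‖) (n : ℕ) :
    ((descendants hJ.2.2.2 n (hComponent (affineIFS B D) J [])).card : ENNReal) *
      MeasureTheory.volume (Metric.ball (0 : Fin d → ℝ) (r / 8)) ≤
        MeasureTheory.volume (levelCollar B K r n) := by
  set S := affineIFS B D
  set F := descendants hJ.2.2.2 n (hComponent S J []) with hF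
  let C : HComponent S J → Set (Fin d → ℝ) := fun Z =>
    (fun x => B ^ n *ᵥ x) '' ⋃ t ∈ Z.supp, cell S K t
  have hlen : ∀ Z ∈ F, ∀ t ∈ Z.supp, t.length = n := by
    intro Z hZ t ht
    have hZt : hComponent S J t = Z := ht
    rw [hF, mem_descendants, ← hZt, isDescendant_mk hJ.2.2.2] at hZ
    have h1 := length_congr hJ.2.2.2 hZ.2
    have h2 := hZ.1
    rw [List.length_take, List.length_nil] at h1
    omega
  have hCsep : ∀ Z ∈ F, ∀ Z' ∈ F, Z ≠ Z' → ∀ y ∈ C Z, ∀ y' ∈ C Z', r ≤ dist y y' := by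
    rintro Z hZ Z' hZ' hne _ ⟨x, hx, rfl⟩ _ ⟨x', hx', rfl⟩
    obtain ⟨t, ht, hxt⟩ := Set.mem_iUnion₂.1 hx
    obtain ⟨t', ht', hxt'⟩ := Set.mem_iUnion₂.1 hx'
    have hl := hlen Z hZ t ht
    have := hsep t t' (hl.trans (hlen Z' hZ' t' ht').symm) ?_ x hxt x' hxt'
    · rwa [hl, ← dist_eq_norm] at this
    · intro h
      refine hne (Eq.trans (Eq.symm ht) (Eq.trans ?_ ht'))
      exact SimpleGraph.ConnectedComponent.sound h
  have hCsub : ∀ Z, C Z ⊆ (fun x => B ^ n *ᵥ x) '' K := fun Z =>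
    Set.image_mono (Set.iUnion₂_subset fun t _ => cell_subset hK.image_subset t)
  have hbdd : Bornology.IsBounded ((fun x => B ^ n *ᵥ x) '' K) :=
    (hK.2.1.image (by fun_prop)).isBounded
  have hCne : ∀ Z, (C Z).Nonempty := by
    intro Z
    obtain ⟨t, ht⟩ := Z.nonempty_supp
    obtain ⟨x, hx⟩ := hK.1
    exact ⟨_, _, Set.mem_biUnion ht ⟨x, hx, rfl⟩, rfl⟩
  have hcover : ∀ y ∈ (fun x => B ^ n *ᵥ x) '' K, ∃ Z ∈ F, y ∈ C Z := by
    rintro _ ⟨x, hx, rfl⟩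
    obtain ⟨u, hu, hxu⟩ := exists_mem_cell hK.2.2 hx n
    refine ⟨hComponent S J u, ?_, x, Set.mem_biUnion (x := u) rfl hxu, rfl⟩
    rw [hF, mem_descendants, isDescendant_mk hJ.2.2.2]
    exact ⟨hu.ge, by rw [hu, Nat.sub_self, List.take_zero]⟩
  -- The value 3r/8 is the midpoint of the interval from r/4 to r/2, so the ball of radius r/8
  -- around such a point stays in the collar of its component. It is at least r/2 away from all
  -- other components, as these are r-separated.
  have hp : ∀ Z, ∃ p, Metric.infDist p (C Z) = 3 * r / 8 := fun Z =>
    Metric.exists_infDist_eq hd (hCne Z) (hbdd.subset (hCsub Z)) (by positivity)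
  choose p hp using hp
  have hnear : ∀ Z, ∀ z ∈ Metric.ball (p Z) (r / 8), ∃ y ∈ C Z, dist z y < r / 2 := by
    intro Z z hz
    refine (Metric.infDist_lt_iff (hCne Z)).1 ?_
    have h1 := Metric.infDist_le_infDist_add_dist (s := C Z) (x := z) (y := p Z)
    rw [hp] at h1
    have h2 := Metric.mem_ball.1 hz
    linarith
  have hdisj : (F : Set (HComponent S J)).PairwiseDisjoint fun Z => Metric.ball (p Z) (r / 8) := by
    intro Z hZ Z' hZ' hne
    refine Set.disjoint_left.2 fun z hz hz' => ?_
    obtain ⟨y, hy, hzy⟩ := hnear Z z hz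
    obtain ⟨y', hy', hzy'⟩ := hnear Z' z hz'
    have h1 := hCsep Z hZ Z' hZ' hne y hy y' hy'
    have h2 := dist_triangle_left y y' z
    linarith
  have hsub : (⋃ Z ∈ F, Metric.ball (p Z) (r / 8)) ⊆ levelCollar B K r n := by
    refine Set.iUnion₂_subset fun Z hZ z hz => ⟨?_, ?_⟩
    · have h1 := Metric.infDist_le_infDist_add_dist (s := C Z) (x := p Z) (y := z)
      rw [hp] at h1
      have h2 := Metric.mem_ball'.1 hz
      have h3 : min (Metric.infDist z (C Z)) (r / 2) ≤
          Metric.infDist z ((fun x => B ^ n *ᵥ x) '' K) := by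
        rw [Metric.le_infDist ((hCne Z).mono (hCsub Z))]
        intro y hy
        obtain ⟨Z', hZ', hy'⟩ := hcover y hy
        by_cases hne : Z = Z'
        · subst hne
          exact min_le_of_left_le (Metric.infDist_le_dist_of_mem hy')
        · refine min_le_of_right_le ?_
          obtain ⟨y₀, hy₀, hzy₀⟩ := hnear Z z hz
          have h4 := hCsep Z hZ Z' hZ' hne y₀ hy₀ y hy'
          have h5 := dist_triangle_left y₀ y z
          linarith
      refine lt_of_lt_of_le (lt_min ?_ ?_) h3
      · linarith
      · linarith
    · obtain ⟨y, hy, hzy⟩ := hnear Z z hz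
      exact (Metric.infDist_le_dist_of_mem (hCsub Z hy)).trans_lt hzy
  refine le_trans (le_of_eq ?_) (MeasureTheory.measure_mono hsub)
  rw [MeasureTheory.measure_biUnion_finset hdisj fun Z _ => Metric.isOpen_ball.measurableSet,
    ← nsmul_eq_mul, ← Finset.sum_const]
  refine Finset.sum_congr rfl fun Z _ => ?_
  exact (MeasureTheory.Measure.addHaar_ball_center _ _ _).symm

/-- A system with components of bounded size and condition (H) has less than `|det B|` maps. -/
theorem natCast_lt_abs_det (hd : 1 ≤ d) (hB : IsExpanding B)
    (hJ : IsBoundedInvariant (affineIFS B D) J) {M : ℕ}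
    (hM : ∀ T : HComponent (affineIFS B D) J, T.supp.ncard ≤ M) (W : AdaptedData B)
    (hK : IsAttractor (affineIFS B D) K) (hH : W.ConditionH (affineIFS B D) K) :
    (m : ℝ) < |B.det| := by
  -- If m ≥ q, the at least m ^ n / M components of level n give a collar of K whose volume, scaled
  -- back by q ^ (-n), is bounded below. Collars of sufficiently distant levels are disjoint and lie
  -- in one ball, so their total volume would be both infinite and finite.
  by_contra! hmq
  have hKJ : K ⊆ J := hK.subset_of_isBoundedInvariant hd hB hJ
  have hdet := hB.isUnit_det
  have hq : 0 < |B.det| := abs_pos.2 hdet.ne_zero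
  obtain ⟨r, hr, hsep⟩ := exists_separation hd hB hKJ W hH
  obtain ⟨l', hl'⟩ := hB.exists_norm_inv_pow_mulVec_le hd (ε := 1 / 2) (by norm_num)
  set l := l' + 1 with hl
  have hhalf : ∀ n ≥ l, ∀ x : Fin d → ℝ, ‖x‖ ≤ 1 / 2 * ‖B ^ n *ᵥ x‖ := by
    intro n hn x
    have := hl' n (by omega) (B ^ n *ᵥ x)
    rwa [inv_pow_mulVec_pow_mulVec hdet] at this
  set H : ℕ → Set (Fin d → ℝ) := fun n => (fun x => B ^ n *ᵥ x) ⁻¹' levelCollar B K r n with hHdef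
  have hHopen : ∀ n, IsOpen (H n) := fun n => (isOpen_levelCollar r n).preimage (by fun_prop)
  have hHnear : ∀ n, ∀ x ∈ H n, ∃ k ∈ K, ‖B ^ n *ᵥ (x - k)‖ < r / 2 := by
    intro n x hx
    obtain ⟨_, ⟨k, hk, rfl⟩, hlt⟩ := (Metric.infDist_lt_iff (hK.1.image _)).1 hx.2
    refine ⟨k, hk, ?_⟩
    rwa [Matrix.mulVec_sub, ← dist_eq_norm]
  -- Being within r/2 of K on the scale n' means being within r/4 on the coarser scale n, which the
  -- collar of level n excludes.
  have hHdisj : ∀ n n', n + l ≤ n' → Disjoint (H n) (H n') := by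
    intro n n' hn
    refine Set.disjoint_left.2 fun x hx hx' => ?_
    obtain ⟨k, hk, hlt⟩ := hHnear n' x hx'
    have h1 := hhalf (n' - n) (by omega) (B ^ n *ᵥ (x - k))
    rw [Matrix.mulVec_mulVec, ← pow_add, Nat.sub_add_cancel (by omega)] at h1
    have h2 : r / 4 < _ := hx.1
    have h3 := Metric.infDist_le_dist_of_mem (x := B ^ n *ᵥ x)
      (Set.mem_image_of_mem (fun x => B ^ n *ᵥ x) hk)
    rw [dist_eq_norm, ← Matrix.mulVec_sub] at h3
    linarith
  obtain ⟨ρ, hρ, hbd⟩ := hK.2.1.isBounded.exists_pos_norm_le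
  have hHsub : ∀ n ≥ l, H n ⊆ Metric.closedBall 0 (ρ + r) := by
    intro n hn x hx
    obtain ⟨k, hk, hlt⟩ := hHnear n x hx
    have h1 := hhalf n hn (x - k)
    have h2 := hbd k hk
    have h3 := norm_sub_norm_le x k
    rw [mem_closedBall_zero_iff]
    linarith
  have hMpos : 0 < M := (HComponent.ncard_supp_pos hJ.2.2.2 (hComponent _ J [])).trans_le (hM _)
  set v := MeasureTheory.volume (Metric.ball (0 : Fin d → ℝ) (r / 8)) with hv
  have hv0 : v ≠ 0 := (Metric.measure_ball_pos _ _ (by positivity)).ne'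
  have hHvol : ∀ n, ENNReal.ofReal (M : ℝ)⁻¹ * v ≤ MeasureTheory.volume (H n) := by
    intro n
    have h1 := le_volume_levelCollar hd hJ hK hr hsep n
    have hcount := sum_descendants_ncard hJ.2.2.2 n (hComponent (affineIFS B D) J [])
    rw [ncard_supp_root hJ.2.2.2, one_mul] at hcount
    set F := descendants hJ.2.2.2 n (hComponent (affineIFS B D) J [])
    have h2 : m ^ n ≤ F.card * M := by
      rw [← hcount, ← smul_eq_mul, ← Finset.sum_const]
      exact Finset.sum_le_sum fun Z _ => hM Z
    have hdet' : LinearMap.det (Matrix.toLin' (B ^ n)) = B.det ^ n := by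
      rw [LinearMap.det_toLin', Matrix.det_pow]
    have h3 : MeasureTheory.volume (H n) =
        ENNReal.ofReal (|B.det| ^ n)⁻¹ * MeasureTheory.volume (levelCollar B K r n) := by
      have := MeasureTheory.Measure.addHaar_preimage_linearMap MeasureTheory.volume
        (f := Matrix.toLin' (B ^ n)) (by rw [hdet']; exact pow_ne_zero _ hdet.ne_zero)
        (levelCollar B K r n)
      rw [hdet', abs_inv, abs_pow] at this
      exact this
    rw [h3]
    refine le_trans ?_ (mul_le_mul_right h1 _)
    rw [← mul_assoc, ← ENNReal.ofReal_natCast, ← ENNReal.ofReal_mul (by positivity)]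
    refine mul_le_mul_left (ENNReal.ofReal_le_ofReal ?_) _
    have h4 : |B.det| ^ n ≤ F.card * M := by
      refine (pow_le_pow_left₀ hq.le hmq n).trans ?_
      exact_mod_cast h2
    have hM0 : (0 : ℝ) < M := by exact_mod_cast hMpos
    rw [inv_mul_eq_div, le_div_iff₀ (by positivity), inv_mul_le_iff₀ hM0]
    linarith
  have hsum := MeasureTheory.measure_iUnion (μ := MeasureTheory.volume)
    (f := fun j : ℕ => H (l * (j + 1))) ?_ fun j => (hHopen _).measurableSet
  · have h1 : MeasureTheory.volume (⋃ j : ℕ, H (l * (j + 1))) < ⊤ := by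
      refine (MeasureTheory.measure_mono (Set.iUnion_subset fun j => hHsub _ ?_)).trans_lt
        (isCompact_closedBall (0 : Fin d → ℝ) (ρ + r)).measure_lt_top
      exact Nat.le_mul_of_pos_right l (Nat.succ_pos j)
    rw [hsum] at h1
    have h2 : ENNReal.ofReal (M : ℝ)⁻¹ * v ≠ 0 := by
      refine mul_ne_zero ?_ hv0
      rw [Ne, ENNReal.ofReal_eq_zero, not_le]
      positivity
    refine absurd h1 (not_lt.2 ?_)
    rw [← ENNReal.tsum_const_eq_top_of_ne_zero (α := ℕ) h2]
    exact ENNReal.tsum_le_tsum fun j => hHvol _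
  · intro i j hij
    have key : ∀ i j : ℕ, i < j → Disjoint (H (l * (i + 1))) (H (l * (j + 1))) := by
      intro i j hij
      refine hHdisj _ _ ?_
      calc l * (i + 1) + l = l * (i + 1 + 1) := by ring
        _ ≤ l * (j + 1) := Nat.mul_le_mul_left l (by omega)
    rcases lt_or_gt_of_ne hij with h | h
    · exact key i j h
    · exact (key j i h).symm

end CountBound

/-! ### Positivity of the ultra-metric for a standard choice of data -/

namespace AdaptedData

variable {d : ℕ} {B : Matrix (Fin d) (Fin d) ℝ} (W : AdaptedData B)

theorem mem_shell_iff (hB : IsUnit B.det) (x : Fin d → ℝ) :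
    x ∈ W.shell ↔ W.N (B⁻¹ *ᵥ x) < 1 ∧ ¬ W.N x < 1 := by
  unfold shell unitBall
  rw [Set.mem_sdiff]
  refine and_congr ⟨?_, fun h => ⟨_, h, ?_⟩⟩ Iff.rfl
  · rintro ⟨y, hy, rfl⟩
    simpa [Matrix.mulVec_mulVec, Matrix.nonsing_inv_mul _ hB] using hy
  · simp [Matrix.mulVec_mulVec, Matrix.mul_nonsing_inv _ hB]

variable (hB : IsUnit B.det) (hN : ∀ x, W.N x = ‖x‖)
include hB hN

theorem measurableSet_shell : MeasurableSet W.shell := by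
  have : W.shell = {x | ‖B⁻¹ *ᵥ x‖ < 1} \ {x | ‖x‖ < 1} := by
    ext x
    rw [W.mem_shell_iff hB, hN, hN]
    rfl
  rw [this]
  exact (isOpen_lt (by fun_prop) continuous_const).measurableSet.diff
    (isOpen_lt continuous_norm continuous_const).measurableSet

theorem continuous_h : Continuous W.h := by
  have h1 : HasCompactSupport W.φ := by
    refine HasCompactSupport.of_support_subset_isCompact (isCompact_closedBall 0 W.δ) ?_
    intro x hx
    have h2 : W.N x < W.δ := W.φ_support hx
    rw [hN] at h2
    rw [mem_closedBall_zero_iff]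
    exact h2.le
  have h2 : MeasureTheory.LocallyIntegrable (W.shell.indicator fun _ => (1 : ℝ))
      (MeasureTheory.volume : MeasureTheory.Measure (Fin d → ℝ)) :=
    (MeasureTheory.locallyIntegrable_const 1).indicator (W.measurableSet_shell hB hN)
  have h3 := h1.continuous_convolution_left (ContinuousLinearMap.mul ℝ ℝ) W.φ_smooth.continuous h2
  convert h3 using 1
  funext x
  unfold h MeasureTheory.convolution
  congr 1
  funext y
  rw [ContinuousLinearMap.mul_apply', mul_comm]

variable (hφ : Function.support W.φ = {x | ‖x‖ < W.δ})
include hφ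

/-- The shell contains part of its inner boundary, so z itself may not be an interior point. Moving
outward to (1 + t)z with small t > 0 reaches the interior, and φ is positive on the whole δ-ball, so
the integrand is positive on a non-empty open set. -/
theorem h_pos_of_mem_shell {z : Fin d → ℝ} (hz : z ∈ W.shell) : 0 < W.h z := by
  have hmeas := W.measurableSet_shell hB hN
  obtain ⟨hz1, hz2⟩ := (W.mem_shell_iff hB z).1 hz
  rw [hN] at hz1 hz2
  rw [not_lt] at hz2
  unfold h
  have hint : MeasureTheory.Integrable
      fun y => W.shell.indicator (fun _ => (1 : ℝ)) (z - y) * W.φ y := by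
    refine W.φ_integrable.mono ?_ (Filter.Eventually.of_forall fun y => ?_)
    · have hm : Measurable fun y : Fin d → ℝ => W.shell.indicator (fun _ => (1 : ℝ)) (z - y) :=
        (measurable_const.indicator hmeas).comp (measurable_const.sub measurable_id)
      exact (hm.mul W.φ_smooth.continuous.measurable).aestronglyMeasurable
    · rw [norm_mul]
      refine mul_le_of_le_one_left (norm_nonneg _) ?_
      by_cases hy : z - y ∈ W.shell <;> simp [hy]
  rw [MeasureTheory.integral_pos_iff_support_of_nonneg (fun y =>
    mul_nonneg (Set.indicator_nonneg (fun _ _ => zero_le_one) _) (W.φ_nonneg y)) hint]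
  set U : Set (Fin d → ℝ) := {y | ‖y‖ < W.δ} ∩ {y | 1 < ‖z - y‖} ∩ {y | ‖B⁻¹ *ᵥ (z - y)‖ < 1}
    with hU
  have hUo : IsOpen U := ((isOpen_lt continuous_norm continuous_const).inter
    (isOpen_lt continuous_const (by fun_prop))).inter (isOpen_lt (by fun_prop) continuous_const)
  have hUne : U.Nonempty := by
    have h1 : ∀ᶠ t : ℝ in nhds 0, ‖-t • z‖ < W.δ := by
      refine (Continuous.tendsto (by fun_prop) 0).eventually_lt_const ?_
      simpa using W.δ_pos
    have h2 : ∀ᶠ t : ℝ in nhds 0, ‖B⁻¹ *ᵥ (z - -t • z)‖ < 1 := by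
      refine (Continuous.tendsto (by fun_prop) 0).eventually_lt_const ?_
      simpa using hz1
    obtain ⟨t, ⟨ht1, ht2⟩, ht0⟩ := (((h1.and h2).filter_mono nhdsWithin_le_nhds).and
      (self_mem_nhdsWithin (s := Set.Ioi (0 : ℝ)))).exists
    refine ⟨-t • z, ⟨ht1, ?_⟩, ht2⟩
    have h3 : z - -t • z = (1 + t) • z := by
      rw [add_smul, one_smul, neg_smul, sub_neg_eq_add]
    have ht0' : 0 < t := ht0
    change 1 < ‖z - -t • z‖
    rw [h3, norm_smul, Real.norm_of_nonneg (by linarith)]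
    nlinarith
  refine (hUo.measure_pos _ hUne).trans_le (MeasureTheory.measure_mono ?_)
  rintro y ⟨⟨hy1, hy2⟩, hy3⟩
  have hy4 : z - y ∈ W.shell := by
    rw [W.mem_shell_iff hB, hN, hN]
    exact ⟨hy3, not_lt.2 (le_of_lt hy2)⟩
  have hy5 : y ∈ Function.support W.φ := by rw [hφ]; exact hy1
  rw [Function.mem_support, Set.indicator_of_mem hy4, one_mul]
  exact hy5

-- Contract x into the unit ball; the first iterate of B that leaves the ball lies in the shell.
omit hN hφ in
theorem exists_zpow_mulVec_mem_shell (hd : 1 ≤ d) (hN : ∀ x, W.N x = ‖x‖) (hB' : IsExpanding B)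
    {x : Fin d → ℝ} (hx : x ≠ 0) : ∃ n : ℤ, (B ^ n) *ᵥ x ∈ W.shell := by
  have hpos : 0 < ‖x‖ := norm_pos_iff.2 hx
  obtain ⟨k₀, hk₀⟩ := hB'.exists_norm_inv_pow_mulVec_le hd (ε := 1 / (2 * ‖x‖)) (by positivity)
  set y := B⁻¹ ^ k₀ *ᵥ x with hy
  have hy1 : ‖y‖ < 1 := by
    refine (hk₀ k₀ le_rfl x).trans_lt ?_
    have : 1 / (2 * ‖x‖) * ‖x‖ = 1 / 2 := by field_simp
    rw [this]
    norm_num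
  have hy0 : 0 < ‖y‖ := by
    rw [norm_pos_iff]
    intro h
    have := pow_mulVec_inv_pow_mulVec hB k₀ x
    rw [← hy, h, Matrix.mulVec_zero] at this
    exact hx this.symm
  have hex : ∃ k : ℕ, 1 ≤ ‖B ^ k *ᵥ y‖ := by
    obtain ⟨k, hk⟩ := hB'.exists_norm_inv_pow_mulVec_le hd hy0
    refine ⟨k, ?_⟩
    have := hk k le_rfl (B ^ k *ᵥ y)
    rw [inv_pow_mulVec_pow_mulVec hB] at this
    by_contra! h
    nlinarith
  classical
  obtain ⟨k, hk⟩ : ∃ k, Nat.find hex = k + 1 := by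
    refine Nat.exists_eq_succ_of_ne_zero fun h0 => ?_
    have h1 := Nat.find_spec hex
    rw [h0, pow_zero, Matrix.one_mulVec] at h1
    linarith
  have h1 : 1 ≤ ‖B ^ (k + 1) *ᵥ y‖ := hk ▸ Nat.find_spec hex
  have h2 : ‖B ^ k *ᵥ y‖ < 1 := by
    by_contra! h
    have := Nat.find_min' hex h
    omega
  refine ⟨((k + 1 : ℕ) : ℤ) + -(k₀ : ℤ), ?_⟩
  rw [Matrix.zpow_add hB, Matrix.zpow_neg_natCast, zpow_natCast, ← Matrix.inv_pow',
    ← Matrix.mulVec_mulVec, ← hy, W.mem_shell_iff hB, hN, hN, not_lt]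
  refine ⟨?_, h1⟩
  rwa [pow_succ', ← Matrix.mulVec_mulVec, Matrix.mulVec_mulVec, Matrix.nonsing_inv_mul _ hB,
    Matrix.one_mulVec]

omit hB in
/-- `w` is bounded from below on compact sets which do not contain the origin. -/
theorem exists_le_w_of_isCompact (hd : 1 ≤ d) (hB' : IsExpanding B) {P : Set (Fin d → ℝ)}
    (hP : IsCompact P) (h0 : (0 : Fin d → ℝ) ∉ P) : ∃ c : ℝ, 0 < c ∧ ∀ x ∈ P, c ≤ W.w x := by
  have hB := hB'.isUnit_det
  -- A positive lower bound passes to subsets and finite unions, so it is needed only locally. There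
  -- a single term of the series, positive at the point and continuous, provides it.
  refine hP.induction_on (p := fun s => ∃ c : ℝ, 0 < c ∧ ∀ x ∈ s, c ≤ W.w x)
    ⟨1, one_pos, fun x hx => hx.elim⟩ ?_ ?_ ?_
  · rintro s t hst ⟨c, hc, h⟩
    exact ⟨c, hc, fun x hx => h x (hst hx)⟩
  · rintro s t ⟨c, hc, h⟩ ⟨c', hc', h'⟩
    refine ⟨min c c', lt_min hc hc', ?_⟩
    rintro x (hx | hx)
    · exact (min_le_left _ _).trans (h x hx)
    · exact (min_le_right _ _).trans (h' x hx)
  · intro x hx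
    obtain ⟨n, hn⟩ := W.exists_zpow_mulVec_mem_shell hB hd hN hB' (x := x) fun h => h0 (h ▸ hx)
    have hpos := W.h_pos_of_mem_shell hB hN hφ hn
    have hq : 0 < |B.det| := abs_pos.2 hB.ne_zero
    have hcont : Continuous fun y => W.h ((B ^ n) *ᵥ y) :=
      (W.continuous_h hB hN).comp (by fun_prop)
    have hev := (hcont.tendsto x).eventually_const_lt (half_lt_self hpos)
    refine ⟨_, mem_nhdsWithin_of_mem_nhds hev,
      |B.det| ^ (-(n : ℝ) / (d : ℝ)) * (W.h ((B ^ n) *ᵥ x) / 2), by positivity, fun y hy => ?_⟩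
    refine le_trans ?_ ((W.summable_wTerm hd hB' y).le_tsum n fun k _ => W.wTerm_nonneg y k)
    exact mul_le_mul_of_nonneg_left (le_of_lt hy) (by positivity)

-- The differences of points in different first-level pieces form a compact set without 0, on which
-- w is bounded below. Cancelling the common prefix of two words reduces every level to this case by
-- scaling.
open scoped Pointwise in
omit hB in
theorem conditionH_of_isDustLike (hd : 1 ≤ d) (hB' : IsExpanding B) {m : ℕ}
    {D : Fin m → Fin d → ℝ} {K : Set (Fin d → ℝ)} (hK : IsAttractor (affineIFS B D) K)
    (hdust : IsDustLike (affineIFS B D) K) : W.ConditionH (affineIFS B D) K := by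
  have hB := hB'.isUnit_det
  set S := affineIFS B D with hS
  have hcompact : ∀ i, IsCompact (S i '' K) := fun i =>
    hK.2.1.image (by rw [hS]; unfold affineIFS; fun_prop)
  set P : Set (Fin d → ℝ) := ⋃ i, ⋃ j, ⋃ _ : i ≠ j, S i '' K - S j '' K with hP
  have hPc : IsCompact P := isCompact_iUnion fun i => isCompact_iUnion fun j =>
    isCompact_iUnion fun _ => by
      rw [← Set.image2_sub, ← Set.image_prod]
      exact ((hcompact i).prod (hcompact j)).image continuous_sub
  have hP0 : (0 : Fin d → ℝ) ∉ P := by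
    simp only [hP, Set.mem_iUnion, not_exists]
    rintro i j hij ⟨x, hx, y, hy, hxy⟩
    have hxy' : x = y := sub_eq_zero.1 hxy
    exact Set.disjoint_left.1 (hdust i j hij) hx (hxy' ▸ hy)
  obtain ⟨c, hc, hcP⟩ := W.exists_le_w_of_isCompact hN hφ hd hB' hPc hP0
  have hq := hB'.one_lt_abs_det hd
  have hq0 : 0 < |B.det| := by linarith
  have key : ∀ u v : List (Fin m), u.length = v.length → u ≠ v → ∀ x ∈ cell S K u,
      ∀ y ∈ cell S K v, c * |B.det| ^ (-(u.length : ℝ) / (d : ℝ)) ≤ W.w (x - y) := by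
    intro u
    induction u with
    | nil => intro v h hne; exact absurd (List.length_eq_zero_iff.1 h.symm).symm hne
    | cons i u ih =>
      rintro (_ | ⟨j, v⟩) hl hne x hx y hy
      · simp at hl
      · rw [cell, wordMap, Set.image_comp] at hx hy
        by_cases hij : i = j
        · subst hij
          obtain ⟨x', hx', rfl⟩ := hx
          obtain ⟨y', hy', rfl⟩ := hy
          have h1 := ih v (by simpa using hl) (fun h => hne (by rw [h])) x' hx' y' hy'
          have h2 : S i x' - S i y' = B⁻¹ *ᵥ (x' - y') := by
            have := wordMap_affineIFS_sub (B := B) (D := D) [i] x' y'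
            rwa [List.length_singleton, pow_one] at this
          have h3 := W.w_eq hB 1 (S i x' - S i y')
          rw [pow_one, h2, Matrix.mulVec_mulVec, Matrix.mul_nonsing_inv _ hB,
            Matrix.one_mulVec] at h3
          rw [h2, h3]
          calc c * |B.det| ^ (-((i :: u).length : ℝ) / (d : ℝ))
              = |B.det| ^ (-((1 : ℕ) : ℝ) / (d : ℝ)) *
                (c * |B.det| ^ (-(u.length : ℝ) / (d : ℝ))) := by
                rw [mul_left_comm, ← Real.rpow_add hq0, List.length_cons]
                congr 2
                push_cast
                ring
            _ ≤ _ := mul_le_mul_of_nonneg_left h1 (by positivity)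
        · refine le_trans ?_ (hcP (x - y) ?_)
          · refine mul_le_of_le_one_right hc.le ?_
            refine Real.rpow_le_one_of_one_le_of_nonpos hq.le ?_
            exact div_nonpos_of_nonpos_of_nonneg (neg_nonpos.2 (Nat.cast_nonneg _))
              (Nat.cast_nonneg _)
          · simp only [hP, Set.mem_iUnion]
            exact ⟨i, j, hij, Set.sub_mem_sub
              (Set.image_mono (cell_subset hK.image_subset u) hx)
              (Set.image_mono (cell_subset hK.image_subset v) hy)⟩
  refine ⟨c, hc, fun n _ u v hu hv huv x hx y hy => ?_⟩
  rw [← hu]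
  refine key u v (hu.trans hv.symm) ?_ x hx y hy
  rintro rfl
  rw [Set.inter_self] at huv
  rw [huv] at hx
  exact hx

end AdaptedData

/-! ### Existence of dust-like systems -/

/-- Injective contractions of a compact set with disjoint images have an attractor. -/
theorem exists_isAttractor_of_disjoint {d m : ℕ} (hm : 0 < m)
    {S : Fin m → (Fin d → ℝ) → (Fin d → ℝ)} (hcont : ∀ i, Continuous (S i))
    (hinj : ∀ i, Function.Injective (S i)) {Q : Set (Fin d → ℝ)} (hQ : IsCompact Q)
    (hne : Q.Nonempty) (hsub : ∀ i, S i '' Q ⊆ Q)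
    (hdisj : ∀ i j, i ≠ j → Disjoint (S i '' Q) (S j '' Q)) :
    ∃ K, IsAttractor S K ∧ IsDustLike S K := by
  let F : Set (Fin d → ℝ) → Set (Fin d → ℝ) := fun A => ⋃ i, S i '' A
  have hmono : ∀ {A A'}, A ⊆ A' → F A ⊆ F A' := fun h =>
    Set.iUnion_mono fun i => Set.image_mono h
  let C : ℕ → Set (Fin d → ℝ) := fun n => F^[n] Q
  have hCs : ∀ n, C (n + 1) = F (C n) := fun n => Function.iterate_succ_apply' F n Q
  have hCanti : ∀ n, C (n + 1) ⊆ C n := by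
    intro n
    induction n with
    | zero => exact Set.iUnion_subset hsub
    | succ n ih => rw [hCs (n + 1), hCs n]; exact hmono (hCs n ▸ ih)
  have hCQ : ∀ n, C n ⊆ Q := by
    intro n
    induction n with
    | zero => exact subset_rfl
    | succ n ih => exact (hCanti n).trans ih
  have hCc : ∀ n, IsCompact (C n) := by
    intro n
    induction n with
    | zero => exact hQ
    | succ n ih => rw [hCs]; exact isCompact_iUnion fun i => ih.image (hcont i)
  have hCne : ∀ n, (C n).Nonempty := by
    intro n
    induction n with
    | zero => exact hne
    | succ n ih =>
      rw [hCs]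
      exact (ih.image (S ⟨0, hm⟩)).mono (Set.subset_iUnion (fun i => S i '' C n) _)
  refine ⟨⋂ n, C n, ⟨?_, ?_, ?_⟩, fun i j hij => ?_⟩
  · exact IsCompact.nonempty_iInter_of_sequence_nonempty_isCompact_isClosed C hCanti hCne hQ
      fun n => (hCc n).isClosed
  · exact hQ.of_isClosed_subset (isClosed_iInter fun n => (hCc n).isClosed) (Set.iInter_subset C 0)
  · refine Set.Subset.antisymm (fun x hx => ?_) ?_
    · rw [Set.mem_iInter] at hx
      have h1 := hx 1
      rw [hCs 0, Set.mem_iUnion] at h1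
      obtain ⟨i, y, hy, rfl⟩ := h1
      refine Set.mem_iUnion.2 ⟨i, y, Set.mem_iInter.2 fun n => ?_, rfl⟩
      have h2 := hx (n + 1)
      rw [hCs n, Set.mem_iUnion] at h2
      obtain ⟨j, z, hz, hzy⟩ := h2
      -- Disjointness and injectivity give x a unique preimage in Q, so the same y serves at every
      -- stage n.
      by_cases hij : j = i
      · subst hij
        exact hinj j hzy ▸ hz
      · exact (Set.disjoint_left.1 (hdisj j i hij) ⟨z, hCQ n hz, hzy⟩ ⟨y, hy, rfl⟩).elim
    · refine Set.iUnion_subset fun i => ?_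
      rintro _ ⟨y, hy, rfl⟩
      rw [Set.mem_iInter] at hy ⊢
      intro n
      refine hCanti n ?_
      rw [hCs]
      exact Set.mem_iUnion.2 ⟨i, y, hy n, rfl⟩
  · exact (hdisj i j hij).mono (Set.image_mono (Set.iInter_subset C 0))
      (Set.image_mono (Set.iInter_subset C 0))

section Cyclic

variable {k : ℕ} {q : ℝ}

/-- The matrix of `x ↦ (q x_1, x_2, …, x_k, x_0)`. -/
def cyclicMatrix (k : ℕ) (q : ℝ) : Matrix (Fin (k + 1)) (Fin (k + 1)) ℝ :=
  Matrix.of fun i j => if j = i + 1 then (if i = 0 then q else 1) else 0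

theorem cyclicMatrix_mulVec (x : Fin (k + 1) → ℝ) (i : Fin (k + 1)) :
    (cyclicMatrix k q *ᵥ x) i = (if i = 0 then q else 1) * x (i + 1) := by
  simp [cyclicMatrix, Matrix.mulVec, dotProduct]

theorem abs_det_cyclicMatrix (hq : 0 < q) : |(cyclicMatrix k q).det| = q := by
  have h1 : cyclicMatrix k q = Matrix.diagonal (fun i => if i = 0 then q else 1) *
      (finRotate (k + 1)).permMatrix ℝ := by
    ext i j
    rw [Matrix.diagonal_mul, Equiv.Perm.permMatrix, PEquiv.toMatrix_apply]
    simp [cyclicMatrix, eq_comm]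
  rw [h1, Matrix.det_mul, Matrix.det_diagonal, Matrix.det_permutation, abs_mul]
  rcases Int.units_eq_one_or (Equiv.Perm.sign (finRotate (k + 1))) with h | h <;>
    simp [h, abs_of_pos hq]

/-- For an eigenvalue of modulus at most 1, the moduli of the entries of an eigenvector do not
increase around the cycle, hence are constant. At the coordinate stretched by q > 1 this forces them
to be 0. -/
theorem isExpanding_cyclicMatrix (hq : 1 < q) : IsExpanding (cyclicMatrix k q) := by
  intro z hz
  by_contra! hz1
  rw [spectrum.mem_iff, Matrix.isUnit_iff_isUnit_det, isUnit_iff_ne_zero, not_not,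
    ← Matrix.exists_mulVec_eq_zero_iff] at hz
  obtain ⟨v, hv0, hv⟩ := hz
  have hv1 : ∀ i, (if i = 0 then (q : ℂ) else 1) * v (i + 1) = z * v i := by
    intro i
    have h1 := congrFun hv i
    rw [Matrix.sub_mulVec, Pi.sub_apply, Pi.zero_apply, sub_eq_zero, Algebra.algebraMap_eq_smul_one,
      Matrix.smul_mulVec, Matrix.one_mulVec, Pi.smul_apply, smul_eq_mul] at h1
    rw [h1]
    simp only [Matrix.mulVec, dotProduct, cyclicMatrix, Matrix.map_apply, Matrix.of_apply]
    rw [Finset.sum_eq_single (i + 1)]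
    · rw [if_pos rfl]
      split_ifs <;> simp
    · intro j _ hj
      simp [hj]
    · simp
  have hle : ∀ i, ‖v (i + 1)‖ ≤ ‖v i‖ := by
    intro i
    have h1 := congrArg norm (hv1 i)
    rw [norm_mul, norm_mul] at h1
    have h2 : 1 ≤ ‖(if i = 0 then (q : ℂ) else 1)‖ := by
      split_ifs
      · rw [Complex.norm_real, Real.norm_of_nonneg (by linarith)]; exact hq.le
      · simp
    have h3 := norm_nonneg (v (i + 1))
    have h4 := norm_nonneg (v i)
    nlinarith
  have heq : ∀ i, ‖v (i + 1)‖ = ‖v i‖ := by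
    have h1 : ∑ i, ‖v (i + 1)‖ = ∑ i, ‖v i‖ :=
      Equiv.sum_comp (Equiv.addRight (1 : Fin (k + 1))) fun i => ‖v i‖
    intro i
    exact (Finset.sum_eq_sum_iff_of_le fun i _ => hle i).1 h1 i (Finset.mem_univ i)
  have h0 : ‖v 0‖ = 0 := by
    have h1 := congrArg norm (hv1 0)
    rw [norm_mul, norm_mul, heq, if_pos rfl, Complex.norm_real,
      Real.norm_of_nonneg (by linarith)] at h1
    have h2 := norm_nonneg (v 0)
    nlinarith
  refine hv0 (funext fun i => norm_eq_zero.1 ?_)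
  induction i using Fin.induction with
  | zero => exact h0
  | succ i ih => rw [← Fin.coeSucc_eq_succ, heq, ih]

theorem norm_le_norm_cyclicMatrix_mulVec (hq : 1 < q) (x : Fin (k + 1) → ℝ) :
    ‖x‖ ≤ ‖cyclicMatrix k q *ᵥ x‖ := by
  rw [pi_norm_le_iff_of_nonneg (norm_nonneg _)]
  intro i
  obtain ⟨j, rfl⟩ := (Equiv.addRight (1 : Fin (k + 1))).surjective i
  refine le_trans ?_ (norm_le_pi_norm _ j)
  rw [cyclicMatrix_mulVec, norm_mul]
  refine le_mul_of_one_le_left (norm_nonneg _) ?_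
  split_ifs
  · rw [Real.norm_of_nonneg (by linarith)]; exact hq.le
  · simp

/-- The standard bump function in the data for the cyclic matrix. -/
noncomputable def cyclicBump (k : ℕ) : ContDiffBump (0 : Fin (k + 1) → ℝ) where
  rIn := 1 / 8
  rOut := 1 / 4
  rIn_pos := by norm_num
  rIn_lt_rOut := by norm_num

/-- Data for the cyclic matrix, with the maximum norm. -/
noncomputable def cyclicData (k : ℕ) (hq : 1 < q) : AdaptedData (cyclicMatrix k q) where
  N := normSeminorm ℝ (Fin (k + 1) → ℝ)
  eq_zero_of_N := fun _ h => norm_eq_zero.1 h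
  N_le := norm_le_norm_cyclicMatrix_mulVec hq
  δ := 1 / 4
  δ_pos := by norm_num
  δ_lt := by norm_num
  φ := (cyclicBump k).normed MeasureTheory.volume
  φ_smooth := (cyclicBump k).contDiff_normed
  φ_nonneg := (cyclicBump k).nonneg_normed
  φ_even := (cyclicBump k).normed_neg
  φ_support := by
    rw [ContDiffBump.support_normed_eq]
    intro x hx
    exact mem_ball_zero_iff.1 hx
  zero_mem_tsupport := by
    refine subset_tsupport _ ?_
    rw [ContDiffBump.support_normed_eq]
    exact Metric.mem_ball_self (cyclicBump k).rOut_pos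
  φ_integral := (cyclicBump k).integral_normed

theorem exists_dustLike_system {d m : ℕ} (hd : 1 ≤ d) (hm : 0 < m) {q : ℝ} (hmq : (m : ℝ) < q) :
    ∃ (B : Matrix (Fin d) (Fin d) ℝ) (D : Fin m → Fin d → ℝ) (W : AdaptedData B)
      (K : Set (Fin d → ℝ)), IsExpanding B ∧ |B.det| = q ∧ IsAttractor (affineIFS B D) K ∧
        IsDustLike (affineIFS B D) K ∧ W.ConditionH (affineIFS B D) K := by
  obtain ⟨k, rfl⟩ : ∃ k, d = k + 1 := ⟨d - 1, by omega⟩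
  have hm1 : (1 : ℝ) ≤ m := by exact_mod_cast hm
  have hq : 1 < q := hm1.trans_lt hmq
  have hB := isExpanding_cyclicMatrix (k := k) hq
  have hdet := hB.isUnit_det
  -- The images of the unit cube are slabs of thickness 1/q starting at the multiples i/m in the
  -- coordinate 0 + 1; they are disjoint because 1/q < 1/m.
  set D : Fin m → Fin (k + 1) → ℝ := fun i => Pi.single 0 (i * (q / m)) with hD
  set Q : Set (Fin (k + 1) → ℝ) := Set.Icc 0 1 with hQ
  have himage : ∀ i, ∀ x ∈ Q, ∀ j, (if j = 0 then q else 1) *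
      affineIFS (cyclicMatrix k q) D i x (j + 1) = x j + D i j := by
    intro i x _ j
    rw [← cyclicMatrix_mulVec, affineIFS, Matrix.mulVec_mulVec, Matrix.mul_nonsing_inv _ hdet,
      Matrix.one_mulVec, Pi.add_apply]
  have hs : 1 < q / m := (one_lt_div (by linarith)).2 hmq
  have hsub : ∀ i, affineIFS (cyclicMatrix k q) D i '' Q ⊆ Q := by
    rintro i _ ⟨x, hx, rfl⟩
    have key : ∀ j, 0 ≤ affineIFS (cyclicMatrix k q) D i x (j + 1) ∧
        affineIFS (cyclicMatrix k q) D i x (j + 1) ≤ 1 := by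
      intro j
      have h1 := himage i x hx j
      have h2 : 0 ≤ x j := hx.1 j
      have h3 : x j ≤ 1 := hx.2 j
      by_cases hj : j = 0
      · subst hj
        simp only [if_true, hD, Pi.single_eq_same] at h1
        have h4 : (0 : ℝ) ≤ (i : ℕ) * (q / m) := by positivity
        have h5 : ((i : ℕ) : ℝ) + 1 ≤ m := by exact_mod_cast i.2
        have h6 : (((i : ℕ) : ℝ) + 1) * (q / m) ≤ m * (q / m) :=
          mul_le_mul_of_nonneg_right h5 (by positivity)
        have h7 : (m : ℝ) * (q / m) = q := by field_simp
        constructor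
        · by_contra! h
          nlinarith
        · by_contra! h
          nlinarith
      · simp only [hj, if_false, one_mul, hD, ne_eq, not_false_eq_true, Pi.single_eq_of_ne,
          add_zero] at h1
        rw [h1]
        exact ⟨h2, h3⟩
    constructor
    · intro j
      obtain ⟨j, rfl⟩ := (Equiv.addRight (1 : Fin (k + 1))).surjective j
      exact (key j).1
    · intro j
      obtain ⟨j, rfl⟩ := (Equiv.addRight (1 : Fin (k + 1))).surjective j
      exact (key j).2
  have hdisj : ∀ i j, i ≠ j → Disjoint (affineIFS (cyclicMatrix k q) D i '' Q)
      (affineIFS (cyclicMatrix k q) D j '' Q) := by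
    intro i j hij
    wlog hlt : i < j generalizing i j
    · exact (this j i hij.symm (lt_of_le_of_ne (not_lt.1 hlt) hij.symm)).symm
    refine Set.disjoint_left.2 ?_
    rintro _ ⟨x, hx, rfl⟩ ⟨y, hy, hxy⟩
    have h1 := himage i x hx 0
    have h2 := himage j y hy 0
    rw [hxy, h1] at h2
    simp only [hD, Pi.single_eq_same] at h2
    have h3 : x 0 ≤ 1 := hx.2 0
    have h4 : 0 ≤ y 0 := hy.1 0
    have h5 : ((i : ℕ) : ℝ) + 1 ≤ (j : ℕ) := by exact_mod_cast hlt
    nlinarith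
  obtain ⟨K, hK, hdust⟩ := exists_isAttractor_of_disjoint hm
    (fun i => by unfold affineIFS; fun_prop) (injective_affineIFS hdet) isCompact_Icc
    ⟨0, le_rfl, zero_le_one⟩ hsub hdisj
  refine ⟨_, D, cyclicData k hq, K, hB, abs_det_cyclicMatrix (by linarith), hK, hdust, ?_⟩
  refine AdaptedData.conditionH_of_isDustLike _ (fun _ => rfl) ?_ hd hB hK hdust
  change Function.support ((cyclicBump k).normed MeasureTheory.volume) = _
  rw [ContDiffBump.support_normed_eq]
  ext x
  exact mem_ball_zero_iff

end Cyclic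

/-! ### The main theorem -/

section Main

theorem IsSizeVector.exists_ncard_le {E : Type*} {m r : ℕ} {S : Fin m → E → E} {J : Set E}
    {e : ConnectedClass S J ≃ Fin r} {b : Fin r → ℕ} (hb : IsSizeVector S J e b) :
    ∃ M : ℕ, ∀ T : HComponent S J, T.supp.ncard ≤ M :=
  ⟨Finset.univ.sup b, fun T => hb T ▸ Finset.le_sup (Finset.mem_univ _)⟩

theorem IsIncidenceMatrix.exists_equiv {E : Type*} {m r : ℕ} {S : Fin m → E → E} {J : Set E}
    {e : ConnectedClass S J ≃ Fin r} {A : Matrix (Fin r) (Fin r) ℕ} {b : Fin r → ℕ}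
    (hA : IsIncidenceMatrix S J e A) (hb : IsSizeVector S J e b) (hJ : ∀ i, S i '' J ⊆ J)
    (hm : 0 < m) (hAb : IsRearrangeable m b A ∨ IsPrimitiveMatrix A) :
    ∃ (c : ℕ) (σ : List (Fin m) ≃ List (Fin m)), (∀ x, (σ x).length = x.length) ∧
      (∀ x y, confluence (HRel S J) x y ≤ confluence (· = ·) (σ x) (σ y) + c) ∧
      ∀ x y, confluence (· = ·) (σ x) (σ y) ≤ confluence (HRel S J) x y + c := by
  obtain ⟨k, hk, hr⟩ : ∃ k : ℕ, 0 < k ∧ IsRearrangeable (m ^ k) b (A ^ k) := by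
    rcases hAb with h | h
    · exact ⟨1, one_pos, by rwa [pow_one, pow_one]⟩
    · exact h.exists_isRearrangeable_pow hJ hA hb
  obtain ⟨σ, hσ⟩ := exists_equiv_of_isRearrangeable hJ hm hk hA hb hr
  exact ⟨2 * k, σ, hσ⟩

variable {d m : ℕ} {B : Matrix (Fin d) (Fin d) ℝ} {D : Fin m → Fin d → ℝ}
  {K : Set (Fin d → ℝ)}

theorem lipschitzEquivalent_verticalBoundary {J : Set (Fin d → ℝ)} (hd : 1 ≤ d) (hm : 0 < m)
    (hB : IsExpanding B) (hJ : IsBoundedInvariant (affineIFS B D) J) {r : ℕ}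
    {e : ConnectedClass (affineIFS B D) J ≃ Fin r} {A : Matrix (Fin r) (Fin r) ℕ} {b : Fin r → ℕ}
    (hA : IsIncidenceMatrix (affineIFS B D) J e A) (hb : IsSizeVector (affineIFS B D) J e b)
    (hAb : IsRearrangeable m b A ∨ IsPrimitiveMatrix A) (W : AdaptedData B)
    (hK : IsAttractor (affineIFS B D) K) (hH : W.ConditionH (affineIFS B D) K) :
    LipschitzEquivalent (W.wDist K)
      (fun ξ η : HyperbolicBoundary (verticalGraph m) [] (visualExponent B) => dist ξ η) := by
  obtain ⟨M, hM⟩ := hb.exists_ncard_le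
  obtain ⟨c, σ, -, h1, h2⟩ := hA.exists_equiv hb hJ.2.2.2 hm hAb
  exact (lipschitzEquivalent_hyperbolicBoundary hd hB hJ hM W hK hH).trans
    (lipschitzEquivalent_boundary_of_confluence (isLevelGraph_augmentedTree hJ.2.2.2 hM)
      isLevelGraph_vertical σ h1 h2 (hB.visualExponent_pos hd))

theorem IsDustLike.lipschitzEquivalent_verticalBoundary (hd : 1 ≤ d) (hB : IsExpanding B)
    (W : AdaptedData B) (hK : IsAttractor (affineIFS B D) K) (hdust : IsDustLike (affineIFS B D) K)
    (hH : W.ConditionH (affineIFS B D) K) :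
    LipschitzEquivalent (W.wDist K)
      (fun ξ η : HyperbolicBoundary (verticalGraph m) [] (visualExponent B) => dist ξ η) := by
  -- With K itself as invariant set, all horizontal components are singletons.
  have hJ := isBoundedInvariant_of_isAttractor hK
  have hrel := hRel_eq_of_disjoint (injective_affineIFS hB.isUnit_det) hK.image_subset hdust
  have hM : ∀ T : HComponent (affineIFS B D) K, T.supp.ncard ≤ 1 := by
    intro T
    rw [Set.ncard_le_one (T.finite_supp hJ.2.2.2)]
    intro u hu v hv
    have huv : HRel (affineIFS B D) K u v :=
      SimpleGraph.ConnectedComponent.exact (Eq.trans hu (Eq.symm hv))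
    rwa [hrel] at huv
  have hG := isLevelGraph_augmentedTree hJ.2.2.2 hM
  rw [hrel] at hG
  exact (lipschitzEquivalent_hyperbolicBoundary hd hB hJ hM W hK hH).trans
    (lipschitzEquivalent_boundary_of_confluence hG isLevelGraph_vertical (Equiv.refl _) (c := 0)
      (fun _ _ => le_rfl) (fun _ _ => le_rfl) (hB.visualExponent_pos hd))

theorem visualExponent_congr {B' : Matrix (Fin d) (Fin d) ℝ} (h : |B'.det| = |B.det|) :
    visualExponent B' = visualExponent B := by
  rw [visualExponent, visualExponent, h]

end Main

theorem theorem3p12 {d m : ℕ} (hd : 1 ≤ d) (hm : 1 ≤ m)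
    -- a self-affine system whose augmented tree (defined by `J`) is simple, with incidence matrix
    -- `A` and vector `b` of component sizes
    (B : Matrix (Fin d) (Fin d) ℝ) (hB : IsExpanding B) (D : Fin m → Fin d → ℝ)
    (J : Set (Fin d → ℝ)) (hJ : IsBoundedInvariant (affineIFS B D) J)
    (hS : IsSimpleTree (affineIFS B D) J)
    (r : ℕ) (e : ConnectedClass (affineIFS B D) J ≃ Fin r)
    (A : Matrix (Fin r) (Fin r) ℕ) (hA : IsIncidenceMatrix (affineIFS B D) J e A)
    (b : Fin r → ℕ) (hb : IsSizeVector (affineIFS B D) J e b)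
    (hAb : IsRearrangeable m b A ∨ IsPrimitiveMatrix A) :
    -- the augmented tree and the tree have Lipschitz equivalent hyperbolic boundaries
    ((∃ δ : ℝ, 0 < δ ∧ IsHyperbolicWith (augmentedTree (affineIFS B D) J) [] δ) ∧
      (IsRearrangeable m b A →
        ∃ σ, IsNearIsometry (augmentedTree (affineIFS B D) J) (verticalGraph m) σ) ∧
      (IsPrimitiveMatrix A → ∃ k : ℕ, 0 < k ∧ IsRearrangeable (m ^ k) b (A ^ k)) ∧
      (∀ δ a : ℝ, 0 < δ → 0 < a →
        IsHyperbolicWith (augmentedTree (affineIFS B D) J) [] δ →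
        Real.exp (δ * a) - 1 < √2 - 1 →
        LipschitzEquivalent
          (fun ξ η : HyperbolicBoundary (augmentedTree (affineIFS B D) J) [] a => dist ξ η)
          (fun ξ η : HyperbolicBoundary (verticalGraph m) [] a => dist ξ η))) ∧
    -- the self-affine sets `K` and `K'` of two such systems with condition (H) are Lipschitz
    -- equivalent to each other and to a dust-like self-affine set `K''`
    (∀ (W : AdaptedData B) (K : Set (Fin d → ℝ)), IsAttractor (affineIFS B D) K →
      W.ConditionH (affineIFS B D) K →
      ∀ (B' : Matrix (Fin d) (Fin d) ℝ) (D' : Fin m → Fin d → ℝ) (J' : Set (Fin d → ℝ))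
        (r' : ℕ) (e' : ConnectedClass (affineIFS B' D') J' ≃ Fin r')
        (A' : Matrix (Fin r') (Fin r') ℕ) (b' : Fin r' → ℕ)
        (W' : AdaptedData B') (K' : Set (Fin d → ℝ)),
      IsExpanding B' → |B'.det| = |B.det| →
      IsBoundedInvariant (affineIFS B' D') J' →
      IsSimpleTree (affineIFS B' D') J' →
      IsIncidenceMatrix (affineIFS B' D') J' e' A' →
      IsSizeVector (affineIFS B' D') J' e' b' →
      (IsRearrangeable m b' A' ∨ IsPrimitiveMatrix A') →
      IsAttractor (affineIFS B' D') K' →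
      W'.ConditionH (affineIFS B' D') K' →
      LipschitzEquivalent (W.wDist K) (W'.wDist K') ∧
      ∃ (B'' : Matrix (Fin d) (Fin d) ℝ) (D'' : Fin m → Fin d → ℝ) (W'' : AdaptedData B'')
        (K'' : Set (Fin d → ℝ)),
        IsExpanding B'' ∧ |B''.det| = |B.det| ∧
        IsAttractor (affineIFS B'' D'') K'' ∧ IsDustLike (affineIFS B'' D'') K'' ∧
        LipschitzEquivalent (W.wDist K) (W''.wDist K'') ∧
        LipschitzEquivalent (W'.wDist K') (W''.wDist K'')) := by
  have hm' : 0 < m := hm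
  obtain ⟨M, hM⟩ := hb.exists_ncard_le
  have hG := isLevelGraph_augmentedTree hJ.2.2.2 hM
  refine ⟨⟨⟨2 * M + 1, by positivity, hG.isHyperbolicWith⟩, fun h => ?_,
    fun h => h.exists_isRearrangeable_pow hJ.2.2.2 hA hb, fun _ a _ ha _ _ => ?_⟩, ?_⟩
  · obtain ⟨c, σ, hσ, h1, h2⟩ := hA.exists_equiv hb hJ.2.2.2 hm' (Or.inl h)
    exact ⟨σ, isNearIsometry_of_confluence hG isLevelGraph_vertical σ h1 h2 hσ⟩
  · obtain ⟨c, σ, -, h1, h2⟩ := hA.exists_equiv hb hJ.2.2.2 hm' hAb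
    exact lipschitzEquivalent_boundary_of_confluence hG isLevelGraph_vertical σ h1 h2 ha
  · intro W K hK hH B' D' J' r' e' A' b' W' K' hB' hdet hJ' _ hA' hb' hAb' hK' hH'
    have h1 := lipschitzEquivalent_verticalBoundary hd hm' hB hJ hA hb hAb W hK hH
    have h2 := lipschitzEquivalent_verticalBoundary hd hm' hB' hJ' hA' hb' hAb' W' hK' hH'
    rw [visualExponent_congr hdet] at h2
    -- All three sets are compared with the boundary of the same m-ary tree, at the exponent
    -- determined by |det B| and d.
    obtain ⟨B'', D'', W'', K'', hB'', hdet'', hK'', hdust, hH''⟩ := exists_dustLike_system hd hm'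
      (natCast_lt_abs_det hd hB hJ hM W hK hH)
    have h3 := hdust.lipschitzEquivalent_verticalBoundary hd hB'' W'' hK'' hH''
    rw [visualExponent_congr hdet''] at h3
    exact ⟨h1.trans h2.symm, B'', D'', W'', K'', hB'', hdet'', hK'', hdust, h1.trans h3.symm,
      h2.trans h3.symm⟩
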